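/- **Theorem.** Let $N\in\mathbb N$, $1<p<N$, $0\le\mu<\left(\frac{N-p}{p}\right)^p$, $A>0$ and $\alpha<p$. Let $\gamma_1\ge 0$ be the smaller of the two roots in $[0,\infty)$ of $$\gamma^{p-2}\left[(p-1)\gamma^2-(N-p)\gamma\right]+\mu=0 .$$ There are constants $C>0$ and $R_0>0$, depending only on $N,p,\mu,A,\alpha$, such that the following holds. Let $\Omega\subset\mathbb R^N$ be a bounded domain containing $0$, let $f\in L^{N/p}(\Omega)$ satisfy $f(x)\le A|x|^{-\alpha}$ for a.e. $x\in\Omega$, and let $u\in\mathcal D^{1,p}(\Omega)=\{v\in L^{Np/(N-p)}(\Omega): v \text{ weakly differentiable},\ \nabla v\in L^p(\Omega)\}$ be a weak subsolution of $$-\Delta_p u-\frac{\mu}{|x|^p}|u|^{p-2}u=f|u|^{p-2}u\quad\text{in }\Omega,$$ that is, for all $0\le\varphi\in C_0^\infty(\Omega)$, $$\int_\Omega\left(|\nabla u|^{p-2}\nabla u\cdot\nabla\varphi-\frac{\mu}{|x|^p}|u|^{p-2}u\,\varphi\right)\le\int_\Omega f|u|^{p-2}u\,\varphi .$$ Then for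 every $R\in(0,R_0]$ such that the open ball $B_R=B_R(0)$ is contained in $\Omega$, $$u(x)\le C\,M_R\,|x|^{-\gamma_1}\quad\text{for a.e. }x\in B_R,\qquad M_R=\sup_{\partial B_R}u^+\in[0,\infty].$$ In particular, this holds with $R=R_0$ when $B_{R_0}\subset\Omega$. Here the supremum over $\partial B_R$ is taken in the sense of Sobolev functions: $\sup_{\partial B_R}u^+$ is the infimum of the $k\ge 0$ with $(u^+-k)^+\in W^{1,p}_0(B_R)$ ($\infty$ if there is no such $k$); it is the ordinary supremum if $u$ is continuous near $\partial B_R$. -/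

import Mathlib

open MeasureTheory Set Metric
open scoped ENNReal NNReal ContDiff

noncomputable section

/-- The nonnegative roots `γ` of `γ^(p-2) * ((p-1) γ^2 - (N-p) γ) + μ = 0`.
(At `γ = 0` the bracket vanishes, so `0` is a root exactly when `μ = 0`, as it should be for the
continuous extension `(p-1) γ^p - (N-p) γ^(p-1) + μ`.) -/
def gammaRoots (N : ℕ) (p μ : ℝ) : Set ℝ :=
  {γ | 0 ≤ γ ∧ γ ^ (p - 2) * ((p - 1) * γ ^ 2 - ((N : ℝ) - p) * γ) + μ = 0}

/-- The exponent `γ₁`: the smaller root. See `isLeast_gammaOne`. -/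
def gammaOne (N : ℕ) (p μ : ℝ) : ℝ := sInf (gammaRoots N p μ)

theorem gammaRoots_eq {N : ℕ} {p μ : ℝ} (hp : 1 < p) :
    gammaRoots N p μ =
      Ici 0 ∩ {γ | (p - 1) * γ ^ p - ((N : ℝ) - p) * γ ^ (p - 1) + μ = 0} := by
  ext γ
  simp only [gammaRoots, mem_ofPred_eq, mem_inter_iff, mem_Ici]
  refine and_congr_right fun h0 => ?_
  have key : γ ^ (p - 2) * ((p - 1) * γ ^ 2 - ((N : ℝ) - p) * γ)
      = (p - 1) * γ ^ p - ((N : ℝ) - p) * γ ^ (p - 1) := by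
    rcases h0.eq_or_lt with h | h
    · subst h
      rw [Real.zero_rpow (by linarith : p ≠ 0), Real.zero_rpow (by linarith : p - 1 ≠ 0)]
      simp
    · have e1 : γ ^ p = γ ^ (p - 2) * γ ^ 2 := by
        rw [← Real.rpow_natCast, ← Real.rpow_add h]; norm_num
      have e2 : γ ^ (p - 1) = γ ^ (p - 2) * γ := by
        rw [← Real.rpow_add_one h.ne']; congr 1; ring
      rw [e1, e2]; ring
  rw [key]

/-- In the admissible range of the parameters, `gammaOne` really is the least nonnegative root. -/
theorem isLeast_gammaOne {N : ℕ} {p μ : ℝ} (hp : 1 < p) (hpN : p < N) (hμ0 : 0 ≤ μ)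
    (hμ : μ < (((N : ℝ) - p) / p) ^ p) : IsLeast (gammaRoots N p μ) (gammaOne N p μ) := by
  have hcont : Continuous
      fun γ : ℝ => (p - 1) * γ ^ p - ((N : ℝ) - p) * γ ^ (p - 1) + μ :=
    ((continuous_const.mul (Real.continuous_rpow_const (by linarith))).sub
      (continuous_const.mul (Real.continuous_rpow_const (by linarith)))).add continuous_const
  have hbdd : BddBelow (gammaRoots N p μ) := ⟨0, fun _ h => h.1⟩
  have hclosed : IsClosed (gammaRoots N p μ) := by
    rw [gammaRoots_eq hp]
    exact isClosed_Ici.inter (isClosed_eq hcont continuous_const)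
  have hne : (gammaRoots N p μ).Nonempty := by
    rw [gammaRoots_eq hp]
    have hb : 0 < ((N : ℝ) - p) / p := div_pos (by linarith) (by linarith)
    set b := ((N : ℝ) - p) / p with hbdef
    have hivt := intermediate_value_Icc' hb.le hcont.continuousOn
    have h0 : (p - 1) * (0 : ℝ) ^ p - ((N : ℝ) - p) * (0 : ℝ) ^ (p - 1) + μ = μ := by
      rw [Real.zero_rpow (by linarith : p ≠ 0), Real.zero_rpow (by linarith : p - 1 ≠ 0)]
      ring
    have hfb : (p - 1) * b ^ p - ((N : ℝ) - p) * b ^ (p - 1) + μ ≤ 0 := by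
      have e1 : b ^ p = b ^ (p - 1) * b := by
        rw [← Real.rpow_add_one hb.ne']; congr 1; ring
      have e2 : (N : ℝ) - p = p * b := by
        rw [hbdef]; field_simp
      rw [e2]
      have : (p - 1) * b ^ p - p * b * b ^ (p - 1) = - b ^ p := by rw [e1]; ring
      linarith
    obtain ⟨γ, hγ, hγ0⟩ := hivt ⟨hfb, by simpa only [h0] using hμ0⟩
    exact ⟨γ, hγ.1, hγ0⟩
  exact ⟨hclosed.csInf_mem hne hbdd, fun γ h => csInf_le hbdd h⟩

/-- `φ ∈ C₀^∞(Ω)`, extended by zero to the whole space. -/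
def IsTestFunction {N : ℕ} (Ω : Set (EuclideanSpace ℝ (Fin N)))
    (φ : EuclideanSpace ℝ (Fin N) → ℝ) : Prop :=
  ContDiff ℝ ∞ φ ∧ HasCompactSupport φ ∧ tsupport φ ⊆ Ω

/-- `G` is the weak gradient of `u` in the open set `Ω`:
`∫_Ω u ∇φ = - ∫_Ω φ G` for all `φ ∈ C₀^∞(Ω)`. -/
def HasWeakGradient {N : ℕ} (Ω : Set (EuclideanSpace ℝ (Fin N)))
    (u : EuclideanSpace ℝ (Fin N) → ℝ)
    (G : EuclideanSpace ℝ (Fin N) → EuclideanSpace ℝ (Fin N)) : Prop :=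
  LocallyIntegrableOn u Ω ∧ LocallyIntegrableOn G Ω ∧
    ∀ φ : EuclideanSpace ℝ (Fin N) → ℝ, IsTestFunction Ω φ →
      ∫ x in Ω, u x • gradient φ x = - ∫ x in Ω, φ x • G x

/-- `u ∈ 𝒟^{1,p}(Ω)` with weak gradient `G`: `u ∈ L^{p*}(Ω)`, `p* = N p / (N - p)`, and
`G = ∇u ∈ L^p(Ω)`. -/
def MemD1p {N : ℕ} (Ω : Set (EuclideanSpace ℝ (Fin N))) (p : ℝ)
    (u : EuclideanSpace ℝ (Fin N) → ℝ)
    (G : EuclideanSpace ℝ (Fin N) → EuclideanSpace ℝ (Fin N)) : Prop :=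
  MemLp u (ENNReal.ofReal (N * p / (N - p))) (volume.restrict Ω) ∧
    HasWeakGradient Ω u G ∧ MemLp G (ENNReal.ofReal p) (volume.restrict Ω)

/-- `u ∈ 𝒟^{1,p}(Ω)` is a weak subsolution in `Ω` of
`-Δ_p u - μ |x|^{-p} |u|^{p-2} u = f |u|^{p-2} u`. The gradient is determined by `u` up to a
null set, so it does not matter which one is taken. -/
def IsWeakSubsolution {N : ℕ} (Ω : Set (EuclideanSpace ℝ (Fin N))) (p μ : ℝ)
    (f u : EuclideanSpace ℝ (Fin N) → ℝ) : Prop :=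
  ∃ G : EuclideanSpace ℝ (Fin N) → EuclideanSpace ℝ (Fin N), MemD1p Ω p u G ∧
    ∀ φ : EuclideanSpace ℝ (Fin N) → ℝ, IsTestFunction Ω φ → (∀ x, 0 ≤ φ x) →
      ∫ x in Ω, (‖G x‖ ^ (p - 2) * inner ℝ (G x) (gradient φ x)
          - μ / ‖x‖ ^ p * (|u x| ^ (p - 2) * u x) * φ x)
        ≤ ∫ x in Ω, f x * (|u x| ^ (p - 2) * u x) * φ x

/-- `w ∈ W₀^{1,p}(U)`: `w ∈ W^{1,p}(U)` is a limit of `C₀^∞(U)` functions in the `W^{1,p}(U)`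
norm. -/
def MemW1p0 {N : ℕ} (U : Set (EuclideanSpace ℝ (Fin N))) (p : ℝ)
    (w : EuclideanSpace ℝ (Fin N) → ℝ) : Prop :=
  ∃ G : EuclideanSpace ℝ (Fin N) → EuclideanSpace ℝ (Fin N),
    MemLp w (ENNReal.ofReal p) (volume.restrict U) ∧
    MemLp G (ENNReal.ofReal p) (volume.restrict U) ∧
    HasWeakGradient U w G ∧
    ∀ ε : ℝ≥0∞, 0 < ε → ∃ φ : EuclideanSpace ℝ (Fin N) → ℝ, IsTestFunction U φ ∧
      eLpNorm (fun x => φ x - w x) (ENNReal.ofReal p) (volume.restrict U) ≤ ε ∧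
      eLpNorm (fun x => gradient φ x - G x) (ENNReal.ofReal p) (volume.restrict U) ≤ ε

/-- `sup_{∂U} w` for a nonnegative Sobolev function `w` on `U`, with values in `[0, ∞]`, in the
usual sense of Sobolev spaces: `w ≤ k` on `∂U` means that `(w - k)⁺ ∈ W₀^{1,p}(U)`, and
`sup_{∂U} w` is the infimum of all such constants `k` (it is `∞` if there are none).
For `U` a ball and `w` continuous near `∂U` it is the ordinary supremum of `w` over `∂U`. -/
def boundarySup {N : ℕ} (U : Set (EuclideanSpace ℝ (Fin N))) (p : ℝ)
    (w : EuclideanSpace ℝ (Fin N) → ℝ) : ℝ≥0∞ :=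
  ⨅ (k : ℝ≥0) (_ : MemW1p0 U p (fun x => max (w x - k) 0)), (k : ℝ≥0∞)

end

open MeasureTheory Set Metric Filter Topology
open scoped ENNReal NNReal ContDiff

/-! ### Radial integration by parts and Hardy's inequality. -/

section RadialIntegrals

variable {N : ℕ}

/-! The barrier. For a positive decreasing radial function $W$ put $q=-rW'/W$. Then
$-\Delta_pW=r^{-p}W^{p-1}\left[(N-p)q^{p-1}-(p-1)q^p+(p-1)\,rq'\,q^{p-2}\right]$, so $W$ is a
supersolution as soon as the bracket is at least $\mu+A r^{p-\alpha}$. The constant $q=\gamma_1$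
gives exactly $\mu$. Taking $q=\gamma_1+r^e$ gains twice: $t\mapsto(N-p)t^{p-1}-(p-1)t^p$ increases
up to $(N-p)/p$, and $\gamma_1$ lies strictly below that value because $\mu$ is below Hardy's
constant; moreover the term with $rq'=er^e$, for a suitable $e$, beats any multiple of
$r^{p-\alpha}$ near $0$ (`exists_riccati_supersolution`). Integrating $q$ gives
$W=\kappa(R/r)^{\gamma_1}\exp((R^e-r^e)/e)$, which equals $\kappa$ on $\partial B_R$ and is at most
$e^{1/e}\kappa r^{-\gamma_1}$ when $R\le1$. It remains to show $u\le W$ for every $\kappa>M_R$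
(`le_barrier_of_weakSubsolution`).

The comparison. It rests on the $(p-1)$-homogeneity of the equation. With $\theta=u/W$, the
inequality for $u$ is tested with $W\theta g(\theta)$ and the one for $W$ with $W\theta^pg(\theta)$,
where $g$ vanishes on $[0,1]$. The gradient terms combine into $g$ times Picone's expression plus
$\theta g'$ times the monotonicity expression of the $p$-Laplacian, both nonnegative if $g$ is
nondecreasing (`picone_lower_bound`). The barrier is built with $A+1$ instead of $A$, so the lower
order terms leave $\int|x|^{-\alpha}u^pg(\theta)\le0$, whence $\theta\le1$.

Since $\theta$ is not known to be bounded, $g$ is cut off beyond a level $m$. The decreasing part of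
$g$ costs a multiple of $\int_{\{\theta\ge m\}}(|\nabla u|^p+|\theta\nabla W|^p)$. As $|\nabla
W|\le\frac{N-p}{p}W/|x|$, Hardy's inequality makes the integrand integrable, and the error vanishes
as $m\to\infty$.

Admissibility. Only smooth test functions are allowed and $W$ may be singular at $0$. So
$z=(u^+-k)^+$ with $k<\kappa$ is approximated by test functions $\psi_n$ vanishing near $0$, which
is possible because points have zero $p$-capacity, and $\theta$ is replaced by $(k+\psi_n)/W$. This
ratio exceeds $1$ only where $\psi_n>0$, so the competitors are test functions in the punctured
ball. In the limit $z$ has the same gradient as $u$ on $\{z>0\}$. -/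

theorem norm_gradient {F : Type*} [NormedAddCommGroup F] [InnerProductSpace ℝ F] [CompleteSpace F]
    (f : F → ℝ) (x : F) : ‖gradient f x‖ = ‖fderiv ℝ f x‖ := by
  rw [← toDual_gradient, LinearIsometryEquiv.norm_map]

theorem integrableOn_norm_rpow_neg_ball (hN : 0 < N) {s : ℝ} (hs : s < N) (R : ℝ) :
    IntegrableOn (fun x : EuclideanSpace ℝ (Fin N) => ‖x‖ ^ (-s)) (ball 0 R) := by
  have : Nonempty (Fin N) := ⟨⟨0, hN⟩⟩
  rcases le_or_gt R 0 with hR | hR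
  · rw [ball_eq_empty.2 hR]; exact integrableOn_empty
  rw [integrableOn_fun_norm_addHaar (E := EuclideanSpace ℝ (Fin N)) volume
    (f := fun y : ℝ => y ^ (-s)), finrank_euclideanSpace_fin]
  have : IntegrableOn (fun y : ℝ => y ^ ((N : ℝ) - 1 - s)) (Ioo 0 R) :=
    (intervalIntegral.integrableOn_Ioo_rpow_iff hR).2 (by linarith)
  refine this.congr_fun (fun y hy => ?_) measurableSet_Ioo
  simp only [smul_eq_mul]
  rw [← Real.rpow_natCast, ← Real.rpow_add hy.1, Nat.cast_sub hN]
  congr 1; push_cast; ring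

/-- The field $h(x)x$ has divergence $Nh+Dh(x)x$ and compact support, so its divergence integrates
to zero; each coordinate contributes one $-\int h$. -/
theorem integral_fderiv_apply_self {h : EuclideanSpace ℝ (Fin N) → ℝ} (hh : ContDiff ℝ 1 h)
    (hc : HasCompactSupport h) : ∫ x, fderiv ℝ h x x = -∫ x, N * h x := by
  have hcd : HasCompactSupport (fderiv ℝ h) := hc.fderiv ℝ
  have hcont : Continuous (fderiv ℝ h) := hh.continuous_fderiv (by norm_num)
  let e : Fin N → EuclideanSpace ℝ (Fin N) := fun i => EuclideanSpace.single i 1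
  let c : Fin N → EuclideanSpace ℝ (Fin N) →L[ℝ] ℝ := fun i => EuclideanSpace.proj i
  have hce : ∀ i, c i (e i) = 1 := fun i => by simp [c, e]
  have hi : ∀ i, Integrable (fun x => c i x * fderiv ℝ h x (e i)) := fun i => by
    refine Continuous.integrable_of_hasCompactSupport (by fun_prop) ?_
    exact (hcd.mono (fun x hx => by
      contrapose! hx; simp only [Function.mem_support, not_not] at hx ⊢; simp [hx]))
  have key : ∀ i, ∫ x, c i x * fderiv ℝ h x (e i) = -∫ x, h x := fun i => by
    have := integral_mul_fderiv_eq_neg_fderiv_mul_of_integrable (μ := volume)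
      (f := fun x => c i x) (g := h) (v := e i) ?_ (hi i) ?_
      (fun x _ => (c i).differentiableAt) (fun x _ => hh.differentiable (by norm_num) x)
    · rw [this]; congr 1; refine integral_congr_ae (ae_of_all _ fun x => ?_)
      change fderiv ℝ (⇑(c i)) x (e i) * h x = h x
      rw [ContinuousLinearMap.fderiv, hce, one_mul]
    · change Integrable (fun x => fderiv ℝ (⇑(c i)) x (e i) * h x)
      simp only [ContinuousLinearMap.fderiv, hce, one_mul]
      exact hh.continuous.integrable_of_hasCompactSupport hc
    · exact Continuous.integrable_of_hasCompactSupport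
        ((c i).continuous.mul hh.continuous) hc.mul_left
  have hsum : ∀ x, fderiv ℝ h x x = ∑ i, c i x * fderiv ℝ h x (e i) := fun x => by
    have hx : x = ∑ i, c i x • e i := by
      ext j; simp [c, e, Pi.single_apply]
    conv_lhs => rw [hx]
    rw [map_sum, ← hx]; simp
  simp_rw [hsum]
  rw [integral_finsetSum _ (fun i _ => hi i), Finset.sum_congr rfl (fun i _ => key i),
    integral_const_mul]
  simp

/-- The divergence theorem for the field `x ↦ S x • x` away from the origin. -/
theorem integral_mul_fderiv_apply_self {S φ : EuclideanSpace ℝ (Fin N) → ℝ}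
    (hS : ∀ x, x ≠ 0 → ContDiffAt ℝ 1 S x) (hφ : ContDiff ℝ 1 φ) (hc : HasCompactSupport φ)
    (h0 : (0 : EuclideanSpace ℝ (Fin N)) ∉ tsupport φ) :
    Integrable (fun x => S x * fderiv ℝ φ x x) ∧
    Integrable (fun x => (N * S x + fderiv ℝ S x x) * φ x) ∧
    ∫ x, S x * fderiv ℝ φ x x = -∫ x, (N * S x + fderiv ℝ S x x) * φ x := by
  have ev : ∀ x, x ∉ tsupport φ → φ =ᶠ[𝓝 x] 0 := fun x hx =>
    notMem_tsupport_iff_eventuallyEq.1 hx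
  have hh : ContDiff ℝ 1 (fun x => S x * φ x) := contDiff_iff_contDiffAt.2 fun x => by
    by_cases hx : x ∈ tsupport φ
    · exact (hS x (by rintro rfl; exact h0 hx)).mul hφ.contDiffAt
    · refine (contDiffAt_const (c := (0 : ℝ))).congr_of_eventuallyEq ?_
      filter_upwards [ev x hx] with y hy; simp [hy]
  have hhc : HasCompactSupport (fun x => S x * φ x) := hc.mul_left
  have hd : ∀ x, fderiv ℝ (fun x => S x * φ x) x x
      = S x * fderiv ℝ φ x x + fderiv ℝ S x x * φ x := fun x => by
    by_cases hx : x ∈ tsupport φ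
    · have := fderiv_fun_mul ((hS x (by rintro rfl; exact h0 hx)).differentiableAt (by norm_num))
        (hφ.differentiable (by norm_num) x)
      rw [this]; simp; ring
    · have h1 : (fun x => S x * φ x) =ᶠ[𝓝 x] fun _ => 0 := by
        filter_upwards [ev x hx] with y hy; simp [hy]
      have h2 : fderiv ℝ φ x = 0 := by
        rw [(ev x hx).fderiv_eq]; exact fderiv_const_apply (0 : ℝ)
      rw [h1.fderiv_eq, h2, (ev x hx).eq_of_nhds]; simp
  have hcont : ∀ x, ContinuousAt (fun x => S x * fderiv ℝ φ x x) x := fun x => by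
    by_cases hx : x ∈ tsupport φ
    · exact (hS x (by rintro rfl; exact h0 hx)).continuousAt.mul
        (((hφ.continuous_fderiv (by norm_num)).clm_apply continuous_id).continuousAt)
    · refine (continuousAt_const (y := (0 : ℝ))).congr ?_
      filter_upwards [(isClosed_tsupport φ).isOpen_compl.mem_nhds hx] with y hy
      have h2 : fderiv ℝ φ y = 0 := by
        rw [(ev y hy).fderiv_eq]; exact fderiv_const_apply (0 : ℝ)
      simp [h2]
  have I1 : Integrable (fun x => S x * fderiv ℝ φ x x) := by
    refine (continuous_iff_continuousAt.2 hcont).integrable_of_hasCompactSupport ?_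
    exact (hc.fderiv ℝ).mono (fun x hx => by
      contrapose! hx; simp only [Function.mem_support, not_not] at hx ⊢; simp [hx])
  have I2 : Integrable (fun x => fderiv ℝ (fun x => S x * φ x) x x) := by
    refine ((hh.continuous_fderiv (by norm_num)).clm_apply
      continuous_id).integrable_of_hasCompactSupport ?_
    exact (hhc.fderiv ℝ).mono (fun x hx => by
      contrapose! hx; simp only [Function.mem_support, not_not, id] at hx ⊢; simp [hx])
  have I3 : Integrable (fun x => (N : ℝ) * (S x * φ x)) :=
    (hh.continuous.integrable_of_hasCompactSupport hhc).const_mul _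
  have e : ∀ x, (N * S x + fderiv ℝ S x x) * φ x
      = N * (S x * φ x) + (fderiv ℝ (fun x => S x * φ x) x x - S x * fderiv ℝ φ x x) := fun x => by
    rw [hd]; ring
  have E := integral_fderiv_apply_self hh hhc
  refine ⟨I1, ?_, ?_⟩
  · simp_rw [e]; exact I3.add (I2.sub I1)
  · simp_rw [e]
    have I4 : Integrable (fun x => fderiv ℝ (fun x => S x * φ x) x x - S x * fderiv ℝ φ x x) :=
      I2.sub I1
    rw [integral_add I3 I4, integral_sub I2 I1, E]; ring

theorem contDiffAt_norm_rpow_of_ne_zero {s : ℝ} {x : EuclideanSpace ℝ (Fin N)} (hx : x ≠ 0) :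
    ContDiffAt ℝ 1 (fun x : EuclideanSpace ℝ (Fin N) => ‖x‖ ^ s) x :=
  (contDiffAt_norm ℝ hx).rpow_const_of_ne (by simpa using hx)

/-- The radial derivative of a radial function. -/
theorem fderiv_comp_norm_apply_self {g : ℝ → ℝ} {g' : ℝ} {x : EuclideanSpace ℝ (Fin N)}
    (hx : x ≠ 0) (hg : HasDerivAt g g' ‖x‖) :
    fderiv ℝ (fun y : EuclideanSpace ℝ (Fin N) => g ‖y‖) x x = ‖x‖ * g' := by
  have h1 : HasFDerivAt (fun y : EuclideanSpace ℝ (Fin N) => ‖y‖) (fderiv ℝ (fun y => ‖y‖) x) x :=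
    ((contDiffAt_norm ℝ hx (n := 1)).differentiableAt (by norm_num)).hasFDerivAt
  have h2 := hg.comp_hasFDerivAt x h1
  have h3 : fderiv ℝ (fun y : EuclideanSpace ℝ (Fin N) => ‖y‖) x x = ‖x‖ :=
    h1.differentiableAt.fderiv_norm_self
  have : fderiv ℝ (fun y : EuclideanSpace ℝ (Fin N) => g ‖y‖) x
      = g' • fderiv ℝ (fun y => ‖y‖) x := h2.fderiv
  rw [this]; simp [h3, mul_comm]

/-- Either $pt\le\eta s$, and the first term suffices, or $s\le(p/\eta)t$, and the second does. This
replaces Young's inequality where the constant is irrelevant. -/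
theorem rpow_mul_le_add {p η s t : ℝ} (hp : 1 < p) (hη : 0 < η) (hs : 0 ≤ s) (ht : 0 ≤ t) :
    p * s ^ (p - 1) * t ≤ η * s ^ p + p * (p / η) ^ (p - 1) * t ^ p := by
  have hs1 := Real.rpow_nonneg hs (p - 1)
  have ht1 := Real.rpow_nonneg ht (p - 1)
  have h1 : ∀ a : ℝ, 0 ≤ a → a ^ p = a ^ (p - 1) * a := fun a ha => by
    rcases ha.eq_or_lt with rfl | ha
    · rw [Real.zero_rpow (by linarith)]; simp
    · rw [← Real.rpow_add_one ha.ne']; congr 1; ring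
  rw [h1 s hs, h1 t ht]
  have hc : 0 ≤ p * (p / η) ^ (p - 1) := by positivity
  rcases le_total (p * t) (η * s) with h | h
  · have : p * s ^ (p - 1) * t ≤ η * (s ^ (p - 1) * s) := by nlinarith
    have : 0 ≤ p * (p / η) ^ (p - 1) * (t ^ (p - 1) * t) := by positivity
    linarith
  · have h2 : s ≤ p / η * t := by
      rw [div_mul_eq_mul_div, le_div_iff₀ hη]; linarith
    have h3 : s ^ (p - 1) ≤ (p / η) ^ (p - 1) * t ^ (p - 1) := by
      rw [← Real.mul_rpow (by positivity) ht]
      exact Real.rpow_le_rpow hs h2 (by linarith)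
    have : 0 ≤ η * (s ^ (p - 1) * s) := by positivity
    have : p * s ^ (p - 1) * t ≤ p * ((p / η) ^ (p - 1) * t ^ (p - 1)) * t := by gcongr
    linarith

/-- Hardy's inequality, with a nonsharp constant. -/
theorem hardy_inequality {p : ℝ} (hp : 1 < p) (hpN : p < N) : ∃ C : ℝ, 0 ≤ C ∧
    ∀ φ : EuclideanSpace ℝ (Fin N) → ℝ, ContDiff ℝ 1 φ → HasCompactSupport φ →
      (0 : EuclideanSpace ℝ (Fin N)) ∉ tsupport φ →
      ∫⁻ x, ENNReal.ofReal (‖x‖ ^ (-p) * |φ x| ^ p)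
        ≤ ENNReal.ofReal C * ∫⁻ x, ENNReal.ofReal (‖gradient φ x‖ ^ p) := by
  have hNp : 0 < (N : ℝ) - p := by linarith
  -- Away from $0$ the field $|x|^{-p}x$ has divergence $(N-p)|x|^{-p}=2\eta|x|^{-p}$. Half of it
  -- absorbs the first term of `rpow_mul_le_add`.
  set η := ((N : ℝ) - p) / 2 with hη
  have hη0 : 0 < η := by positivity
  refine ⟨p * (p / η) ^ (p - 1) / η, by positivity, fun φ hφ hc h0 => ?_⟩
  have hψ : ContDiff ℝ 1 (fun x => ‖φ x‖ ^ p) := hφ.norm_rpow hp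
  have hsub : tsupport (fun x => ‖φ x‖ ^ p) ⊆ tsupport φ := by
    refine closure_mono fun x hx => ?_
    contrapose! hx
    simp only [Function.mem_support, not_not] at hx ⊢
    simp [hx, Real.zero_rpow (by linarith : p ≠ 0)]
  have hψc : HasCompactSupport (fun x => ‖φ x‖ ^ p) :=
    IsCompact.of_isClosed_subset hc (isClosed_tsupport _) hsub
  obtain ⟨I1, I2, I3⟩ := integral_mul_fderiv_apply_self
    (S := fun x : EuclideanSpace ℝ (Fin N) => ‖x‖ ^ (-p))
    (fun x hx => contDiffAt_norm_rpow_of_ne_zero hx) hψ hψc (fun h => h0 (hsub h))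
  have hS : ∀ x : EuclideanSpace ℝ (Fin N), x ≠ 0 →
      fderiv ℝ (fun x : EuclideanSpace ℝ (Fin N) => ‖x‖ ^ (-p)) x x = -p * ‖x‖ ^ (-p) := by
    intro x hx
    have hx' : 0 < ‖x‖ := norm_pos_iff.2 hx
    rw [fderiv_comp_norm_apply_self (g := fun r => r ^ (-p)) hx
      (Real.hasDerivAt_rpow_const (Or.inl hx'.ne'))]
    rw [Real.rpow_sub_one hx'.ne']; field_simp
  have hφ0 : φ 0 = 0 := image_eq_zero_of_notMem_tsupport h0
  have e2 : ∀ x, ((N : ℝ) * ‖x‖ ^ (-p)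
      + fderiv ℝ (fun x : EuclideanSpace ℝ (Fin N) => ‖x‖ ^ (-p)) x x) * ‖φ x‖ ^ p
      = 2 * η * (‖x‖ ^ (-p) * |φ x| ^ p) := fun x => by
    by_cases hx : x = 0
    · subst hx; simp [hφ0, Real.zero_rpow (by linarith : p ≠ 0)]
    · rw [hS x hx, hη, Real.norm_eq_abs]; ring
  simp_rw [e2] at I2 I3
  have I4 : Integrable fun x => ‖x‖ ^ (-p) * |φ x| ^ p :=
    (integrable_const_mul_iff (isUnit_iff_ne_zero.2 (by positivity)) _).1 I2
  have hgc : Continuous fun x => ‖fderiv ℝ φ x‖ := (hφ.continuous_fderiv (by norm_num)).norm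
  have hgcs : HasCompactSupport fun x => ‖fderiv ℝ φ x‖ ^ p :=
    (hc.fderiv ℝ).comp_left (g := fun L => ‖L‖ ^ p)
      (by simp [Real.zero_rpow (by linarith : p ≠ 0)])
  have I5 : Integrable fun x => ‖fderiv ℝ φ x‖ ^ p :=
    (hgc.rpow_const (fun _ => Or.inr (by linarith))).integrable_of_hasCompactSupport hgcs
  have pt : ∀ x, -(‖x‖ ^ (-p) * fderiv ℝ (fun x => ‖φ x‖ ^ p) x x)
      ≤ η * (‖x‖ ^ (-p) * |φ x| ^ p) + p * (p / η) ^ (p - 1) * ‖fderiv ℝ φ x‖ ^ p := by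
    intro x
    by_cases hx : x = 0
    · subst hx
      have : 0 ≤ η * (‖(0 : EuclideanSpace ℝ (Fin N))‖ ^ (-p) * |φ 0| ^ p)
        + p * (p / η) ^ (p - 1) * ‖fderiv ℝ φ 0‖ ^ p := by positivity
      simpa using this
    have hx' : 0 < ‖x‖ := norm_pos_iff.2 hx
    have b := norm_fderiv_norm_rpow_le (hφ.differentiable (by norm_num)) (x := x) hp
    have b1 : -(fderiv ℝ (fun x => ‖φ x‖ ^ p) x x) ≤ p * ‖φ x‖ ^ (p - 1) * ‖fderiv ℝ φ x‖ * ‖x‖ := by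
      refine (neg_le_abs _).trans ?_
      rw [← Real.norm_eq_abs]
      exact ((fderiv ℝ (fun x => ‖φ x‖ ^ p) x).le_opNorm x).trans (by gcongr)
    have yo := rpow_mul_le_add hp hη0 (s := |φ x| / ‖x‖) (t := ‖fderiv ℝ φ x‖) (by positivity)
      (norm_nonneg _)
    rw [Real.div_rpow (abs_nonneg _) hx'.le, Real.div_rpow (abs_nonneg _) hx'.le] at yo
    have e3 : ‖x‖ ^ (-p) * |φ x| ^ p = |φ x| ^ p / ‖x‖ ^ p := by
      rw [Real.rpow_neg hx'.le]; ring
    have e4 : ‖x‖ ^ p = ‖x‖ ^ (p - 1) * ‖x‖ := by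
      rw [← Real.rpow_add_one hx'.ne']; congr 1; ring
    rw [e3]
    refine le_trans ?_ yo
    rw [← mul_neg]
    refine (mul_le_mul_of_nonneg_left b1 (by positivity)).trans (le_of_eq ?_)
    rw [Real.rpow_neg hx'.le, Real.norm_eq_abs, e4]; field_simp
  have main : η * ∫ x, ‖x‖ ^ (-p) * |φ x| ^ p
      ≤ p * (p / η) ^ (p - 1) * ∫ x, ‖fderiv ℝ φ x‖ ^ p := by
    have := integral_mono (I1.neg) ((I4.const_mul η).add
      (I5.const_mul (p * (p / η) ^ (p - 1)))) pt
    simp only [Pi.neg_apply, Pi.add_apply] at this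
    rw [integral_neg, I3, neg_neg, integral_add (I4.const_mul η) (I5.const_mul _),
      integral_const_mul, integral_const_mul, integral_const_mul] at this
    linarith
  simp_rw [norm_gradient]
  rw [← ofReal_integral_eq_lintegral_ofReal I4 (ae_of_all _ fun x => by positivity),
    ← ofReal_integral_eq_lintegral_ofReal I5 (ae_of_all _ fun x => by positivity),
    ← ENNReal.ofReal_mul (by positivity)]
  refine ENNReal.ofReal_le_ofReal ?_
  rw [div_mul_eq_mul_div, le_div_iff₀ hη0]; linarith

end RadialIntegrals

/-! ### Calculus of weak gradients by mollification. -/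

section WeakGradients

open scoped Convolution

variable {N : ℕ}

theorem MeasureTheory.LocallyIntegrableOn.integrable_smul_of_tsupport_subset
    {U : Set (EuclideanSpace ℝ (Fin N))} {F : Type*} [NormedAddCommGroup F] [NormedSpace ℝ F]
    {f : EuclideanSpace ℝ (Fin N) → F} {φ : EuclideanSpace ℝ (Fin N) → ℝ}
    (hf : LocallyIntegrableOn f U) (hφ : Continuous φ) (hc : HasCompactSupport φ)
    (hsub : tsupport φ ⊆ U) : Integrable (fun x => φ x • f x) := by
  have h : IntegrableOn (fun x => φ x • f x) (tsupport φ) :=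
    (hf.integrableOn_compact_subset hsub hc).continuousOn_smul hφ.continuousOn hc
  refine (integrableOn_iff_integrable_of_support_subset fun x hx => ?_).1 h
  refine subset_tsupport φ ?_
  contrapose! hx
  simp only [Function.mem_support, not_not] at hx ⊢
  simp [hx]

/-- Mollifications converge in `L¹`. -/
theorem tendsto_integral_abs_normed_convolution_sub {ρ : ℕ → ContDiffBump (0 : EuclideanSpace ℝ (Fin N))}
    (hρ : Tendsto (fun n => (ρ n).rOut) atTop (𝓝 0)) (hρK : ∀ n, (ρ n).rOut ≤ 2 * (ρ n).rIn)
    {F : EuclideanSpace ℝ (Fin N) → ℝ} (hF : Integrable F) :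
    Tendsto (fun n => ∫ x, |((ρ n).normed volume ⋆[ContinuousLinearMap.lsmul ℝ ℝ, volume] F) x - F x|)
      atTop (𝓝 0) := by
  set A : ℕ → EuclideanSpace ℝ (Fin N) → ℝ := fun n =>
    (ρ n).normed volume ⋆[ContinuousLinearMap.lsmul ℝ ℝ, volume] F with hA
  set B : ℕ → EuclideanSpace ℝ (Fin N) → ℝ := fun n =>
    (ρ n).normed volume ⋆[ContinuousLinearMap.lsmul ℝ ℝ, volume] (fun x => |F x|) with hB
  have hρi : ∀ n, Integrable ((ρ n).normed volume) := fun n => (ρ n).integrable_normed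
  have iA : ∀ n, Integrable (A n) := fun n => (hρi n).integrable_convolution _ hF
  have iB : ∀ n, Integrable (B n) := fun n => (hρi n).integrable_convolution _ hF.abs
  have IB : ∀ n, ∫ x, B n x = ∫ x, |F x| := fun n => by
    rw [hB, integral_convolution _ (hρi n) hF.abs, (ρ n).integral_normed]; simp
  have AB : ∀ n x, |A n x| ≤ B n x := fun n x => by
    simp only [hA, hB, convolution_lsmul_swap, ← Real.norm_eq_abs]
    refine (norm_integral_le_integral_norm _).trans (le_of_eq ?_)
    congr 1; ext t; rw [norm_smul, Real.norm_of_nonneg ((ρ n).nonneg_normed _), smul_eq_mul]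
  have tA := ContDiffBump.ae_convolution_tendsto_right_of_locallyIntegrable (μ := volume) hρ
    (Eventually.of_forall hρK) hF.locallyIntegrable
  have tB := ContDiffBump.ae_convolution_tendsto_right_of_locallyIntegrable (μ := volume) hρ
    (Eventually.of_forall hρK) hF.abs.locallyIntegrable
  have iC : ∀ n, Integrable (fun x => |A n x - F x| - (B n x - |F x|)) := fun n =>
    ((iA n).sub hF).abs.sub ((iB n).sub hF.abs)
  -- A Scheffé-type argument. Since $\int B_n=\int|F|$, subtracting $B_n-|F|$ leaves the integral of
  -- $|A_n-F|$ unchanged, while $|A_n|\le B_n$ bounds the resulting integrand above by $2|F|$.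
  -- Dominated convergence then applies to its positive part.
  have lim : Tendsto (fun n => ∫ x, max (|A n x - F x| - (B n x - |F x|)) 0) atTop (𝓝 0) := by
    have := tendsto_integral_of_dominated_convergence
      (F := fun n x => max (|A n x - F x| - (B n x - |F x|)) 0) (f := fun _ => (0 : ℝ))
      (fun x => 2 * |F x|) (fun n => (iC n).pos_part.aestronglyMeasurable) (hF.abs.const_mul 2)
      (fun n => ae_of_all _ fun x => ?_) ?_
    · simpa using this
    · rw [Real.norm_of_nonneg (le_max_right _ _)]
      refine max_le ?_ (by positivity)
      have := abs_sub (A n x) (F x)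
      have := AB n x
      linarith
    · filter_upwards [tA, tB] with x ha hb
      have h1 : Tendsto (fun n => |A n x - F x| - (B n x - |F x|)) atTop (𝓝 (|F x - F x| - (|F x| - |F x|))) :=
        (ha.sub_const _).abs.sub (hb.sub_const _)
      have h2 := h1.max (tendsto_const_nhds (x := (0 : ℝ)))
      simpa using h2
  refine squeeze_zero (fun n => integral_nonneg fun x => abs_nonneg _) (fun n => ?_) lim
  have h1 : ∫ x, |A n x - F x| = ∫ x, (|A n x - F x| - (B n x - |F x|)) := by
    have e1 := integral_sub ((iA n).sub hF).abs ((iB n).sub hF.abs)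
    have e2 := integral_sub (iB n) hF.abs
    simp only [Pi.sub_apply] at e1 e2
    rw [e1, e2, IB]; simp
  rw [h1]
  exact integral_mono (iC n) (iC n).pos_part fun x => le_max_left _ _

/-- The definition of the weak gradient, tested in a fixed direction. -/
theorem HasWeakGradient.integral_mul_fderiv {U : Set (EuclideanSpace ℝ (Fin N))}
    {y : EuclideanSpace ℝ (Fin N) → ℝ} {Y : EuclideanSpace ℝ (Fin N) → EuclideanSpace ℝ (Fin N)}
    (h : HasWeakGradient U y Y) {φ : EuclideanSpace ℝ (Fin N) → ℝ} (hφ : IsTestFunction U φ)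
    (v : EuclideanSpace ℝ (Fin N)) :
    ∫ x, y x * fderiv ℝ φ x v = -∫ x, φ x * inner ℝ v (Y x) := by
  obtain ⟨h1, h2, h3⟩ := h
  obtain ⟨p1, p2, p3⟩ := hφ
  have off : ∀ x, x ∉ U → φ x = 0 := fun x hx => image_eq_zero_of_notMem_tsupport (fun h => hx (p3 h))
  have offd : ∀ x, x ∉ tsupport φ → fderiv ℝ φ x = 0 := fun x hx =>
    image_eq_zero_of_notMem_tsupport fun h => hx (tsupport_fderiv_subset ℝ h)
  have hg : gradient φ = fun x => (InnerProductSpace.toDual ℝ _).symm (fderiv ℝ φ x) := rfl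
  have e := h3 φ ⟨p1, p2, p3⟩
  rw [setIntegral_eq_integral_of_forall_compl_eq_zero (fun x hx => by
      simp [hg, offd x fun h => hx (p3 h)]),
    setIntegral_eq_integral_of_forall_compl_eq_zero (fun x hx => by simp [off x hx])] at e
  have i1 : Integrable (fun x => y x • gradient φ x) := by
    have hcont : Continuous (gradient φ) :=
      (InnerProductSpace.toDual ℝ _).symm.continuous.comp (p1.continuous_fderiv (by simp))
    have h : IntegrableOn (fun x => y x • gradient φ x) (tsupport φ) := by
      have := (h1.integrableOn_compact_subset p3 p2).smul_continuousOn hcont.continuousOn p2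
      exact this
    refine (integrableOn_iff_integrable_of_support_subset fun x hx => ?_).1 h
    contrapose! hx; simp [hg, offd x hx]
  have i2 := h2.integrable_smul_of_tsupport_subset p1.continuous p2 p3
  have := congrArg (fun z => inner ℝ v z) e
  simp only [inner_neg_right] at this
  rw [← integral_inner i1, ← integral_inner i2] at this
  simpa only [inner_smul_right, inner_gradient_right, conj_trivial] using this

/-- The derivative falls on the kernel, so that for weakly differentiable $g$ the right side is a
pairing with the test function $t\mapsto\rho(x-t)$. -/
theorem fderiv_convolution_apply {ρ g : EuclideanSpace ℝ (Fin N) → ℝ} (hρ : ContDiff ℝ 1 ρ)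
    (hc : HasCompactSupport ρ) (hg : LocallyIntegrable g) (x v : EuclideanSpace ℝ (Fin N)) :
    fderiv ℝ (ρ ⋆[ContinuousLinearMap.lsmul ℝ ℝ, volume] g) x v
      = ∫ t, g t * fderiv ℝ ρ (x - t) v := by
  rw [(hc.hasFDerivAt_convolution_left _ hρ hg x).fderiv]
  have hi : Integrable fun t => ContinuousLinearMap.precompL (EuclideanSpace ℝ (Fin N))
      (ContinuousLinearMap.lsmul ℝ ℝ) (fderiv ℝ ρ t) (g (x - t)) :=
    (hc.fderiv ℝ).convolutionExists_left _ (hρ.continuous_fderiv (by norm_num)) hg x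
  rw [convolution_def, ContinuousLinearMap.integral_apply hi,
    ← integral_sub_left_eq_self _ volume x]
  refine integral_congr_ae (ae_of_all _ fun t => ?_)
  simp [mul_comm]

/-- The chain rule for weak gradients. -/
theorem HasWeakGradient.integral_comp_mul_fderiv {U : Set (EuclideanSpace ℝ (Fin N))}
    (hU : IsOpen U) {y : EuclideanSpace ℝ (Fin N) → ℝ}
    {Y : EuclideanSpace ℝ (Fin N) → EuclideanSpace ℝ (Fin N)}
    (h : HasWeakGradient U y Y) {φ : EuclideanSpace ℝ (Fin N) → ℝ} (hφ : IsTestFunction U φ)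
    (v : EuclideanSpace ℝ (Fin N)) {H : ℝ → ℝ} (hH : ContDiff ℝ 1 H) {B : ℝ}
    (hB : ∀ t, |H t| ≤ B) (hB' : ∀ t, |deriv H t| ≤ B) :
    ∫ x, H (y x) * fderiv ℝ φ x v = -∫ x, φ x * (deriv H (y x) * inner ℝ v (Y x)) := by
  obtain ⟨p1, p2, p3⟩ := id hφ
  -- The margin $\delta$ leaves room for mollification: a kernel of radius at most $\delta$ centred
  -- at a point of $K$ is supported in $K'\subseteq U$. Cutting $y$ and $Y$ off outside $K'$
  -- therefore changes nothing on $K$ and makes them integrable.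
  obtain ⟨δ, hδ, hδU⟩ := p2.isCompact.exists_cthickening_subset_open hU p3
  set K := tsupport φ with hK
  set K' := cthickening δ K with hK'
  have cK' : IsCompact K' := p2.isCompact.cthickening
  have mK' : MeasurableSet K' := cK'.measurableSet
  have hKK' : K ⊆ K' := self_subset_cthickening _
  set y' := K'.indicator y with hy'
  set F := K'.indicator (fun x => inner ℝ v (Y x)) with hFdef
  have iy : Integrable y' := (h.1.integrableOn_compact_subset hδU cK').integrable_indicator mK'
  have iF : Integrable F := IntegrableOn.integrable_indicator
    (Integrable.const_inner v (h.2.1.integrableOn_compact_subset hδU cK')) mK'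
  let ρ : ℕ → ContDiffBump (0 : EuclideanSpace ℝ (Fin N)) := fun n =>
    ⟨δ / (n + 1) / 2, δ / (n + 1), by positivity, half_lt_self (by positivity)⟩
  have hρ : Tendsto (fun n => (ρ n).rOut) atTop (𝓝 0) := by
    have := (tendsto_one_div_add_atTop_nhds_zero_nat (𝕜 := ℝ)).const_mul δ
    simpa [ρ, div_eq_mul_inv] using this
  have hρK : ∀ n, (ρ n).rOut ≤ 2 * (ρ n).rIn := fun n => by simp only [ρ]; linarith
  have hρδ : ∀ n, (ρ n).rOut ≤ δ := fun n => by
    simp only [ρ]; exact div_le_self hδ.le (by linarith [Nat.cast_nonneg (α := ℝ) n])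
  have cρ : ∀ n, HasCompactSupport ((ρ n).normed volume) := fun n => (ρ n).hasCompactSupport_normed
  have sρ : ∀ n (k : ℕ∞), ContDiff ℝ k ((ρ n).normed volume) := fun n k => (ρ n).contDiff_normed
  set a : ℕ → EuclideanSpace ℝ (Fin N) → ℝ := fun n =>
    (ρ n).normed volume ⋆[ContinuousLinearMap.lsmul ℝ ℝ, volume] y' with ha
  set b : ℕ → EuclideanSpace ℝ (Fin N) → ℝ := fun n =>
    (ρ n).normed volume ⋆[ContinuousLinearMap.lsmul ℝ ℝ, volume] F with hb
  have sa : ∀ n, ContDiff ℝ 1 (a n) := fun n =>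
    (cρ n).contDiff_convolution_left _ (sρ n 1) iy.locallyIntegrable
  have ib : ∀ n, Integrable (b n) := fun n =>
    ((ρ n).integrable_normed).integrable_convolution _ iF
  have hab : ∀ n, ∀ x ∈ K, fderiv ℝ (a n) x v = b n x := fun n x hx => by
    rw [ha, fderiv_convolution_apply (sρ n 1) (cρ n) iy.locallyIntegrable]
    simp only [hb]
    rw [convolution_lsmul_swap]
    set η : EuclideanSpace ℝ (Fin N) → ℝ := fun t => (ρ n).normed volume (x - t) with hη
    have ball_sub : closedBall x (ρ n).rOut ⊆ K' :=
      (closedBall_subset_cthickening hx _).trans (cthickening_mono (hρδ n) _)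
    have suppη : Function.support η ⊆ closedBall x (ρ n).rOut := fun t ht => by
      have : x - t ∈ Function.support ((ρ n).normed volume) := ht
      rw [(ρ n).support_normed_eq, mem_ball_zero_iff] at this
      rw [mem_closedBall, dist_comm, dist_eq_norm]; exact this.le
    have tsη : tsupport η ⊆ K' := (closure_minimal suppη isClosed_closedBall).trans ball_sub
    have tη : IsTestFunction U η := by
      refine ⟨(sρ n ⊤).comp (contDiff_const.sub contDiff_id), ?_, tsη.trans hδU⟩
      exact IsCompact.of_isClosed_subset cK' (isClosed_tsupport _) tsη
    have dη : ∀ t, fderiv ℝ η t v = -fderiv ℝ ((ρ n).normed volume) (x - t) v := fun t => by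
      have h1 : HasFDerivAt (fun t : EuclideanSpace ℝ (Fin N) => x - t) (-ContinuousLinearMap.id ℝ _) t :=
        (hasFDerivAt_id t).const_sub x
      have h2 := ((sρ n 1).differentiable (by norm_num) (x - t)).hasFDerivAt.comp t h1
      have h3 : fderiv ℝ η t = _ := h2.fderiv
      rw [h3]; simp
    have w := h.integral_mul_fderiv tη v
    have e1 : ∀ t, y' t * fderiv ℝ ((ρ n).normed volume) (x - t) v = -(y t * fderiv ℝ η t v) := fun t => by
      by_cases ht : t ∈ K'
      · rw [dη, hy', indicator_of_mem ht]; ring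
      · have : fderiv ℝ η t = 0 :=
          image_eq_zero_of_notMem_tsupport fun h => ht (tsη (tsupport_fderiv_subset ℝ h))
        rw [this, hy', indicator_of_notMem ht]; simp
    have e2 : ∀ t, (ρ n).normed volume (x - t) • F t = η t * inner ℝ v (Y t) := fun t => by
      by_cases ht : t ∈ K'
      · rw [hFdef, indicator_of_mem ht]; rfl
      · have : η t = 0 := image_eq_zero_of_notMem_tsupport fun h => ht (tsη h)
        rw [this, hFdef, indicator_of_notMem ht]; simp
    simp_rw [e1, e2]
    rw [integral_neg, w, neg_neg]
  have cH' : Continuous (deriv H) := hH.continuous_deriv (by norm_num)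
  have cdφ : Continuous fun x => fderiv ℝ φ x v :=
    (p1.continuous_fderiv (by simp)).clm_apply continuous_const
  have csdφ : HasCompactSupport fun x => fderiv ℝ φ x v :=
    p2.fderiv_apply ℝ v
  have offφ : ∀ x, x ∉ K → φ x = 0 := fun x hx => image_eq_zero_of_notMem_tsupport hx
  have offd : ∀ x, x ∉ K → fderiv ℝ φ x = 0 := fun x hx =>
    image_eq_zero_of_notMem_tsupport fun h => hx (tsupport_fderiv_subset ℝ h)
  -- the classical chain rule for the mollified functions
  have ibp : ∀ n, ∫ x, H (a n x) * fderiv ℝ φ x v = -∫ x, φ x * (deriv H (a n x) * b n x) := fun n => by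
    have dd : ∀ x, fderiv ℝ (fun x => H (a n x)) x v = deriv H (a n x) * fderiv ℝ (a n) x v := fun x => by
      have h1 := ((hH.differentiable (by norm_num) (a n x)).hasDerivAt.comp_hasFDerivAt x
        ((sa n).differentiable (by norm_num) x).hasFDerivAt)
      have h2 : fderiv ℝ (fun x => H (a n x)) x = _ := h1.fderiv
      rw [h2]; simp
    have e : ∀ x, fderiv ℝ (fun x => H (a n x)) x v * φ x = φ x * (deriv H (a n x) * b n x) := fun x => by
      by_cases hx : x ∈ K
      · rw [dd, hab n x hx]; ring
      · simp [offφ x hx]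
    have ca : Continuous (a n) := (sa n).continuous
    have cda : Continuous fun x => fderiv ℝ (a n) x v :=
      ((sa n).continuous_fderiv (by norm_num)).clm_apply continuous_const
    have := integral_mul_fderiv_eq_neg_fderiv_mul_of_integrable (μ := volume)
      (f := fun x => H (a n x)) (g := φ) (v := v) ?_ ?_ ?_
      (fun x _ => (hH.comp (sa n)).differentiable (by norm_num) x)
      (fun x _ => p1.differentiable (by simp) x)
    · simp_rw [this, e]
    · simp_rw [dd]
      exact ((cH'.comp ca).mul cda |>.mul p1.continuous).integrable_of_hasCompactSupport p2.mul_left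
    · exact ((hH.continuous.comp ca).mul cdφ).integrable_of_hasCompactSupport csdφ.mul_left
    · exact ((hH.continuous.comp ca).mul p1.continuous).integrable_of_hasCompactSupport p2.mul_left
  have ta : ∀ᵐ x, Tendsto (fun n => a n x) atTop (𝓝 (y' x)) :=
    ContDiffBump.ae_convolution_tendsto_right_of_locallyIntegrable (μ := volume) hρ
      (Eventually.of_forall hρK) iy.locallyIntegrable
  have L1 : Tendsto (fun n => ∫ x, H (a n x) * fderiv ℝ φ x v) atTop
      (𝓝 (∫ x, H (y' x) * fderiv ℝ φ x v)) := by
    refine tendsto_integral_of_dominated_convergence (fun x => B * |fderiv ℝ φ x v|)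
      (fun n => ((hH.continuous.comp (sa n).continuous).mul cdφ).aestronglyMeasurable)
      ((cdφ.integrable_of_hasCompactSupport csdφ).abs.const_mul B)
      (fun n => ae_of_all _ fun x => ?_) ?_
    · rw [norm_mul, Real.norm_eq_abs, Real.norm_eq_abs]
      exact mul_le_mul_of_nonneg_right (hB _) (abs_nonneg _)
    · filter_upwards [ta] with x hx
      exact ((hH.continuous.tendsto _).comp hx).mul_const _
  obtain ⟨Φ, hΦ⟩ := p1.continuous.bounded_above_of_compact_support p2
  have B0 : 0 ≤ B := (abs_nonneg _).trans (hB 0)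
  have Φ0 : 0 ≤ Φ := (norm_nonneg _).trans (hΦ 0)
  have meas : ∀ n, AEStronglyMeasurable fun x => φ x * deriv H (a n x) := fun n =>
    (p1.continuous.mul (cH'.comp (sa n).continuous)).aestronglyMeasurable
  have bd : ∀ n x, ‖φ x * deriv H (a n x)‖ ≤ Φ * B := fun n x => by
    rw [norm_mul]; exact mul_le_mul (hΦ x) (hB' _) (norm_nonneg _) Φ0
  have L2 : Tendsto (fun n => ∫ x, φ x * deriv H (a n x) * F x) atTop
      (𝓝 (∫ x, φ x * deriv H (y' x) * F x)) := by
    refine tendsto_integral_of_dominated_convergence (fun x => Φ * B * |F x|)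
      (fun n => (meas n).mul iF.1) (iF.abs.const_mul _) (fun n => ae_of_all _ fun x => ?_) ?_
    · rw [norm_mul, Real.norm_eq_abs (F x)]
      exact mul_le_mul_of_nonneg_right (bd n x) (abs_nonneg _)
    · filter_upwards [ta] with x hx
      exact (((cH'.tendsto _).comp hx).const_mul _).mul_const _
  -- Pointwise convergence of $b_n$ would not suffice, as there is no common majorant; the
  -- boundedness of $\varphi H'(a_n)$ reduces the claim to $b_n\to F$ in $L^1$.
  have L3 : Tendsto (fun n => ∫ x, φ x * deriv H (a n x) * (b n x - F x)) atTop (𝓝 0) := by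
    have := (tendsto_integral_abs_normed_convolution_sub hρ hρK iF).const_mul (Φ * B)
    rw [mul_zero] at this
    refine squeeze_zero_norm (fun n => ?_) this
    rw [← integral_const_mul]
    refine (norm_integral_le_integral_norm _).trans (integral_mono_of_nonneg
      (ae_of_all _ fun x => norm_nonneg _) (((ib n).sub iF).abs.const_mul _)
      (ae_of_all _ fun x => ?_))
    change ‖_‖ ≤ _
    rw [norm_mul]
    exact mul_le_mul_of_nonneg_right (bd n x) (abs_nonneg _)
  have L4 : Tendsto (fun n => ∫ x, φ x * (deriv H (a n x) * b n x)) atTop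
      (𝓝 (∫ x, φ x * deriv H (y' x) * F x)) := by
    have := L2.add L3
    rw [add_zero] at this
    refine this.congr fun n => ?_
    have e := integral_add (iF.bdd_mul (meas n) (ae_of_all _ (bd n)))
      (((ib n).sub iF).bdd_mul (meas n) (ae_of_all _ (bd n)))
    simp only [Pi.sub_apply] at e
    rw [← e]
    congr 1; ext x; ring
  have e := tendsto_nhds_unique L1 ((L4.neg).congr fun n => (ibp n).symm)
  have e1 : ∀ x, H (y x) * fderiv ℝ φ x v = H (y' x) * fderiv ℝ φ x v := fun x => by
    by_cases hx : x ∈ K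
    · rw [hy', indicator_of_mem (hKK' hx)]
    · simp [offd x hx]
  have e2 : ∀ x, φ x * (deriv H (y x) * inner ℝ v (Y x)) = φ x * deriv H (y' x) * F x := fun x => by
    by_cases hx : x ∈ K
    · rw [hy', hFdef, indicator_of_mem (hKK' hx), indicator_of_mem (hKK' hx)]; ring
    · simp [offφ x hx]
  simp_rw [e1, e2]; exact e

/-- The weak gradient vanishes almost everywhere on level sets. -/
theorem HasWeakGradient.ae_eq_zero_of_eq {U : Set (EuclideanSpace ℝ (Fin N))}
    (hU : IsOpen U) {y : EuclideanSpace ℝ (Fin N) → ℝ}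
    {Y : EuclideanSpace ℝ (Fin N) → EuclideanSpace ℝ (Fin N)}
    (h : HasWeakGradient U y Y) (k : ℝ) : ∀ᵐ x, x ∈ U → y x = k → Y x = 0 := by
  have my : AEStronglyMeasurable y (volume.restrict U) := h.1.aestronglyMeasurable
  have mY : AEStronglyMeasurable Y (volume.restrict U) := h.2.1.aestronglyMeasurable
  have dir : ∀ v : EuclideanSpace ℝ (Fin N), ∀ᵐ x, x ∈ U →
      (if y x = k then (1 : ℝ) else 0) * inner ℝ v (Y x) = 0 := by
    intro v
    -- These functions tend to $0$ uniformly while their derivatives stay in $[0,1]$ and tend to the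
    -- indicator of $\{k\}$. The chain rule then turns into $\int\varphi\,1_{\{y=k\}}\langle
    -- v,Y\rangle=0$ in the limit.
    let H : ℕ → ℝ → ℝ := fun n t => Real.arctan ((n + 1) * (t - k)) / (n + 1)
    have n0 : ∀ n : ℕ, (0 : ℝ) < n + 1 := fun n => by positivity
    have hd : ∀ n t, HasDerivAt (H n) (1 / (1 + ((n + 1) * (t - k)) ^ 2)) t := fun n t => by
      have h1 : HasDerivAt (fun t : ℝ => ((n : ℝ) + 1) * (t - k)) ((n + 1) * 1) t :=
        ((hasDerivAt_id t).sub_const k).const_mul _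
      have h2 := ((Real.hasDerivAt_arctan _).comp t h1).div_const ((n : ℝ) + 1)
      refine h2.congr_deriv ?_
      have := n0 n; field_simp
    have hs : ∀ n, ContDiff ℝ 1 (H n) := fun n =>
      (Real.contDiff_arctan.comp (contDiff_const.mul (contDiff_id.sub contDiff_const))).div_const _
    have hb : ∀ n t, |H n t| ≤ Real.pi / 2 / (n + 1) := fun n t => by
      rw [abs_div, abs_of_pos (n0 n)]
      refine div_le_div_of_nonneg_right ?_ (n0 n).le
      exact abs_le.2 ⟨(Real.neg_pi_div_two_lt_arctan _).le, (Real.arctan_lt_pi_div_two _).le⟩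
    have hb' : ∀ n t, |deriv (H n) t| ≤ 1 := fun n t => by
      rw [(hd n t).deriv, abs_of_nonneg (by positivity), div_le_one (by positivity)]
      nlinarith [sq_nonneg (((n : ℝ) + 1) * (t - k))]
    have lim : ∀ t, Tendsto (fun n => deriv (H n) t) atTop (𝓝 (if t = k then 1 else 0)) := by
      intro t
      simp_rw [fun n => (hd n t).deriv]
      split_ifs with ht
      · simp [ht]
      · have h1 : Tendsto (fun n : ℕ => ((n : ℝ) + 1) * |t - k|) atTop atTop :=
          (tendsto_atTop_add_const_right _ _ tendsto_natCast_atTop_atTop).atTop_mul_const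
            (abs_pos.2 (sub_ne_zero.2 ht))
        have h2 := (tendsto_pow_atTop (two_ne_zero)).comp h1
        have h3 := tendsto_atTop_add_const_left atTop (1 : ℝ) h2
        have h4 := h3.inv_tendsto_atTop
        refine h4.congr fun n => ?_
        simp [mul_pow]
    have mk : AEStronglyMeasurable (fun x => if y x = k then (1 : ℝ) else 0) (volume.restrict U) := by
      have hm : Measurable fun t : ℝ => if t = k then (1 : ℝ) else 0 :=
        Measurable.ite (measurableSet_singleton k) measurable_const measurable_const
      exact (hm.comp_aemeasurable my.aemeasurable).aestronglyMeasurable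
    have li : LocallyIntegrableOn (fun x => inner ℝ v (Y x)) U := fun x hx => by
      obtain ⟨s, hs, hi⟩ := h.2.1 x hx
      exact ⟨s, hs, hi.const_inner v⟩
    have lf : LocallyIntegrableOn
        (fun x => (if y x = k then (1 : ℝ) else 0) * inner ℝ v (Y x)) U := fun x hx => by
      obtain ⟨s, hs, hi⟩ := li x hx
      refine ⟨s ∩ U, inter_mem hs self_mem_nhdsWithin, ?_⟩
      refine Integrable.bdd_mul (c := 1) (hi.mono_set inter_subset_left)
        (mk.mono_measure (Measure.restrict_mono inter_subset_right le_rfl)) (ae_of_all _ fun x => ?_)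
      split_ifs <;> simp
    refine hU.ae_eq_zero_of_integral_contDiff_smul_eq_zero lf fun φ g1 g2 g3 => ?_
    have tφ : IsTestFunction U φ := ⟨g1, g2, g3⟩
    have iφ := li.integrable_smul_of_tsupport_subset g1.continuous g2 g3
    have cdφ : Continuous fun x => fderiv ℝ φ x v :=
      (g1.continuous_fderiv (by simp)).clm_apply continuous_const
    have csdφ : HasCompactSupport fun x => fderiv ℝ φ x v :=
      g2.fderiv_apply ℝ v
    have T1 : Tendsto (fun n => ∫ x, H n (y x) * fderiv ℝ φ x v) atTop (𝓝 0) := by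
      have t0 : Tendsto (fun n : ℕ => Real.pi / 2 / ((n : ℝ) + 1) * ∫ x, |fderiv ℝ φ x v|) atTop (𝓝 0) := by
        have := ((tendsto_one_div_add_atTop_nhds_zero_nat (𝕜 := ℝ)).const_mul (Real.pi / 2)).mul_const
          (∫ x, |fderiv ℝ φ x v|)
        simpa [div_eq_mul_inv] using this
      refine squeeze_zero_norm (fun n => ?_) t0
      rw [← integral_const_mul]
      refine (norm_integral_le_integral_norm _).trans (integral_mono_of_nonneg
        (ae_of_all _ fun x => norm_nonneg _)
        ((cdφ.integrable_of_hasCompactSupport csdφ).abs.const_mul _) (ae_of_all _ fun x => ?_))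
      change ‖_‖ ≤ _
      rw [norm_mul]
      exact mul_le_mul_of_nonneg_right (hb n _) (abs_nonneg _)
    have eqn : ∀ n, ∫ x, H n (y x) * fderiv ℝ φ x v
        = -∫ x in U, φ x * (deriv (H n) (y x) * inner ℝ v (Y x)) := fun n => by
      rw [setIntegral_eq_integral_of_forall_compl_eq_zero fun x hx => by
        rw [image_eq_zero_of_notMem_tsupport fun h => hx (g3 h)]; simp]
      refine h.integral_comp_mul_fderiv hU tφ v (hs n) (B := Real.pi / 2) (fun t => (hb n t).trans ?_)
        (fun t => (hb' n t).trans (by linarith [Real.pi_gt_three]))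
      exact div_le_self (by positivity) (by linarith [Nat.cast_nonneg (α := ℝ) n])
    have T2 : Tendsto (fun n => ∫ x in U, φ x * (deriv (H n) (y x) * inner ℝ v (Y x))) atTop
        (𝓝 (∫ x in U, φ x * ((if y x = k then (1 : ℝ) else 0) * inner ℝ v (Y x)))) := by
      refine tendsto_integral_of_dominated_convergence (fun x => |φ x • inner ℝ v (Y x)|)
        (fun n => ?_) iφ.abs.integrableOn (fun n => ae_of_all _ fun x => ?_)
        (ae_of_all _ fun x => ((lim (y x)).mul_const _).const_mul _)
      · refine g1.continuous.aestronglyMeasurable.mul (AEStronglyMeasurable.mul ?_ li.aestronglyMeasurable)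
        exact ((hs n).continuous_deriv (by norm_num)).comp_aestronglyMeasurable my
      · rw [Real.norm_eq_abs, smul_eq_mul, abs_mul, abs_mul, abs_mul]
        refine mul_le_mul_of_nonneg_left ?_ (abs_nonneg _)
        exact mul_le_of_le_one_left (abs_nonneg _) (hb' n _)
    have := tendsto_nhds_unique T2 (by
      have := T1.neg; rw [neg_zero] at this
      exact this.congr fun n => by rw [eqn, neg_neg])
    rw [setIntegral_eq_integral_of_forall_compl_eq_zero fun x hx => by
        rw [image_eq_zero_of_notMem_tsupport fun h => hx (g3 h)]; simp] at this
    simpa using this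
  have all : ∀ᵐ x, ∀ i : Fin N, x ∈ U →
      (if y x = k then (1 : ℝ) else 0) * inner ℝ (EuclideanSpace.single i (1 : ℝ)) (Y x) = 0 :=
    ae_all_iff.2 fun i => dir _
  filter_upwards [all] with x hx hxU hxk
  ext i
  have := hx i hxU
  simpa [hxk, EuclideanSpace.inner_single_left] using this

end WeakGradients

/-! ### Algebra of the $p$-Laplacian flux and Picone's inequality. -/

section PiconeInequality

/-- Valid at $s=0$ too, whatever value $0^{p-2}$ takes; hence the flux needs no case distinction at
its zeros, even for $p<2$. -/
theorem rpow_sub_two_mul_sq {p s : ℝ} (hp : 1 < p) (hs : 0 ≤ s) : s ^ (p - 2) * (s * s) = s ^ p := by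
  rcases hs.eq_or_lt with rfl | hs
  · rw [Real.zero_rpow (by linarith : p ≠ 0)]; ring
  · rw [← mul_assoc, ← Real.rpow_add_one hs.ne', ← Real.rpow_add_one hs.ne']; congr 1; ring

theorem rpow_sub_two_mul_self {p s : ℝ} (hp : 1 < p) (hs : 0 ≤ s) : s ^ (p - 2) * s = s ^ (p - 1) := by
  rcases hs.eq_or_lt with rfl | hs
  · rw [Real.zero_rpow (by linarith : p - 1 ≠ 0)]; ring
  · rw [← Real.rpow_add_one hs.ne']; congr 1; ring

theorem rpow_sub_one_mul_self {p s : ℝ} (hp : 1 < p) (hs : 0 ≤ s) : s ^ (p - 1) * s = s ^ p := by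
  rw [← rpow_sub_two_mul_self hp hs, mul_assoc, rpow_sub_two_mul_sq hp hs]

variable {F : Type*} [NormedAddCommGroup F] [InnerProductSpace ℝ F]

/-- The flux `‖v‖^(p-2) v` of the `p`-Laplacian. -/
noncomputable def pFlux (p : ℝ) (v : F) : F := ‖v‖ ^ (p - 2) • v

theorem inner_pFlux (p : ℝ) (v x : F) : inner ℝ (pFlux p v) x = ‖v‖ ^ (p - 2) * inner ℝ v x := by
  rw [pFlux, real_inner_smul_left]

theorem norm_pFlux {p : ℝ} (hp : 1 < p) (v : F) : ‖pFlux p v‖ = ‖v‖ ^ (p - 1) := by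
  rw [pFlux, norm_smul, Real.norm_of_nonneg (by positivity), rpow_sub_two_mul_self hp (norm_nonneg _)]

theorem inner_pFlux_self {p : ℝ} (hp : 1 < p) (v : F) : inner ℝ (pFlux p v) v = ‖v‖ ^ p := by
  rw [inner_pFlux, real_inner_self_eq_norm_mul_norm, rpow_sub_two_mul_sq hp (norm_nonneg _)]

theorem pFlux_smul {p : ℝ} (hp : 1 < p) {t : ℝ} (ht : 0 ≤ t) (v : F) :
    pFlux p (t • v) = t ^ (p - 1) • pFlux p v := by
  rw [pFlux, pFlux, norm_smul, Real.norm_of_nonneg ht, Real.mul_rpow ht (norm_nonneg _), smul_smul,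
    smul_smul, ← rpow_sub_two_mul_self hp ht]
  congr 1; ring

/-- Cauchy–Schwarz and Young with exponents $p/(p-1)$ and $p$. Applied with both orders and both
signs of the vectors, it yields Picone's inequality, the monotonicity of the flux and the bounds
from above. -/
theorem mul_inner_pFlux_le {p : ℝ} (hp : 1 < p) (a b : F) :
    p * inner ℝ (pFlux p a) b ≤ (p - 1) * ‖a‖ ^ p + ‖b‖ ^ p := by
  have h1 : inner ℝ (pFlux p a) b ≤ ‖a‖ ^ (p - 1) * ‖b‖ := by
    rw [← norm_pFlux hp]; exact real_inner_le_norm _ _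
  have hq : (p / (p - 1)).HolderConjugate p := (Real.HolderConjugate.conjExponent hp).symm
  have h2 := Real.young_inequality_of_nonneg (a := ‖a‖ ^ (p - 1)) (b := ‖b‖) (by positivity)
    (norm_nonneg _) hq
  have hp1 : p - 1 ≠ 0 := by linarith
  rw [← Real.rpow_mul (norm_nonneg _), mul_div_cancel₀ _ hp1] at h2
  have h3 : p * (‖a‖ ^ p / (p / (p - 1)) + ‖b‖ ^ p / p) = (p - 1) * ‖a‖ ^ p + ‖b‖ ^ p := by
    have : p ≠ 0 := by linarith
    field_simp
  rw [← h3]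
  exact mul_le_mul_of_nonneg_left (h1.trans h2) (by linarith)

/-- A quantitative form of Picone's inequality, in both directions at once. -/
theorem picone_lower_bound {p : ℝ} (hp : 1 < p) (G c : F) {g h κ : ℝ} (hg : 0 ≤ g) (hκ : 0 ≤ κ)
    (hh : -κ ≤ h) :
    -(κ * (3 * (‖G‖ ^ p + ‖c‖ ^ p))) ≤ inner ℝ (pFlux p G) ((g + h) • G - h • c)
      - inner ℝ (pFlux p c) ((p * g + h) • G - ((p - 1) * g + h) • c) := by
  have a1 := mul_inner_pFlux_le hp c G
  have a2 := mul_inner_pFlux_le hp G c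
  have a3 := mul_inner_pFlux_le hp G (-c)
  have a4 := mul_inner_pFlux_le hp c (-G)
  simp only [inner_sub_right, inner_smul_right, inner_pFlux_self hp, norm_neg, inner_neg_right] at *
  set X := inner ℝ (pFlux p G) c
  set Y := inner ℝ (pFlux p c) G
  have hG : 0 ≤ ‖G‖ ^ p := by positivity
  have hc : 0 ≤ ‖c‖ ^ p := by positivity
  set g' := ‖G‖ ^ p
  set c' := ‖c‖ ^ p
  have A : 0 ≤ g' - p * Y + (p - 1) * c' := by linarith
  have B0 : 0 ≤ g' + c' - X - Y := by
    have : 0 ≤ p * (g' + c' - X - Y) := by nlinarith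
    exact nonneg_of_mul_nonneg_right this (by linarith)
  have B1 : g' + c' - X - Y ≤ 3 * (g' + c') := by
    have : p * (g' + c' - X - Y) ≤ p * (3 * (g' + c')) := by nlinarith
    exact le_of_mul_le_mul_left this (by linarith)
  -- The coefficient of $g$ is Picone's expression and that of $h$ is
  -- $\langle|G|^{p-2}G-|c|^{p-2}c,\,G-c\rangle$. Both are nonnegative, so only the negative part of
  -- $h$ costs anything, and it multiplies the bounded-above second factor.
  have e : (g + h) * g' - h * X - ((p * g + h) * Y - ((p - 1) * g + h) * c')
      = g * (g' - p * Y + (p - 1) * c') + h * (g' + c' - X - Y) := by ring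
  rw [e]
  have m1 := mul_nonneg hg A
  have m2 : κ * (g' + c' - X - Y) ≤ κ * (3 * (g' + c')) := mul_le_mul_of_nonneg_left B1 hκ
  have m3 : -κ * (g' + c' - X - Y) ≤ h * (g' + c' - X - Y) := mul_le_mul_of_nonneg_right hh B0
  linarith

/-- The case $c=\theta a$, written in the form in which the gradients of $w\tau(\theta)$ appear for
$\tau=\theta g$ and $\tau=\theta^pg$, with $h=\theta g'(\theta)$. -/
theorem picone_lower_bound_smul {p : ℝ} (hp : 1 < p) (G a : F) {θ g h κ : ℝ} (hθ : 0 < θ)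
    (hg : 0 ≤ g) (hκ : 0 ≤ κ) (hh : -κ ≤ h) :
    -(κ * (3 * (‖G‖ ^ p + ‖θ • a‖ ^ p))) ≤
      inner ℝ (pFlux p G) ((g + h) • G + (θ * g - θ * (g + h)) • a)
      - inner ℝ (pFlux p a) ((θ ^ (p - 1) * (p * g + h)) • G
          + (θ ^ p * g - θ * (θ ^ (p - 1) * (p * g + h))) • a) := by
  have := picone_lower_bound hp G (θ • a) hg hκ hh
  rw [pFlux_smul hp hθ.le] at this
  convert this using 2
  · congr 1; module
  · rw [inner_smul_left, conj_trivial, ← inner_smul_right]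
    congr 1
    rw [← rpow_sub_one_mul_self hp hθ.le]
    module

end PiconeInequality

/-! ### Cutoff profiles in the ratio $\theta$. -/

section Profile

open Real (smoothTransition)

/-- A smooth cutoff profile, supported in `[1, 2m]` and increasing up to `m`. -/
noncomputable def profile (m θ : ℝ) : ℝ := smoothTransition (θ - 1) * smoothTransition (2 - θ / m)

theorem contDiff_profile (m : ℝ) (n : ℕ∞) : ContDiff ℝ n (profile m) :=
  (Real.smoothTransition.contDiff.comp (contDiff_id.sub contDiff_const)).mul
    (Real.smoothTransition.contDiff.comp (contDiff_const.sub (contDiff_id.div_const _)))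

theorem profile_nonneg (m θ : ℝ) : 0 ≤ profile m θ :=
  mul_nonneg (Real.smoothTransition.nonneg _) (Real.smoothTransition.nonneg _)

theorem profile_of_le_one {m θ : ℝ} (h : θ ≤ 1) : profile m θ = 0 := by
  rw [profile, Real.smoothTransition.zero_of_nonpos (by linarith), zero_mul]

theorem profile_of_two_mul_le {m θ : ℝ} (hm : 0 < m) (h : 2 * m ≤ θ) : profile m θ = 0 := by
  have : 2 ≤ θ / m := by rwa [le_div_iff₀ hm]
  rw [profile, Real.smoothTransition.zero_of_nonpos (x := 2 - θ / m) (by linarith), mul_zero]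

theorem profile_of_le {m θ : ℝ} (hm : 0 < m) (h : θ ≤ m) :
    profile m θ = smoothTransition (θ - 1) := by
  have : θ / m ≤ 1 := by rwa [div_le_one hm]
  rw [profile, Real.smoothTransition.one_of_one_le (x := 2 - θ / m) (by linarith), mul_one]

/-- At the endpoint $t=c$ only the left side is known, but one-sided derivatives determine the
derivative. -/
theorem deriv_eq_zero_of_forall_le {τ : ℝ → ℝ} {c t : ℝ} (hτ : DifferentiableAt ℝ τ t)
    (h : ∀ s ≤ c, τ s = 0) (ht : t ≤ c) : deriv τ t = 0 := by
  have h1 := hτ.hasDerivAt.hasDerivWithinAt (s := Iic t)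
  have h2 : HasDerivWithinAt τ 0 (Iic t) t :=
    (hasDerivWithinAt_const t (Iic t) (0 : ℝ)).congr (fun s hs => h s (le_trans hs ht)) (h t ht)
  exact (uniqueDiffOn_Iic t t self_mem_Iic).eq_deriv _ h1 h2

theorem deriv_eq_zero_of_forall_ge {τ : ℝ → ℝ} {c t : ℝ} (hτ : DifferentiableAt ℝ τ t)
    (h : ∀ s, c ≤ s → τ s = 0) (ht : c ≤ t) : deriv τ t = 0 := by
  have h1 := hτ.hasDerivAt.hasDerivWithinAt (s := Ici t)
  have h2 : HasDerivWithinAt τ 0 (Ici t) t :=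
    (hasDerivWithinAt_const t (Ici t) (0 : ℝ)).congr (fun s hs => h s (le_trans ht hs)) (h t ht)
  exact (uniqueDiffOn_Ici t t self_mem_Ici).eq_deriv _ h1 h2

theorem exists_deriv_smoothTransition_le :
    ∃ S : ℝ, 0 ≤ S ∧ ∀ t, |deriv smoothTransition t| ≤ S := by
  have hd : Differentiable ℝ smoothTransition :=
    Real.smoothTransition.contDiff.differentiable (n := 1) (by norm_num)
  have hc : Continuous (deriv smoothTransition) :=
    (Real.smoothTransition.contDiff (n := 1)).continuous_deriv (by norm_num)
  obtain ⟨S, hS⟩ := (isCompact_Icc (a := (0 : ℝ)) (b := 1)).exists_bound_of_continuousOn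
    hc.continuousOn
  have S0 : 0 ≤ S := (norm_nonneg _).trans (hS 0 (by simp))
  refine ⟨S, S0, fun t => ?_⟩
  by_cases h : t ∈ Icc (0 : ℝ) 1
  · exact hS t h
  have : deriv smoothTransition t = 0 := by
    rcases lt_or_ge t 0 with h0 | h0
    · exact deriv_eq_zero_of_forall_le (hd t)
        (fun s hs => Real.smoothTransition.zero_of_nonpos hs) h0.le
    · have h1 : 1 ≤ t := by by_contra h1; exact h ⟨h0, by linarith⟩
      have := deriv_eq_zero_of_forall_ge (τ := fun t => smoothTransition t - 1) (c := 1)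
        ((hd t).sub_const 1)
        (fun s hs => by simp [Real.smoothTransition.one_of_one_le hs]) h1
      rwa [deriv_sub_const] at this
  rw [this, abs_zero]; exact S0

/-- The profile decreases only for $m\le\theta\le2m$, at rate of order $1/m$. There $\theta/m\le2$,
so $\theta g'(\theta)$ is bounded below independently of $m$, and below $m$ it is nonnegative. -/
theorem exists_mul_deriv_profile_ge :
    ∃ S : ℝ, 0 ≤ S ∧ ∀ m, 0 < m → ∀ θ, 0 ≤ θ →
      -(if m ≤ θ then S else 0) ≤ θ * deriv (profile m) θ := by
  obtain ⟨S, S0, hS⟩ := exists_deriv_smoothTransition_le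
  have hd : Differentiable ℝ smoothTransition :=
    Real.smoothTransition.contDiff.differentiable (n := 1) (by norm_num)
  have hd0 : ∀ t, 0 ≤ deriv smoothTransition t := fun t => Real.smoothTransition.monotone.deriv_nonneg
  refine ⟨2 * S, by positivity, fun m hm θ hθ => ?_⟩
  have h1 : HasDerivAt (fun θ : ℝ => smoothTransition (θ - 1)) (deriv smoothTransition (θ - 1) * 1) θ :=
    (hd _).hasDerivAt.comp θ ((hasDerivAt_id θ).sub_const 1)
  have h2 : HasDerivAt (fun θ : ℝ => smoothTransition (2 - θ / m))
      (deriv smoothTransition (2 - θ / m) * (-(1 / m))) θ :=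
    (hd _).hasDerivAt.comp θ (((hasDerivAt_id θ).div_const m).const_sub 2)
  have h3 : deriv (profile m) θ = _ := (h1.mul h2).deriv
  rw [h3]
  set a := deriv smoothTransition (θ - 1)
  have ha : 0 ≤ a := hd0 _
  have hb0 : 0 ≤ deriv smoothTransition (2 - θ / m) := hd0 _
  have hb1 : deriv smoothTransition (2 - θ / m) ≤ S := (le_abs_self _).trans (hS _)
  have hz1 : θ < m → deriv smoothTransition (2 - θ / m) = 0 := fun h => by
    have h1 : θ / m < 1 := by rwa [div_lt_one hm]
    have := deriv_eq_zero_of_forall_ge (τ := fun t => smoothTransition t - 1) (c := 1)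
        ((hd _).sub_const 1) (t := 2 - θ / m)
        (fun s hs => by simp [Real.smoothTransition.one_of_one_le hs]) (by linarith)
    rwa [deriv_sub_const] at this
  have hz2 : 2 * m < θ → deriv smoothTransition (2 - θ / m) = 0 := fun h => by
    have : 2 < θ / m := by rwa [lt_div_iff₀ hm]
    exact deriv_eq_zero_of_forall_le (hd _) (c := 0)
        (fun s hs => Real.smoothTransition.zero_of_nonpos hs) (by linarith)
  set b := deriv smoothTransition (2 - θ / m)
  set s1 := smoothTransition (θ - 1)
  set s2 := smoothTransition (2 - θ / m)
  have hs1 : 0 ≤ s1 := Real.smoothTransition.nonneg _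
  have hs1' : s1 ≤ 1 := Real.smoothTransition.le_one _
  have hs2 : 0 ≤ s2 := Real.smoothTransition.nonneg _
  have e : θ * (a * 1 * s2 + s1 * (b * -(1 / m))) = θ * a * s2 - s1 * (θ / m * b) := by ring
  have t1 : 0 ≤ θ * a * s2 := by positivity
  have t2 : 0 ≤ θ / m * b := by positivity
  have t3 : s1 * (θ / m * b) ≤ θ / m * b := mul_le_of_le_one_left t2 hs1'
  suffices θ / m * b ≤ (if m ≤ θ then 2 * S else 0) by rw [e]; linarith
  split_ifs with h
  · rcases lt_or_ge (2 * m) θ with h' | h'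
    · rw [hz2 h']; simp only [mul_zero]; positivity
    · have : θ / m ≤ 2 := by rwa [div_le_iff₀ hm]
      gcongr
  · rw [hz1 (not_le.1 h)]; simp

/-- The power $\theta^p$ need not be smooth at $0$, but the profile vanishes up to $\theta=1$. -/
theorem contDiff_rpow_mul_profile (p m : ℝ) (n : ℕ∞) :
    ContDiff ℝ n (fun θ => θ ^ p * profile m θ) := contDiff_iff_contDiffAt.2 fun θ => by
  rcases lt_or_ge θ 1 with h | h
  · refine (contDiffAt_const (c := (0 : ℝ))).congr_of_eventuallyEq ?_
    filter_upwards [Iio_mem_nhds h] with t ht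
    rw [profile_of_le_one (le_of_lt ht), mul_zero]
  · exact (Real.contDiffAt_rpow_const_of_ne (by linarith)).mul (contDiff_profile m n).contDiffAt

theorem deriv_mul_profile (m θ : ℝ) :
    deriv (fun θ => θ * profile m θ) θ = profile m θ + θ * deriv (profile m) θ := by
  have h := (hasDerivAt_id θ).mul
    ((contDiff_profile m 1).differentiable (by norm_num) θ).hasDerivAt
  have : deriv (fun θ => θ * profile m θ) θ = _ := h.deriv
  rw [this]; simp

theorem deriv_rpow_mul_profile (p m : ℝ) {θ : ℝ} (hθ : 0 < θ) :
    deriv (fun θ => θ ^ p * profile m θ) θ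
      = θ ^ (p - 1) * (p * profile m θ + θ * deriv (profile m) θ) := by
  have h := (Real.hasDerivAt_rpow_const (p := p) (Or.inl hθ.ne')).mul
    ((contDiff_profile m 1).differentiable (by norm_num) θ).hasDerivAt
  have : deriv (fun θ => θ ^ p * profile m θ) θ = _ := h.deriv
  rw [this]
  have : θ ^ p = θ ^ (p - 1) * θ := by rw [← Real.rpow_add_one hθ.ne']; congr 1; ring
  rw [this]; ring

end Profile

/-! ### The exponent $\gamma_1$ and the radial barrier. -/

section Barrier

/-- In the admissible range, `γ₁ < (N - p) / p`. -/
theorem gammaOne_lt {N : ℕ} {p μ : ℝ} (hp : 1 < p) (hpN : p < N) (hμ0 : 0 ≤ μ)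
    (hμ : μ < (((N : ℝ) - p) / p) ^ p) : gammaOne N p μ < ((N : ℝ) - p) / p := by
  have hcont : Continuous fun γ : ℝ => (p - 1) * γ ^ p - ((N : ℝ) - p) * γ ^ (p - 1) + μ :=
    ((continuous_const.mul (Real.continuous_rpow_const (by linarith))).sub
      (continuous_const.mul (Real.continuous_rpow_const (by linarith)))).add continuous_const
  have hb : 0 < ((N : ℝ) - p) / p := div_pos (by linarith) (by linarith)
  set b := ((N : ℝ) - p) / p with hbdef
  have hivt := intermediate_value_Icc' hb.le hcont.continuousOn
  have h0 : (p - 1) * (0 : ℝ) ^ p - ((N : ℝ) - p) * (0 : ℝ) ^ (p - 1) + μ = μ := by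
    rw [Real.zero_rpow (by linarith : p ≠ 0), Real.zero_rpow (by linarith : p - 1 ≠ 0)]
    ring
  -- At $b=(N-p)/p$ the indicial function equals $\mu-b^p$, strictly negative by the bound on $\mu$,
  -- so there is a root strictly below $b$.
  have hfb : (p - 1) * b ^ p - ((N : ℝ) - p) * b ^ (p - 1) + μ < 0 := by
    have e1 : b ^ p = b ^ (p - 1) * b := (rpow_sub_one_mul_self hp hb.le).symm
    have e2 : (N : ℝ) - p = p * b := by rw [hbdef]; field_simp
    rw [e2]
    have : (p - 1) * b ^ p - p * b * b ^ (p - 1) = - b ^ p := by rw [e1]; ring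
    linarith
  obtain ⟨γ, hγ, hγ0⟩ := hivt ⟨hfb.le, by simpa only [h0] using hμ0⟩
  have hne : γ ≠ b := by rintro rfl; simp only at hγ0; linarith
  have hmem : γ ∈ gammaRoots N p μ := by rw [gammaRoots_eq hp]; exact ⟨hγ.1, hγ0⟩
  exact ((isLeast_gammaOne hp hpN hμ0 hμ).2 hmem).trans_lt (lt_of_le_of_ne hγ.2 hne)

/-- The derivative is $(p-1)t^{p-2}(a-pt)$. With $a=N-p$, raising the exponent above $\gamma_1$ but
not above $(N-p)/p$ keeps the indicial expression at least $\mu$. -/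
theorem monotoneOn_indicial {a p : ℝ} (hp : 1 < p) :
    MonotoneOn (fun t : ℝ => a * t ^ (p - 1) - (p - 1) * t ^ p) (Icc 0 (a / p)) := by
  refine monotoneOn_of_deriv_nonneg (convex_Icc _ _) ?_ ?_ ?_
  · exact ((continuous_const.mul (Real.continuous_rpow_const (by linarith))).sub
      (continuous_const.mul (Real.continuous_rpow_const (by linarith)))).continuousOn
  · rw [interior_Icc]
    intro t ht
    exact (((Real.hasDerivAt_rpow_const (Or.inl ht.1.ne')).const_mul _).sub
      ((Real.hasDerivAt_rpow_const (Or.inl ht.1.ne')).const_mul _)).differentiableAt.differentiableWithinAt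
  · rw [interior_Icc]
    intro t ht
    have h := ((Real.hasDerivAt_rpow_const (p := p - 1) (Or.inl ht.1.ne')).const_mul a).sub
      ((Real.hasDerivAt_rpow_const (p := p) (Or.inl ht.1.ne')).const_mul (p - 1))
    have e : deriv (fun t : ℝ => a * t ^ (p - 1) - (p - 1) * t ^ p) t = _ := h.deriv
    rw [e]
    have h1 : t ^ (p - 1) = t ^ (p - 1 - 1) * t := by
      rw [← Real.rpow_add_one ht.1.ne']; congr 1; ring
    have h2 : t * p ≤ a := by
      have := ht.2.le; rwa [le_div_iff₀ (by linarith)] at this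
    have h3 : 0 ≤ t ^ (p - 1 - 1) := Real.rpow_nonneg ht.1.le _
    have : a * ((p - 1) * t ^ (p - 1 - 1)) - (p - 1) * (p * t ^ (p - 1))
        = (p - 1) * t ^ (p - 1 - 1) * (a - t * p) := by rw [h1]; ring
    rw [this]
    exact mul_nonneg (mul_nonneg (by linarith) h3) (by linarith)

/-- The Riccati inequality behind the barrier. -/
theorem exists_riccati_supersolution {N : ℕ} {p μ A α : ℝ} (hp : 1 < p) (hpN : p < N) (hμ0 : 0 ≤ μ)
    (hμ : μ < (((N : ℝ) - p) / p) ^ p) (hA : 0 < A) (hα : α < p) :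
    ∃ e R₀ : ℝ, 0 < e ∧ 0 < R₀ ∧ R₀ ≤ 1 ∧ ∀ r, 0 < r → r ≤ R₀ →
      gammaOne N p μ + r ^ e ≤ ((N : ℝ) - p) / p ∧
      μ + A * r ^ (p - α) ≤ ((N : ℝ) - p) * (gammaOne N p μ + r ^ e) ^ (p - 1)
        - (p - 1) * (gammaOne N p μ + r ^ e) ^ p
        + (p - 1) * e * r ^ e * (gammaOne N p μ + r ^ e) ^ (p - 2) := by
  have hγb := gammaOne_lt hp hpN hμ0 hμ
  have hroot := (isLeast_gammaOne hp hpN hμ0 hμ).1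
  rw [gammaRoots_eq hp] at hroot
  obtain ⟨hγ0, hγ⟩ := hroot
  set γ := gammaOne N p μ
  simp only [mem_Ici] at hγ0
  change (p - 1) * γ ^ p - ((N : ℝ) - p) * γ ^ (p - 1) + μ = 0 at hγ
  have hb : 0 < ((N : ℝ) - p) / p := div_pos (by linarith) (by linarith)
  set b := ((N : ℝ) - p) / p with hbdef
  -- Half of the gap: $r^{p-\alpha}=r^dr^d$, and for small $r$ one factor absorbs the ratio $A/c$.
  set d := (p - α) / 2 with hd
  have hd0 : 0 < d := by simp only [hd]; linarith
  -- the lower bound for the term coming from `q'`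
  obtain ⟨e, c, he, hc, hlow⟩ : ∃ e c : ℝ, 0 < e ∧ 0 < c ∧ ∀ r, 0 < r → γ + r ^ e ≤ b →
      c * r ^ d ≤ (p - 1) * e * r ^ e * (γ + r ^ e) ^ (p - 2) := by
    have hp1 : 0 < p - 1 := by linarith
    -- Since $\gamma$ may be $0$, for $p\ge2$ only $q\ge r^e$ is available, and $e+e(p-2)=d$
    -- dictates $e=d/(p-1)$. For $p<2$ the negative power is bounded below through $q\le b$, so
    -- $e=d$ works.
    rcases le_or_gt 2 p with h2 | h2
    · refine ⟨d / (p - 1), (p - 1) * (d / (p - 1)), by positivity, by positivity, fun r hr _ => ?_⟩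
      set e := d / (p - 1) with he
      have hre : 0 < r ^ e := Real.rpow_pos_of_pos hr e
      have h1 : r ^ d = r ^ e * (r ^ e) ^ (p - 2) := by
        rw [← Real.rpow_mul hr.le, ← Real.rpow_add hr]
        congr 1; rw [he]; field_simp; ring
      have h3 : (r ^ e) ^ (p - 2) ≤ (γ + r ^ e) ^ (p - 2) :=
        Real.rpow_le_rpow hre.le (by linarith) (by linarith)
      have he0 : 0 < e := by positivity
      rw [h1, ← mul_assoc]; gcongr
    · refine ⟨d, (p - 1) * d * b ^ (p - 2), hd0, by positivity, fun r hr hq => ?_⟩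
      have hre : 0 < r ^ d := Real.rpow_pos_of_pos hr d
      have h3 : b ^ (p - 2) ≤ (γ + r ^ d) ^ (p - 2) :=
        Real.rpow_le_rpow_of_nonpos (by linarith) hq (by linarith)
      have : (p - 1) * d * b ^ (p - 2) * r ^ d = (p - 1) * d * r ^ d * b ^ (p - 2) := by ring
      rw [this]; gcongr
  have t1 : Tendsto (fun r : ℝ => r ^ e) (𝓝[>] 0) (𝓝 0) := by
    have := (Real.continuous_rpow_const he.le).tendsto 0
    rw [Real.zero_rpow he.ne'] at this
    exact this.mono_left nhdsWithin_le_nhds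
  have t2 : Tendsto (fun r : ℝ => r ^ d) (𝓝[>] 0) (𝓝 0) := by
    have := (Real.continuous_rpow_const hd0.le).tendsto 0
    rw [Real.zero_rpow hd0.ne'] at this
    exact this.mono_left nhdsWithin_le_nhds
  have ev := ((t1.eventually_le_const (show 0 < b - γ by linarith)).and
    (t2.eventually_le_const (show 0 < c / A by positivity))).and
    (Ioc_mem_nhdsGT (show (0 : ℝ) < 1 by norm_num))
  obtain ⟨R₀, ⟨h1, h2⟩, h3⟩ := ev.exists
  refine ⟨e, R₀, he, h3.1, h3.2, fun r hr hrR => ?_⟩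
  have hre : r ^ e ≤ R₀ ^ e := Real.rpow_le_rpow hr.le hrR he.le
  have hrd : r ^ d ≤ R₀ ^ d := Real.rpow_le_rpow hr.le hrR hd0.le
  have hre0 : 0 ≤ r ^ e := Real.rpow_nonneg hr.le e
  have hq : γ + r ^ e ≤ b := by linarith
  refine ⟨hq, ?_⟩
  have m := monotoneOn_indicial (a := (N : ℝ) - p) hp (show γ ∈ Icc 0 b from ⟨hγ0, hγb.le⟩)
    (show γ + r ^ e ∈ Icc 0 b from ⟨by linarith, hq⟩) (by linarith)
  simp only at m
  have l := hlow r hr hq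
  have : A * r ^ (p - α) ≤ c * r ^ d := by
    have e1 : r ^ (p - α) = r ^ d * r ^ d := by
      rw [← Real.rpow_add hr]; congr 1; rw [hd]; ring
    have e2 : A * r ^ d ≤ c := by
      have := hrd.trans h2
      rw [le_div_iff₀ hA] at this; linarith
    rw [e1, ← mul_assoc]
    exact mul_le_mul_of_nonneg_right e2 (Real.rpow_nonneg hr.le d)
  linarith

/-- The radial profile of the barrier. -/
noncomputable def barrier (γ e κ R r : ℝ) : ℝ := κ * R ^ γ * r ^ (-γ) * Real.exp ((R ^ e - r ^ e) / e)

variable {γ e κ R r : ℝ}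

theorem barrier_pos (hκ : 0 < κ) (hR : 0 < R) (hr : 0 < r) : 0 < barrier γ e κ R r := by
  unfold barrier; positivity

/-- The normalising factors $R^\gamma$ and $e^{R^e/e}$ make the value at $r=R$ equal to $\kappa$;
inside, both remaining factors are at least $1$. -/
theorem le_barrier (hγ : 0 ≤ γ) (he : 0 < e) (hκ : 0 < κ) (hr : 0 < r) (hrR : r ≤ R) :
    κ ≤ barrier γ e κ R r := by
  have hR : 0 < R := hr.trans_le hrR
  have h1 : 1 ≤ R ^ γ * r ^ (-γ) := by
    rw [Real.rpow_neg hr.le, ← div_eq_mul_inv, ← Real.div_rpow hR.le hr.le]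
    exact Real.one_le_rpow (by rwa [one_le_div hr]) hγ
  have h2 : 1 ≤ Real.exp ((R ^ e - r ^ e) / e) :=
    Real.one_le_exp (div_nonneg (sub_nonneg.2 (Real.rpow_le_rpow hr.le hrR he.le)) he.le)
  have h3 := one_le_mul_of_one_le_of_one_le h1 h2
  rw [barrier, mul_assoc κ, mul_assoc κ]
  exact le_mul_of_one_le_right hκ.le h3

/-- The restriction $R\le1$ makes the constant independent of $R$. -/
theorem barrier_le (hγ : 0 ≤ γ) (he : 0 < e) (hκ : 0 < κ) (hr : 0 < r) (hR : 0 < R) (hR1 : R ≤ 1) :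
    barrier γ e κ R r ≤ κ * Real.exp (1 / e) * r ^ (-γ) := by
  have h1 : R ^ γ ≤ 1 := Real.rpow_le_one hR.le hR1 hγ
  have h2 : R ^ e ≤ 1 := Real.rpow_le_one hR.le hR1 he.le
  have h3 : 0 ≤ r ^ e := Real.rpow_nonneg hr.le e
  have h4 : Real.exp ((R ^ e - r ^ e) / e) ≤ Real.exp (1 / e) :=
    Real.exp_le_exp.2 (div_le_div_of_nonneg_right (by linarith) he.le)
  calc barrier γ e κ R r ≤ κ * 1 * r ^ (-γ) * Real.exp (1 / e) := by unfold barrier; gcongr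
    _ = _ := by ring

/-- The exponential factor is chosen so that $-rW'/W$ is exactly $\gamma+r^e$. -/
theorem hasDerivAt_barrier (he : 0 < e) (hr : 0 < r) :
    HasDerivAt (barrier γ e κ R) (-((γ + r ^ e) * barrier γ e κ R r / r)) r := by
  have h1 : HasDerivAt (fun r : ℝ => κ * R ^ γ * r ^ (-γ)) (κ * R ^ γ * (-γ * r ^ (-γ - 1))) r :=
    (Real.hasDerivAt_rpow_const (Or.inl hr.ne')).const_mul _
  have h2 : HasDerivAt (fun r : ℝ => Real.exp ((R ^ e - r ^ e) / e))
      (Real.exp ((R ^ e - r ^ e) / e) * (-(e * r ^ (e - 1)) / e)) r :=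
    (((Real.hasDerivAt_rpow_const (Or.inl hr.ne')).const_sub _).div_const e).exp
  refine (h1.mul h2).congr_deriv ?_
  unfold barrier
  rw [Real.rpow_sub_one hr.ne', Real.rpow_sub_one hr.ne']
  field_simp
  ring

theorem contDiffAt_barrier (hr : 0 < r) (n : ℕ∞) : ContDiffAt ℝ n (barrier γ e κ R) r := by
  unfold barrier
  refine (contDiffAt_const.mul (Real.contDiffAt_rpow_const_of_ne hr.ne')).mul ?_
  exact ((contDiffAt_const.sub (Real.contDiffAt_rpow_const_of_ne hr.ne')).div_const _).exp

theorem measurable_barrier : Measurable (barrier γ e κ R) := by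
  unfold barrier; fun_prop

variable {N : ℕ} {x : EuclideanSpace ℝ (Fin N)}

/-- The gradient of the barrier, as an explicit vector field. -/
noncomputable def barrierGradient (γ e κ R : ℝ) (x : EuclideanSpace ℝ (Fin N)) :
    EuclideanSpace ℝ (Fin N) :=
  (-((γ + ‖x‖ ^ e) * barrier γ e κ R ‖x‖ / ‖x‖) / ‖x‖) • x

theorem measurable_barrierGradient :
    Measurable (barrierGradient γ e κ R : EuclideanSpace ℝ (Fin N) → _) := by
  unfold barrierGradient
  have : Measurable fun x : EuclideanSpace ℝ (Fin N) => barrier γ e κ R ‖x‖ :=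
    measurable_barrier.comp measurable_norm
  fun_prop

theorem contDiffAt_barrier_norm (hx : x ≠ 0) (n : ℕ∞) :
    ContDiffAt ℝ n (fun x : EuclideanSpace ℝ (Fin N) => barrier γ e κ R ‖x‖) x :=
  (contDiffAt_barrier (norm_pos_iff.2 hx) n).comp x (contDiffAt_norm ℝ hx)

theorem hasGradientAt_barrier_norm (he : 0 < e) (hx : x ≠ 0) :
    HasGradientAt (fun x : EuclideanSpace ℝ (Fin N) => barrier γ e κ R ‖x‖)
      (barrierGradient γ e κ R x) x := by
  have hx' : 0 < ‖x‖ := norm_pos_iff.2 hx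
  have h1 : HasFDerivAt (fun y : EuclideanSpace ℝ (Fin N) => ‖y‖) (‖x‖⁻¹ • innerSL ℝ x) x := by
    have hs := (hasStrictFDerivAt_norm_sq x).hasFDerivAt.sqrt (by positivity)
    have e1 : (fun y : EuclideanSpace ℝ (Fin N) => √(‖y‖ ^ 2)) = fun y => ‖y‖ := by
      ext y; exact Real.sqrt_sq (norm_nonneg y)
    rw [e1] at hs
    refine hs.congr_fderiv ?_
    rw [Real.sqrt_sq (norm_nonneg x)]
    ext v
    simp
    field_simp
  have h2 := (hasDerivAt_barrier (γ := γ) (κ := κ) (R := R) he hx').comp_hasFDerivAt x h1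
  rw [hasGradientAt_iff_hasFDerivAt]
  refine h2.congr_fderiv ?_
  ext v
  simp [barrierGradient]
  ring

theorem norm_barrierGradient (hγ : 0 ≤ γ) (hκ : 0 < κ) (hR : 0 < R) (hx : x ≠ 0) :
    ‖barrierGradient γ e κ R x‖ = (γ + ‖x‖ ^ e) * barrier γ e κ R ‖x‖ / ‖x‖ := by
  have hx' : 0 < ‖x‖ := norm_pos_iff.2 hx
  have hW : 0 < barrier γ e κ R ‖x‖ := barrier_pos hκ hR hx'
  rw [barrierGradient, norm_smul, neg_div, norm_neg, Real.norm_of_nonneg (by positivity)]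
  field_simp

/-- The barrier is a supersolution away from the origin. -/
theorem barrier_supersolution {p μ A α R₀ : ℝ} (hp : 1 < p) (hγ : 0 ≤ γ) (he : 0 < e) (hκ : 0 < κ)
    (hR : 0 < R) (hRR : R ≤ R₀)
    (hq : ∀ r, 0 < r → r ≤ R₀ → μ + A * r ^ (p - α) ≤ ((N : ℝ) - p) * (γ + r ^ e) ^ (p - 1)
        - (p - 1) * (γ + r ^ e) ^ p + (p - 1) * e * r ^ e * (γ + r ^ e) ^ (p - 2))
    {φ : EuclideanSpace ℝ (Fin N) → ℝ} (hφ : ContDiff ℝ 1 φ) (hc : HasCompactSupport φ)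
    (hsub : tsupport φ ⊆ ball 0 R \ {0}) (hφ0 : ∀ x, 0 ≤ φ x)
    (hint : Integrable fun x => (μ * ‖x‖ ^ (-p) + A * ‖x‖ ^ (-α))
      * barrier γ e κ R ‖x‖ ^ (p - 1) * φ x) :
    ∫ x, (μ * ‖x‖ ^ (-p) + A * ‖x‖ ^ (-α)) * barrier γ e κ R ‖x‖ ^ (p - 1) * φ x
      ≤ ∫ x, inner ℝ (pFlux p (barrierGradient γ e κ R x)) (gradient φ x) := by
  set W := barrier γ e κ R with hW
  -- $D=|W'|$, and the flux of the barrier is $-s(|x|)x$. The weak inequality thus reduces to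
  -- comparing $Ns+rs'$, the divergence of $s(|x|)x$, with the lower order term.
  let D : ℝ → ℝ := fun r => (γ + r ^ e) * W r / r
  let s : ℝ → ℝ := fun r => D r ^ (p - 1) / r
  have D0 : ∀ r, 0 < r → 0 < D r := fun r hr => by
    have := barrier_pos (γ := γ) (e := e) hκ hR hr
    have : 0 < r ^ e := Real.rpow_pos_of_pos hr e
    simp only [D]; positivity
  have dD : ∀ r, 0 < r → HasDerivAt D (D r / r * (e * r ^ e / (γ + r ^ e) - (γ + r ^ e) - 1)) r := by
    intro r hr
    have hre : 0 < r ^ e := Real.rpow_pos_of_pos hr e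
    have hq0 : γ + r ^ e ≠ 0 := by positivity
    have h1 : HasDerivAt (fun r : ℝ => γ + r ^ e) (e * r ^ (e - 1)) r :=
      (Real.hasDerivAt_rpow_const (Or.inl hr.ne')).const_add γ
    refine ((h1.mul (hasDerivAt_barrier he hr)).div (hasDerivAt_id r) hr.ne').congr_deriv ?_
    simp only [D, hW, Pi.mul_apply, id, Real.rpow_sub_one hr.ne']
    field_simp
    ring
  have ds : ∀ r, 0 < r → HasDerivAt s
      (s r / r * ((p - 1) * (e * r ^ e / (γ + r ^ e) - (γ + r ^ e) - 1) - 1)) r := by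
    intro r hr
    refine (((dD r hr).rpow_const (p := p - 1) (Or.inl (D0 r hr).ne')).div (hasDerivAt_id r)
      hr.ne').congr_deriv ?_
    have : D r ^ (p - 1 - 1) * D r = D r ^ (p - 1) := by
      rw [← Real.rpow_add_one (D0 r hr).ne']; congr 1; ring
    simp only [s, id, ← this]
    field_simp
  have h0 : (0 : EuclideanSpace ℝ (Fin N)) ∉ tsupport φ := fun h => (hsub h).2 rfl
  obtain ⟨-, I2, I3⟩ := integral_mul_fderiv_apply_self (S := fun x => s ‖x‖) (fun x hx => by
    have hx' : 0 < ‖x‖ := norm_pos_iff.2 hx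
    have hre : ContDiffAt ℝ 1 D ‖x‖ :=
      ((contDiffAt_const.add (Real.contDiffAt_rpow_const_of_ne hx'.ne')).mul
        (contDiffAt_barrier hx' 1)).div contDiffAt_id hx'.ne'
    have hs : ContDiffAt ℝ 1 s ‖x‖ :=
      (hre.rpow_const_of_ne (D0 _ hx').ne').div contDiffAt_id hx'.ne'
    exact hs.comp x (contDiffAt_norm ℝ hx)) hφ hc h0
  have e1 : ∀ x, inner ℝ (pFlux p (barrierGradient γ e κ R x)) (gradient φ x)
      = -(s ‖x‖ * fderiv ℝ φ x x) := fun x => by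
    by_cases hx : x = 0
    · have : gradient φ x = 0 := by
        have : fderiv ℝ φ x = 0 := image_eq_zero_of_notMem_tsupport fun h =>
          h0 (hx ▸ tsupport_fderiv_subset ℝ h)
        simp [gradient, this]
      rw [this, hx]; simp
    have hx' : 0 < ‖x‖ := norm_pos_iff.2 hx
    rw [inner_pFlux, norm_barrierGradient hγ hκ hR hx, barrierGradient, inner_smul_left,
      inner_gradient_right]
    change D ‖x‖ ^ (p - 2) * (_ * _) = _
    simp only [conj_trivial, s]
    rw [← rpow_sub_two_mul_self hp (D0 _ hx').le]
    simp only [D, hW]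
    ring
  simp_rw [e1]
  rw [integral_neg, I3, neg_neg]
  refine integral_mono hint I2 fun x => ?_
  by_cases hx : x ∈ tsupport φ
  · have hx0 : x ≠ 0 := (hsub hx).2
    have hx' : 0 < ‖x‖ := norm_pos_iff.2 hx0
    have hxR : ‖x‖ ≤ R₀ := by
      have := (hsub hx).1; rw [mem_ball_zero_iff] at this; linarith
    refine mul_le_mul_of_nonneg_right ?_ (hφ0 x)
    rw [fderiv_comp_norm_apply_self (g := s) hx0 (ds _ hx')]
    set r := ‖x‖
    have hre : 0 < r ^ e := Real.rpow_pos_of_pos hx' e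
    have hq0 : 0 < γ + r ^ e := by positivity
    have hWr : 0 < W r := barrier_pos hκ hR hx'
    have hs : s r = (γ + r ^ e) ^ (p - 1) * (W r ^ (p - 1) * r ^ (-p)) := by
      simp only [s, D]
      rw [Real.div_rpow (by positivity) hx'.le, Real.mul_rpow hq0.le hWr.le, Real.rpow_neg hx'.le,
        ← rpow_sub_one_mul_self hp hx'.le]
      field_simp
    have hpos : 0 < W r ^ (p - 1) * r ^ (-p) := by positivity
    have hα : r ^ (-α) = r ^ (p - α) * r ^ (-p) := by
      rw [← Real.rpow_add hx']; congr 1; ring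
    have lhs : (μ * r ^ (-p) + A * r ^ (-α)) * W r ^ (p - 1)
        = (μ + A * r ^ (p - α)) * (W r ^ (p - 1) * r ^ (-p)) := by rw [hα]; ring
    have q1 : (γ + r ^ e) ^ (p - 1) * (γ + r ^ e) = (γ + r ^ e) ^ p := rpow_sub_one_mul_self hp hq0.le
    have q2 : (γ + r ^ e) ^ (p - 1) / (γ + r ^ e) = (γ + r ^ e) ^ (p - 2) := by
      rw [← Real.rpow_sub_one hq0.ne']; congr 1; ring
    -- The logarithmic derivative $rs'/s=(p-1)(er^e/q-q)-p$, with $q=\gamma+r^e$, turns $Ns+rs'$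
    -- into the Riccati expression times $W^{p-1}r^{-p}$.
    have rhs : (N : ℝ) * s r + r * (s r / r * ((p - 1) * (e * r ^ e / (γ + r ^ e) - (γ + r ^ e) - 1) - 1))
        = (((N : ℝ) - p) * (γ + r ^ e) ^ (p - 1)
        - (p - 1) * (γ + r ^ e) ^ p + (p - 1) * e * r ^ e * (γ + r ^ e) ^ (p - 2))
          * (W r ^ (p - 1) * r ^ (-p)) := by
      rw [← q1, ← q2, hs]; field_simp; ring
    rw [lhs, rhs]
    exact mul_le_mul_of_nonneg_right (hq r hx' hxR) hpos.le
  · simp [image_eq_zero_of_notMem_tsupport hx]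

end Barrier

/-! ### Test functions built from the ratio to the barrier. -/

section Competitor

variable {N : ℕ}

/-- The competitor `w τ((k + ψ) / w)`, cut off outside the support of `ψ`. -/
noncomputable def competitor (k : ℝ) (τ : ℝ → ℝ) (w ψ : EuclideanSpace ℝ (Fin N) → ℝ) :
    EuclideanSpace ℝ (Fin N) → ℝ :=
  (tsupport ψ).indicator fun x => w x * τ ((k + ψ x) / w x)

/-- Where $\psi=0$ the ratio is $k/w<1$ and $\tau$ vanishes, so the cutoff is invisible inside $V$
and the formula may be differentiated there. The gradient is the quotient rule, with the $\nabla w$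
terms collected into $\tau(\theta)-\theta\tau'(\theta)$. -/
theorem competitor_spec {V : Set (EuclideanSpace ℝ (Fin N))} (hV : IsOpen V) {k κ : ℝ}
    (hk : 0 ≤ k) (hkκ : k < κ) {w ψ : EuclideanSpace ℝ (Fin N) → ℝ}
    {a : EuclideanSpace ℝ (Fin N) → EuclideanSpace ℝ (Fin N)}
    (hw : ∀ x ∈ V, ContDiffAt ℝ ∞ w x) (ha : ∀ x ∈ V, HasGradientAt w (a x) x)
    (hκ : ∀ x ∈ V, κ ≤ w x) {τ : ℝ → ℝ} (hτ : ContDiff ℝ ∞ τ) (hτ0 : ∀ t ≤ 1, τ t = 0)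
    (hψ : IsTestFunction V ψ) :
    IsTestFunction V (competitor k τ w ψ) ∧
    (∀ x ∈ V, competitor k τ w ψ x = w x * τ ((k + ψ x) / w x)) ∧
    ∀ x ∈ V, gradient (competitor k τ w ψ) x = deriv τ ((k + ψ x) / w x) • gradient ψ x
      + (τ ((k + ψ x) / w x) - (k + ψ x) / w x * deriv τ ((k + ψ x) / w x)) • a x := by
  obtain ⟨s1, s2, s3⟩ := hψ
  have w0 : ∀ x ∈ V, 0 < w x := fun x hx => by linarith [hκ x hx]
  have val : ∀ x ∈ V, competitor k τ w ψ x = w x * τ ((k + ψ x) / w x) := fun x hx => by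
    by_cases h : x ∈ tsupport ψ
    · rw [competitor, indicator_of_mem h]
    · rw [competitor, indicator_of_notMem h, image_eq_zero_of_notMem_tsupport h, add_zero,
        hτ0 _ ((div_le_one (w0 x hx)).2 (by linarith [hκ x hx])), mul_zero]
  have off : ∀ x, x ∉ tsupport ψ → competitor k τ w ψ =ᶠ[𝓝 x] fun _ => 0 := fun x hx => by
    filter_upwards [(isClosed_tsupport ψ).isOpen_compl.mem_nhds hx] with y hy
    rw [competitor, indicator_of_notMem hy]
  have near : ∀ x ∈ V, competitor k τ w ψ =ᶠ[𝓝 x] fun y => w y * τ ((k + ψ y) / w y) := fun x hx => by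
    filter_upwards [hV.mem_nhds hx] with y hy using val y hy
  have ts : tsupport (competitor k τ w ψ) ⊆ tsupport ψ :=
    closure_minimal (support_indicator_subset) (isClosed_tsupport ψ)
  refine ⟨⟨contDiff_iff_contDiffAt.2 fun x => ?_, IsCompact.of_isClosed_subset s2
    (isClosed_tsupport _) ts, ts.trans s3⟩, val, fun x hx => ?_⟩
  · by_cases hx : x ∈ tsupport ψ
    · have hxV := s3 hx
      refine ContDiffAt.congr_of_eventuallyEq ?_ (near x hxV)
      refine (hw x hxV).mul (hτ.contDiffAt.comp x ?_)
      exact (contDiffAt_const.add s1.contDiffAt).div (hw x hxV) (w0 x hxV).ne'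
    · exact contDiffAt_const.congr_of_eventuallyEq (off x hx)
  · rw [(near x hx).gradient_eq]
    refine HasGradientAt.gradient ?_
    rw [hasGradientAt_iff_hasFDerivAt]
    have hW := (ha x hx).hasFDerivAt
    have hP := (s1.differentiable (by simp) x).hasGradientAt.hasFDerivAt
    have hI := (hasDerivAt_inv (w0 x hx).ne').comp_hasFDerivAt x hW
    have hθ := (hP.const_add k).mul hI
    have hT := ((hτ.differentiable (by simp) ((k + ψ x) * (w x)⁻¹)).hasDerivAt).comp_hasFDerivAt x hθ
    have := hW.mul hT
    refine (this.congr_fderiv ?_).congr_of_eventuallyEq (Eventually.of_forall fun y => ?_)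
    · ext v
      have := (w0 x hx).ne'
      simp [div_eq_mul_inv]
      field_simp
      ring
    · simp [div_eq_mul_inv]

end Competitor

/-! ### Approximation by test functions vanishing near the origin. -/

section Approximation

variable {N : ℕ}

theorem eLpNorm_ofReal_rpow {α F : Type*} [MeasurableSpace α] [NormedAddCommGroup F] {ν : Measure α}
    {p : ℝ} (hp : 0 < p) (f : α → F) :
    eLpNorm f (ENNReal.ofReal p) ν ^ p = ∫⁻ x, ENNReal.ofReal (‖f x‖ ^ p) ∂ν := by
  rw [eLpNorm_eq_lintegral_rpow_enorm_toReal (by simpa using hp) ENNReal.ofReal_ne_top,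
    ENNReal.toReal_ofReal hp.le, ← ENNReal.rpow_mul, one_div_mul_cancel hp.ne', ENNReal.rpow_one]
  refine lintegral_congr fun x => ?_
  rw [← ofReal_norm, ENNReal.ofReal_rpow_of_nonneg (norm_nonneg _) hp.le]

theorem tendsto_eLpNorm_zero_iff {α F : Type*} [MeasurableSpace α] [NormedAddCommGroup F]
    {ν : Measure α} {p : ℝ} (hp : 0 < p) {f : ℕ → α → F} :
    Tendsto (fun n => eLpNorm (f n) (ENNReal.ofReal p) ν) atTop (𝓝 0) ↔
      Tendsto (fun n => ∫⁻ x, ENNReal.ofReal (‖f n x‖ ^ p) ∂ν) atTop (𝓝 0) := by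
  simp_rw [← eLpNorm_ofReal_rpow hp]
  constructor
  · intro h
    have := h.ennrpow_const p
    rwa [ENNReal.zero_rpow_of_pos hp] at this
  · intro h
    have := h.ennrpow_const p⁻¹
    rw [ENNReal.zero_rpow_of_pos (by positivity)] at this
    simpa only [← ENNReal.rpow_mul, mul_inv_cancel₀ hp.ne', ENNReal.rpow_one] using this

theorem tendsto_eLpNorm_zero_of_dominated {α F : Type*} [MeasurableSpace α] [NormedAddCommGroup F]
    {ν : Measure α} {p : ℝ} (hp : 0 < p) {f : ℕ → α → F} {b : α → ℝ}
    (hf : ∀ n, AEStronglyMeasurable (f n) ν) (hb : Integrable b ν)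
    (hfb : ∀ n, ∀ᵐ x ∂ν, ‖f n x‖ ^ p ≤ b x)
    (hlim : ∀ᵐ x ∂ν, Tendsto (fun n => f n x) atTop (𝓝 0)) :
    Tendsto (fun n => eLpNorm (f n) (ENNReal.ofReal p) ν) atTop (𝓝 0) := by
  rw [tendsto_eLpNorm_zero_iff hp]
  have := tendsto_lintegral_of_dominated_convergence' (μ := ν)
    (F := fun n x => ENNReal.ofReal (‖f n x‖ ^ p)) (f := fun _ => 0) (fun x => ENNReal.ofReal (b x))
    (fun n => ((hf n).norm.aemeasurable.pow_const p).ennreal_ofReal)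
    (fun n => (hfb n).mono fun x hx => ENNReal.ofReal_le_ofReal hx)
    hb.lintegral_lt_top.ne ?_
  · simpa using this
  · filter_upwards [hlim] with x hx
    have h1 := (hx.norm.rpow_const (p := p) (Or.inr hp.le))
    rw [norm_zero, Real.zero_rpow hp.ne'] at h1
    simpa using ENNReal.tendsto_ofReal h1

/-- Points have zero `p`-capacity for `p < N`: test functions may be taken to vanish near `0`. -/
theorem exists_isTestFunction_punctured {p R : ℝ} (hp : 1 < p) (hpN : p < N) (hR1 : R ≤ 1)
    {φ : EuclideanSpace ℝ (Fin N) → ℝ} (hφ : IsTestFunction (ball 0 R) φ) {ε : ℝ≥0∞} (hε : 0 < ε) :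
    ∃ ψ : EuclideanSpace ℝ (Fin N) → ℝ, IsTestFunction (ball 0 R \ {0}) ψ ∧
      eLpNorm (fun x => ψ x - φ x) (ENNReal.ofReal p) (volume.restrict (ball 0 R)) ≤ ε ∧
      eLpNorm (fun x => gradient ψ x - gradient φ x) (ENNReal.ofReal p)
        (volume.restrict (ball 0 R)) ≤ ε := by
  obtain ⟨s1, s2, s3⟩ := hφ
  have hN : 0 < N := by
    have : (0 : ℝ) < N := by linarith
    exact_mod_cast this
  have : Nonempty (Fin N) := ⟨⟨0, hN⟩⟩
  obtain ⟨S, S0, hS⟩ := exists_deriv_smoothTransition_le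
  have cgφ : Continuous (gradient φ) :=
    (InnerProductSpace.toDual ℝ _).symm.continuous.comp (s1.continuous_fderiv (by simp))
  have cgs : HasCompactSupport (gradient φ) :=
    (s2.fderiv ℝ).comp_left (g := (InnerProductSpace.toDual ℝ _).symm) (map_zero _)
  obtain ⟨B1, hB1⟩ := s1.continuous.bounded_above_of_compact_support s2
  obtain ⟨B2, hB2⟩ := cgφ.bounded_above_of_compact_support cgs
  have B10 : 0 ≤ B1 := (norm_nonneg _).trans (hB1 0)
  have B20 : 0 ≤ B2 := (norm_nonneg _).trans (hB2 0)
  let s := Real.smoothTransition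
  have hsd : Differentiable ℝ s := Real.smoothTransition.contDiff.differentiable (n := 1) (by norm_num)
  -- These cutoffs vanish for $|x|\le1/(j+1)$ and equal $1$ for $|x|\ge\sqrt2/(j+1)$. In between,
  -- $(j+1)^2|x|^2<2$ bounds the gradient by $4S/|x|$ uniformly in $j$; since $p<N$, this majorant
  -- is in $L^p$ and dominated convergence applies.
  let χ : ℕ → EuclideanSpace ℝ (Fin N) → ℝ := fun j x => s ((j + 1) ^ 2 * ‖x‖ ^ 2 - 1)
  have hχs : ∀ j, ContDiff ℝ ∞ (χ j) := fun j =>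
    Real.smoothTransition.contDiff.comp ((contDiff_const.mul (contDiff_norm_sq ℝ)).sub contDiff_const)
  have hχ01 : ∀ j x, |χ j x - 1| ≤ 1 := fun j x => by
    have h1 : 0 ≤ χ j x := Real.smoothTransition.nonneg _
    have h2 : χ j x ≤ 1 := Real.smoothTransition.le_one _
    rw [abs_le]; constructor <;> linarith
  have hχ1 : ∀ (j : ℕ) (x : EuclideanSpace ℝ (Fin N)), 2 ≤ ((j : ℝ) + 1) ^ 2 * ‖x‖ ^ 2 → χ j x = 1 :=
    fun j x h => Real.smoothTransition.one_of_one_le (by linarith)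
  have gχ : ∀ j x, HasFDerivAt (χ j) ((deriv s ((j + 1) ^ 2 * ‖x‖ ^ 2 - 1)) •
      (((j : ℝ) + 1) ^ 2 • (2 • innerSL ℝ x))) x := fun j x =>
    (hsd _).hasDerivAt.comp_hasFDerivAt x
      (((hasStrictFDerivAt_norm_sq x).hasFDerivAt.const_mul (((j : ℝ) + 1) ^ 2)).sub_const 1)
  have gχ1 : ∀ (j : ℕ) x, 2 ≤ ((j : ℝ) + 1) ^ 2 * ‖x‖ ^ 2 → fderiv ℝ (χ j) x = 0 := fun j x h => by
    have := deriv_eq_zero_of_forall_ge (τ := fun t => s t - 1) (c := 1) ((hsd _).sub_const 1)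
        (t := (j + 1) ^ 2 * ‖x‖ ^ 2 - 1)
        (fun t ht => by simp [s, Real.smoothTransition.one_of_one_le ht]) (by linarith)
    rw [deriv_sub_const] at this
    rw [(gχ j x).fderiv, this, zero_smul]
  have gχb : ∀ j x, x ≠ 0 → ‖fderiv ℝ (χ j) x‖ ≤ 4 * S * ‖x‖⁻¹ := fun j x hx => by
    have hx' : 0 < ‖x‖ := norm_pos_iff.2 hx
    rcases le_or_gt 2 (((j : ℝ) + 1) ^ 2 * ‖x‖ ^ 2) with h | h
    · rw [gχ1 j x h, norm_zero]; positivity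
    · rw [(gχ j x).fderiv, norm_smul, norm_smul, two_smul, Real.norm_of_nonneg (sq_nonneg _)]
      have h1 : ‖innerSL ℝ x + innerSL ℝ x‖ ≤ 2 * ‖x‖ := by
        refine (norm_add_le _ _).trans ?_
        rw [innerSL_apply_norm]; linarith
      have h2 : ((j : ℝ) + 1) ^ 2 * (2 * ‖x‖) ≤ 4 * ‖x‖⁻¹ := by
        rw [← div_eq_mul_inv, le_div_iff₀ hx']; nlinarith
      calc ‖deriv s ((j + 1) ^ 2 * ‖x‖ ^ 2 - 1)‖ * (((j : ℝ) + 1) ^ 2 * ‖innerSL ℝ x + innerSL ℝ x‖)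
          ≤ S * (((j : ℝ) + 1) ^ 2 * (2 * ‖x‖)) := by gcongr; exact hS _
        _ ≤ S * (4 * ‖x‖⁻¹) := by gcongr
        _ = _ := by ring
  let ψ : ℕ → EuclideanSpace ℝ (Fin N) → ℝ := fun j x => χ j x * φ x
  have hψt : ∀ j, IsTestFunction (ball 0 R \ {0}) (ψ j) := fun j => by
    refine ⟨(hχs j).mul s1, s2.mul_left, fun x hx => ⟨s3 (tsupport_mul_subset_right hx), ?_⟩⟩
    rintro rfl
    have h1 : (0 : EuclideanSpace ℝ (Fin N)) ∈ tsupport (χ j) := tsupport_mul_subset_left hx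
    have h2 : χ j =ᶠ[𝓝 0] 0 := by
      have : Tendsto (fun x : EuclideanSpace ℝ (Fin N) => ((j : ℝ) + 1) ^ 2 * ‖x‖ ^ 2) (𝓝 0)
          (𝓝 (((j : ℝ) + 1) ^ 2 * ‖(0 : EuclideanSpace ℝ (Fin N))‖ ^ 2)) :=
        Continuous.tendsto (by fun_prop) 0
      rw [norm_zero] at this
      filter_upwards [this.eventually_le_const (show ((j : ℝ) + 1) ^ 2 * 0 ^ 2 < 1 by norm_num)] with y hy
      exact Real.smoothTransition.zero_of_nonpos (by linarith)
    exact notMem_tsupport_iff_eventuallyEq.2 h2 h1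
  have gψ : ∀ j x, gradient (ψ j) x = χ j x • gradient φ x + φ x • gradient (χ j) x := fun j x => by
    have h := ((hχs j).differentiable (by simp) x).hasFDerivAt.mul
      (s1.differentiable (by simp) x).hasFDerivAt
    have h2 : fderiv ℝ (ψ j) x = _ := h.fderiv
    simp only [gradient, h2, map_add, map_smulₛₗ, conj_trivial]
  have big : ∀ x : EuclideanSpace ℝ (Fin N), x ≠ 0 →
      ∀ᶠ j : ℕ in atTop, 2 ≤ ((j : ℝ) + 1) ^ 2 * ‖x‖ ^ 2 := fun x hx => by
    have hx' : 0 < ‖x‖ := norm_pos_iff.2 hx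
    have h1 : Tendsto (fun j : ℕ => ((j : ℝ) + 1) ^ 2) atTop atTop :=
      (tendsto_pow_atTop two_ne_zero).comp
        (tendsto_atTop_add_const_right _ _ tendsto_natCast_atTop_atTop)
    exact (h1.atTop_mul_const (by positivity : 0 < ‖x‖ ^ 2)).eventually_ge_atTop 2
  have ne0 : ∀ᵐ x : EuclideanSpace ℝ (Fin N) ∂(volume.restrict (ball 0 R)), x ≠ 0 :=
    ae_restrict_of_ae (Measure.ae_ne volume 0)
  have inb : ∀ᵐ x : EuclideanSpace ℝ (Fin N) ∂(volume.restrict (ball 0 R)), x ∈ ball 0 R :=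
    ae_restrict_mem measurableSet_ball
  have p0 : 0 < p := by linarith
  have cgψ : ∀ j, Continuous (gradient (ψ j)) := fun j =>
    (InnerProductSpace.toDual ℝ _).symm.continuous.comp ((hψt j).1.continuous_fderiv (by simp))
  have T1 : Tendsto (fun j => eLpNorm (fun x => ψ j x - φ x) (ENNReal.ofReal p)
      (volume.restrict (ball 0 R))) atTop (𝓝 0) := by
    refine tendsto_eLpNorm_zero_of_dominated p0 (b := fun _ => B1 ^ p)
      (fun j => ((hψt j).1.continuous.sub s1.continuous).aestronglyMeasurable)
      (integrableOn_const measure_ball_lt_top.ne) (fun j => ae_of_all _ fun x => ?_) ?_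
    · have : ψ j x - φ x = (χ j x - 1) * φ x := by simp only [ψ]; ring
      rw [this, norm_mul, Real.norm_eq_abs]
      refine Real.rpow_le_rpow (by positivity) ?_ p0.le
      exact (mul_le_of_le_one_left (norm_nonneg _) (hχ01 j x)).trans (hB1 x)
    · filter_upwards [ne0] with x hx
      refine tendsto_const_nhds.congr' ?_
      filter_upwards [big x hx] with j hj
      simp [ψ, hχ1 j x hj]
  have T2 : Tendsto (fun j => eLpNorm (fun x => gradient (ψ j) x - gradient φ x) (ENNReal.ofReal p)
      (volume.restrict (ball 0 R))) atTop (𝓝 0) := by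
    refine tendsto_eLpNorm_zero_of_dominated p0
      (b := fun x => (B2 + B1 * (4 * S)) ^ p * ‖x‖ ^ (-p))
      (fun j => ((cgψ j).sub cgφ).aestronglyMeasurable)
      ((integrableOn_norm_rpow_neg_ball hN hpN R).const_mul _) (fun j => ?_) ?_
    · filter_upwards [ne0, inb] with x hx hxR
      have hx' : 0 < ‖x‖ := norm_pos_iff.2 hx
      have h1 : 1 ≤ ‖x‖⁻¹ := (one_le_inv₀ hx').2 (by rw [mem_ball_zero_iff] at hxR; linarith)
      have e : gradient (ψ j) x - gradient φ x
          = (χ j x - 1) • gradient φ x + φ x • gradient (χ j) x := by rw [gψ]; module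
      have e2 : (B2 + B1 * (4 * S)) ^ p * ‖x‖ ^ (-p) = ((B2 + B1 * (4 * S)) * ‖x‖⁻¹) ^ p := by
        rw [Real.mul_rpow (by positivity) (by positivity), Real.rpow_neg hx'.le,
          Real.inv_rpow hx'.le]
      rw [e, e2]
      refine Real.rpow_le_rpow (by positivity) ((norm_add_le _ _).trans ?_) p0.le
      rw [norm_smul, norm_smul, add_mul, Real.norm_eq_abs]
      have b1 : |χ j x - 1| * ‖gradient φ x‖ ≤ B2 * ‖x‖⁻¹ :=
        ((mul_le_of_le_one_left (norm_nonneg _) (hχ01 j x)).trans (hB2 x)).trans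
          (le_mul_of_one_le_right B20 h1)
      have b2 : ‖φ x‖ * ‖gradient (χ j) x‖ ≤ B1 * (4 * S) * ‖x‖⁻¹ := by
        rw [norm_gradient, mul_assoc]
        exact mul_le_mul (hB1 x) (gχb j x hx) (norm_nonneg _) B10
      linarith
    · filter_upwards [ne0] with x hx
      refine tendsto_const_nhds.congr' ?_
      filter_upwards [big x hx] with j hj
      have : gradient (χ j) x = 0 := by simp [gradient, gχ1 j x hj]
      simp [gψ, hχ1 j x hj, this]
  obtain ⟨j, h1, h2⟩ := ((T1.eventually_le_const hε).and (T2.eventually_le_const hε)).exists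
  exact ⟨ψ j, hψt j, h1, h2⟩

/-- A function in `W₀^{1,p}` of a ball is the limit of test functions vanishing near the origin. -/
theorem MemW1p0.exists_seq_punctured {p R : ℝ} (hp : 1 < p) (hpN : p < N) (hR1 : R ≤ 1)
    {z : EuclideanSpace ℝ (Fin N) → ℝ} (hz : MemW1p0 (ball 0 R) p z) :
    ∃ (G : EuclideanSpace ℝ (Fin N) → EuclideanSpace ℝ (Fin N))
      (ψ : ℕ → EuclideanSpace ℝ (Fin N) → ℝ),
      MemLp z (ENNReal.ofReal p) (volume.restrict (ball 0 R)) ∧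
      MemLp G (ENNReal.ofReal p) (volume.restrict (ball 0 R)) ∧
      HasWeakGradient (ball 0 R) z G ∧
      (∀ n, IsTestFunction (ball 0 R \ {0}) (ψ n)) ∧
      (∀ᵐ x ∂(volume.restrict (ball 0 R)), Tendsto (fun n => ψ n x) atTop (𝓝 (z x))) ∧
      Tendsto (fun n => eLpNorm (fun x => gradient (ψ n) x - G x) (ENNReal.ofReal p)
        (volume.restrict (ball 0 R))) atTop (𝓝 0) := by
  obtain ⟨G, hz1, hG, hw, happ⟩ := hz
  set ν := volume.restrict (ball (0 : EuclideanSpace ℝ (Fin N)) R)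
  have hp1 : 1 ≤ ENNReal.ofReal p := by simpa using hp.le
  have cg : ∀ {U : Set (EuclideanSpace ℝ (Fin N))} {φ : EuclideanSpace ℝ (Fin N) → ℝ},
      IsTestFunction U φ → Continuous (gradient φ) := fun h =>
    (InnerProductSpace.toDual ℝ _).symm.continuous.comp (h.1.continuous_fderiv (by simp))
  have step : ∀ ε : ℝ≥0∞, 0 < ε → ∃ ψ : EuclideanSpace ℝ (Fin N) → ℝ,
      IsTestFunction (ball 0 R \ {0}) ψ ∧
      eLpNorm (ψ - z) (ENNReal.ofReal p) ν ≤ ε + ε ∧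
      eLpNorm (fun x => gradient ψ x - G x) (ENNReal.ofReal p) ν ≤ ε + ε := fun ε hε => by
    obtain ⟨φ, f1, f2, f3⟩ := happ ε hε
    obtain ⟨ψ, g1, g2, g3⟩ := exists_isTestFunction_punctured hp hpN hR1 f1 hε
    refine ⟨ψ, g1, ?_, ?_⟩
    · have e : ψ - z = (fun x => ψ x - φ x) + fun x => φ x - z x := by ext x; simp
      rw [e]
      refine (eLpNorm_add_le ?_ ?_ hp1).trans (add_le_add g2 f2)
      · exact (g1.1.continuous.sub f1.1.continuous).aestronglyMeasurable
      · exact f1.1.continuous.aestronglyMeasurable.sub hz1.1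
    · have e : (fun x => gradient ψ x - G x)
          = (fun x => gradient ψ x - gradient φ x) + fun x => gradient φ x - G x := by ext1 x; simp
      rw [e]
      refine (eLpNorm_add_le ?_ ?_ hp1).trans (add_le_add g3 f3)
      · exact ((cg g1).sub (cg f1)).aestronglyMeasurable
      · exact (cg f1).aestronglyMeasurable.sub hG.1
  choose ψ h1 h2 h3 using fun n : ℕ => step ((n : ℝ≥0∞) + 1)⁻¹ (by simp)
  have t0 : Tendsto (fun n : ℕ => ((n : ℝ≥0∞) + 1)⁻¹ + ((n : ℝ≥0∞) + 1)⁻¹) atTop (𝓝 0) := by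
    have h : Tendsto (fun n : ℕ => ((n : ℝ≥0∞) + 1)⁻¹) atTop (𝓝 0) := by
      have := (tendsto_add_atTop_iff_nat 1).2 ENNReal.tendsto_inv_nat_nhds_zero
      simpa using this
    simpa using h.add h
  have t1 : Tendsto (fun n => eLpNorm (ψ n - z) (ENNReal.ofReal p) ν) atTop (𝓝 0) :=
    tendsto_of_tendsto_of_tendsto_of_le_of_le tendsto_const_nhds t0 (fun _ => zero_le) h2
  have t2 : Tendsto (fun n => eLpNorm (fun x => gradient (ψ n) x - G x) (ENNReal.ofReal p) ν)
      atTop (𝓝 0) :=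
    tendsto_of_tendsto_of_tendsto_of_le_of_le tendsto_const_nhds t0 (fun _ => zero_le) h3
  obtain ⟨ns, hns, hae⟩ := (tendstoInMeasure_of_tendsto_eLpNorm (by positivity)
    (fun n => (h1 n).1.continuous.aestronglyMeasurable) hz1.1 t1).exists_seq_tendsto_ae
  exact ⟨G, fun n => ψ (ns n), hz1, hG, hw, fun n => h1 _, hae, t2.comp hns.tendsto_atTop⟩

end Approximation

/-! ### Integrability and passage to the limit. -/

section Limits

variable {N : ℕ}

theorem IsTestFunction.continuous_gradient {U : Set (EuclideanSpace ℝ (Fin N))}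
    {φ : EuclideanSpace ℝ (Fin N) → ℝ} (h : IsTestFunction U φ) : Continuous (gradient φ) :=
  (InnerProductSpace.toDual ℝ _).symm.continuous.comp (h.1.continuous_fderiv (by simp))

theorem IsTestFunction.hasCompactSupport_gradient {U : Set (EuclideanSpace ℝ (Fin N))}
    {φ : EuclideanSpace ℝ (Fin N) → ℝ} (h : IsTestFunction U φ) : HasCompactSupport (gradient φ) :=
  (h.2.1.fderiv ℝ).comp_left (g := (InnerProductSpace.toDual ℝ _).symm) (map_zero _)

theorem IsTestFunction.gradient_eq_zero {U : Set (EuclideanSpace ℝ (Fin N))}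
    {φ : EuclideanSpace ℝ (Fin N) → ℝ} (h : IsTestFunction U φ) {x : EuclideanSpace ℝ (Fin N)}
    (hx : x ∉ U) : gradient φ x = 0 := by
  have : fderiv ℝ φ x = 0 :=
    image_eq_zero_of_notMem_tsupport fun h' => hx (h.2.2 (tsupport_fderiv_subset ℝ h'))
  simp [gradient, this]

theorem IsTestFunction.eq_zero {U : Set (EuclideanSpace ℝ (Fin N))}
    {φ : EuclideanSpace ℝ (Fin N) → ℝ} (h : IsTestFunction U φ) {x : EuclideanSpace ℝ (Fin N)}
    (hx : x ∉ U) : φ x = 0 := image_eq_zero_of_notMem_tsupport fun h' => hx (h.2.2 h')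

/-- Hardy's inequality passes to the limit. -/
theorem integrable_hardy_of_tendsto {p R : ℝ} (hp : 1 < p) (hpN : p < N)
    {z : EuclideanSpace ℝ (Fin N) → ℝ} {G : EuclideanSpace ℝ (Fin N) → EuclideanSpace ℝ (Fin N)}
    {ψ : ℕ → EuclideanSpace ℝ (Fin N) → ℝ}
    (hz : AEStronglyMeasurable z (volume.restrict (ball 0 R)))
    (hG : MemLp G (ENNReal.ofReal p) (volume.restrict (ball 0 R)))
    (hψ : ∀ n, IsTestFunction (ball 0 R \ {0}) (ψ n))
    (hlim : ∀ᵐ x ∂(volume.restrict (ball 0 R)), Tendsto (fun n => ψ n x) atTop (𝓝 (z x)))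
    (hgrad : Tendsto (fun n => eLpNorm (fun x => gradient (ψ n) x - G x) (ENNReal.ofReal p)
        (volume.restrict (ball 0 R))) atTop (𝓝 0)) :
    IntegrableOn (fun x => ‖x‖ ^ (-p) * |z x| ^ p) (ball 0 R) := by
  have p0 : 0 < p := by linarith
  have hp1 : 1 ≤ ENNReal.ofReal p := by simpa using hp.le
  set ν := volume.restrict (ball (0 : EuclideanSpace ℝ (Fin N)) R)
  obtain ⟨C, C0, hC⟩ := hardy_inequality hp hpN
  set K := 1 + eLpNorm G (ENNReal.ofReal p) ν
  have hK : K ≠ ⊤ := ENNReal.add_ne_top.2 ⟨ENNReal.one_ne_top, hG.2.ne⟩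
  have bound : ∀ᶠ n in atTop,
      ∫⁻ x, ENNReal.ofReal (‖x‖ ^ (-p) * |ψ n x| ^ p) ∂ν ≤ ENNReal.ofReal C * K ^ p := by
    filter_upwards [hgrad.eventually_le_const (zero_lt_one)] with n hn
    have h0 : (0 : EuclideanSpace ℝ (Fin N)) ∉ tsupport (ψ n) := fun h => ((hψ n).2.2 h).2 rfl
    have h1 := hC (ψ n) ((hψ n).1.of_le (by simp)) (hψ n).2.1 h0
    have h2 : ∫⁻ x, ENNReal.ofReal (‖gradient (ψ n) x‖ ^ p)
        = ∫⁻ x, ENNReal.ofReal (‖gradient (ψ n) x‖ ^ p) ∂ν := by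
      refine (setLIntegral_eq_of_support_subset fun x hx => ?_).symm
      by_contra hxU
      have : gradient (ψ n) x = 0 := (hψ n).gradient_eq_zero fun h => hxU h.1
      simp [this, Real.zero_rpow p0.ne'] at hx
    refine (lintegral_mono' Measure.restrict_le_self le_rfl).trans (h1.trans ?_)
    rw [h2, ← eLpNorm_ofReal_rpow p0]
    gcongr
    have e : gradient (ψ n) = (fun x => gradient (ψ n) x - G x) + G := by ext1 x; simp
    rw [e]
    refine (eLpNorm_add_le ?_ hG.1 hp1).trans (add_le_add_left hn _)
    exact (hψ n).continuous_gradient.aestronglyMeasurable.sub hG.1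
  have mN : Measurable fun x : EuclideanSpace ℝ (Fin N) => ‖x‖ ^ (-p) := by fun_prop
  have fatou := lintegral_liminf_le' (μ := ν) (u := atTop)
    (f := fun n x => ENNReal.ofReal (‖x‖ ^ (-p) * |ψ n x| ^ p)) fun n => by
      have : Measurable (ψ n) := (hψ n).1.continuous.measurable
      exact (mN.mul (this.norm.pow_const p)).ennreal_ofReal.aemeasurable
  have e : ∫⁻ x, ENNReal.ofReal (‖x‖ ^ (-p) * |z x| ^ p) ∂ν
      = ∫⁻ x, liminf (fun n => ENNReal.ofReal (‖x‖ ^ (-p) * |ψ n x| ^ p)) atTop ∂ν := by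
    refine lintegral_congr_ae ?_
    filter_upwards [hlim] with x hx
    refine (Tendsto.liminf_eq ?_).symm
    exact ENNReal.tendsto_ofReal ((hx.abs.rpow_const (Or.inr p0.le)).const_mul _)
  have fin : ∫⁻ x, ENNReal.ofReal (‖x‖ ^ (-p) * |z x| ^ p) ∂ν < ⊤ := by
    rw [e]
    refine (fatou.trans (liminf_le_of_frequently_le' bound.frequently)).trans_lt ?_
    exact ENNReal.mul_lt_top ENNReal.ofReal_lt_top (ENNReal.rpow_lt_top_of_nonneg p0.le hK)
  refine ⟨mN.aestronglyMeasurable.mul ?_, ?_⟩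
  · exact (hz.norm.aemeasurable.pow_const p).aestronglyMeasurable
  · rw [hasFiniteIntegral_iff_ofReal (ae_of_all _ fun x => by positivity)]; exact fin

theorem measurable_pFlux (p : ℝ) :
    Measurable (pFlux p : EuclideanSpace ℝ (Fin N) → EuclideanSpace ℝ (Fin N)) := by
  unfold pFlux; fun_prop

variable {α : Type*} [MeasurableSpace α] {ν : Measure α} {p : ℝ}

theorem aestronglyMeasurable_pFlux {e : α → EuclideanSpace ℝ (Fin N)}
    (he : AEStronglyMeasurable e ν) : AEStronglyMeasurable (fun x => pFlux p (e x)) ν :=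
  ((measurable_pFlux p).comp_aemeasurable he.aemeasurable).aestronglyMeasurable

theorem MeasureTheory.MemLp.integrable_norm_rpow_ofReal {F : Type*} [NormedAddCommGroup F]
    (hp : 0 < p) {f : α → F} (hf : MemLp f (ENNReal.ofReal p) ν) :
    Integrable (fun x => ‖f x‖ ^ p) ν := by
  have := hf.integrable_norm_rpow (by simpa using hp) ENNReal.ofReal_ne_top
  rwa [ENNReal.toReal_ofReal hp.le] at this

theorem integrable_inner_pFlux (hp : 1 < p) {e g : α → EuclideanSpace ℝ (Fin N)}
    (he : MemLp e (ENNReal.ofReal p) ν) (hg : MemLp g (ENNReal.ofReal p) ν) :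
    Integrable (fun x => inner ℝ (pFlux p (e x)) (g x)) ν := by
  refine (((he.integrable_norm_rpow_ofReal (by linarith)).const_mul (p - 1)).add
    (hg.integrable_norm_rpow_ofReal (by linarith))).mono'
    ((aestronglyMeasurable_pFlux he.1).inner hg.1) (ae_of_all _ fun x => ?_)
  have h1 := mul_inner_pFlux_le hp (e x) (g x)
  have h2 := mul_inner_pFlux_le hp (e x) (-g x)
  rw [inner_neg_right, norm_neg] at h2
  simp only [Pi.add_apply]
  set b := (p - 1) * ‖e x‖ ^ p + ‖g x‖ ^ p
  have : |p * inner ℝ (pFlux p (e x)) (g x)| ≤ b := abs_le.2 ⟨by linarith, h1⟩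
  rw [abs_mul, abs_of_pos (by linarith : 0 < p)] at this
  refine le_trans ?_ this
  exact le_mul_of_one_le_left (abs_nonneg _) hp.le

theorem MeasureTheory.MemLp.bdd_smul {g : α → EuclideanSpace ℝ (Fin N)} {c : α → ℝ} {B : ℝ} {q : ℝ≥0∞}
    (hg : MemLp g q ν) (hc : AEStronglyMeasurable c ν) (hB : ∀ᵐ x ∂ν, |c x| ≤ B) :
    MemLp (fun x => c x • g x) q ν := by
  refine MemLp.of_le_mul (c := B) hg (hc.smul hg.1) ?_
  filter_upwards [hB] with x hx
  rw [norm_smul]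
  exact mul_le_mul_of_nonneg_right hx (norm_nonneg _)

/-- The integrand is split as $(c_nG+d_na)+c_n(g_n-G)$: dominated convergence handles the first
part, Hölder's inequality the second, since the coefficients are uniformly bounded. -/
theorem tendsto_integral_inner_pFlux (hp : 1 < p) {e G a : α → EuclideanSpace ℝ (Fin N)}
    {g : ℕ → α → EuclideanSpace ℝ (Fin N)} {c d : ℕ → α → ℝ} {c' d' : α → ℝ} {B : ℝ}
    (he : MemLp e (ENNReal.ofReal p) ν) (hG : MemLp G (ENNReal.ofReal p) ν)
    (ha : MemLp a (ENNReal.ofReal p) ν) (hg : ∀ n, MemLp (g n) (ENNReal.ofReal p) ν)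
    (hgG : Tendsto (fun n => eLpNorm (fun x => g n x - G x) (ENNReal.ofReal p) ν) atTop (𝓝 0))
    (hc : ∀ n, AEStronglyMeasurable (c n) ν) (hd : ∀ n, AEStronglyMeasurable (d n) ν)
    (hcB : ∀ n x, |c n x| ≤ B) (hdB : ∀ n x, |d n x| ≤ B)
    (hcl : ∀ᵐ x ∂ν, Tendsto (fun n => c n x) atTop (𝓝 (c' x)))
    (hdl : ∀ᵐ x ∂ν, Tendsto (fun n => d n x) atTop (𝓝 (d' x))) :
    Integrable (fun x => inner ℝ (pFlux p (e x)) (c' x • G x + d' x • a x)) ν ∧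
    Tendsto (fun n => ∫ x, inner ℝ (pFlux p (e x)) (c n x • g n x + d n x • a x) ∂ν) atTop
      (𝓝 (∫ x, inner ℝ (pFlux p (e x)) (c' x • G x + d' x • a x) ∂ν)) := by
  have p0 : 0 < p := by linarith
  have hc' : AEStronglyMeasurable c' ν := aestronglyMeasurable_of_tendsto_ae atTop hc hcl
  have hd' : AEStronglyMeasurable d' ν := aestronglyMeasurable_of_tendsto_ae atTop hd hdl
  have hcB' : ∀ᵐ x ∂ν, |c' x| ≤ B := hcl.mono fun x hx => le_of_tendsto' hx.abs fun n => hcB n x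
  have hdB' : ∀ᵐ x ∂ν, |d' x| ≤ B := hdl.mono fun x hx => le_of_tendsto' hx.abs fun n => hdB n x
  have m1 : ∀ n, MemLp (fun x => c n x • G x + d n x • a x) (ENNReal.ofReal p) ν := fun n =>
    (hG.bdd_smul (hc n) (ae_of_all _ (hcB n))).add (ha.bdd_smul (hd n) (ae_of_all _ (hdB n)))
  have m2 : ∀ n, MemLp (fun x => c n x • (g n x - G x)) (ENNReal.ofReal p) ν := fun n =>
    ((hg n).sub hG).bdd_smul (hc n) (ae_of_all _ (hcB n))
  refine ⟨integrable_inner_pFlux hp he ((hG.bdd_smul hc' hcB').add (ha.bdd_smul hd' hdB')), ?_⟩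
  have iGn : Integrable (fun x => ‖e x‖ ^ (p - 1) * ‖G x‖) ν ∧
      Integrable (fun x => ‖e x‖ ^ (p - 1) * ‖a x‖) ν := by
    have key : ∀ h : α → EuclideanSpace ℝ (Fin N), MemLp h (ENNReal.ofReal p) ν →
        Integrable (fun x => ‖e x‖ ^ (p - 1) * ‖h x‖) ν := fun h hh => by
      refine ((he.integrable_norm_rpow_ofReal p0).add
        ((hh.integrable_norm_rpow_ofReal p0).const_mul (p * (p / 1) ^ (p - 1)))).mono'
        ((he.1.norm.aemeasurable.pow_const _).aestronglyMeasurable.mul hh.1.norm)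
        (ae_of_all _ fun x => ?_)
      have y := rpow_mul_le_add hp zero_lt_one (norm_nonneg (e x)) (norm_nonneg (h x))
      simp only [Pi.add_apply]
      rw [Real.norm_of_nonneg (by positivity)]
      refine le_trans ?_ (y.trans (by rw [one_mul]))
      rw [mul_assoc]
      exact le_mul_of_one_le_left (by positivity) hp.le
    exact ⟨key G hG, key a ha⟩
  have L1 : Tendsto (fun n => ∫ x, inner ℝ (pFlux p (e x)) (c n x • G x + d n x • a x) ∂ν) atTop
      (𝓝 (∫ x, inner ℝ (pFlux p (e x)) (c' x • G x + d' x • a x) ∂ν)) := by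
    refine tendsto_integral_of_dominated_convergence
      (fun x => B * (‖e x‖ ^ (p - 1) * ‖G x‖) + B * (‖e x‖ ^ (p - 1) * ‖a x‖))
      (fun n => (aestronglyMeasurable_pFlux he.1).inner (m1 n).1)
      ((iGn.1.const_mul B).add (iGn.2.const_mul B)) (fun n => ae_of_all _ fun x => ?_) ?_
    · refine (norm_inner_le_norm _ _).trans ?_
      rw [norm_pFlux hp]
      have h1 : ‖c n x • G x + d n x • a x‖ ≤ B * ‖G x‖ + B * ‖a x‖ := by
        refine (norm_add_le _ _).trans ?_
        rw [norm_smul, norm_smul]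
        exact add_le_add (mul_le_mul_of_nonneg_right (hcB n x) (norm_nonneg _))
          (mul_le_mul_of_nonneg_right (hdB n x) (norm_nonneg _))
      refine (mul_le_mul_of_nonneg_left h1 (by positivity)).trans (le_of_eq (by ring))
    · filter_upwards [hcl, hdl] with x h1 h2
      exact tendsto_const_nhds.inner ((h1.smul_const _).add (h2.smul_const _))
  have L2 : Tendsto (fun n => ∫ x, inner ℝ (pFlux p (e x)) (c n x • (g n x - G x)) ∂ν) atTop
      (𝓝 0) := by
    have hq : (p / (p - 1)).HolderConjugate p := (Real.HolderConjugate.conjExponent hp).symm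
    set K := (∫⁻ x, (‖e x‖ₑ ^ (p - 1)) ^ (p / (p - 1)) ∂ν) ^ (1 / (p / (p - 1))) with hKdef
    have hK : K ≠ ⊤ := by
      refine (ENNReal.rpow_lt_top_of_nonneg (by have : 0 < p - 1 := by linarith
                                                positivity) ?_).ne
      have : ∀ x, (‖e x‖ₑ ^ (p - 1)) ^ (p / (p - 1)) = ENNReal.ofReal (‖e x‖ ^ p) := fun x => by
        rw [← ENNReal.rpow_mul, mul_div_cancel₀ _ (by linarith : p - 1 ≠ 0), ← ofReal_norm,
          ENNReal.ofReal_rpow_of_nonneg (norm_nonneg _) p0.le]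
      simp_rw [this]
      exact (he.integrable_norm_rpow_ofReal p0).lintegral_lt_top.ne
    have hn : ∀ n, ∫⁻ x, ‖inner ℝ (pFlux p (e x)) (c n x • (g n x - G x)) - (0 : ℝ)‖ₑ ∂ν
        ≤ ENNReal.ofReal B * (K * eLpNorm (fun x => g n x - G x) (ENNReal.ofReal p) ν) := fun n => by
      have hol := ENNReal.lintegral_mul_le_Lp_mul_Lq ν hq
        (f := fun x => ‖e x‖ₑ ^ (p - 1)) (g := fun x => ‖g n x - G x‖ₑ)
        (he.1.enorm.pow_const _) (((hg n).1.sub hG.1).enorm)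
      have e2 : (∫⁻ x, ‖g n x - G x‖ₑ ^ p ∂ν) ^ (1 / p)
          = eLpNorm (fun x => g n x - G x) (ENNReal.ofReal p) ν := by
        rw [eLpNorm_eq_lintegral_rpow_enorm_toReal (by simpa using p0) ENNReal.ofReal_ne_top,
          ENNReal.toReal_ofReal p0.le]
      rw [e2] at hol
      refine le_trans ?_ (mul_le_mul_right hol _)
      rw [← lintegral_const_mul' _ _ ENNReal.ofReal_ne_top]
      refine lintegral_mono fun x => ?_
      have hreal : ‖inner ℝ (pFlux p (e x)) (c n x • (g n x - G x))‖
          ≤ B * (‖e x‖ ^ (p - 1) * ‖g n x - G x‖) := by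
        refine (norm_inner_le_norm _ _).trans ?_
        rw [norm_pFlux hp, norm_smul, Real.norm_eq_abs]
        have := mul_le_mul_of_nonneg_right (hcB n x)
          (by positivity : 0 ≤ ‖e x‖ ^ (p - 1) * ‖g n x - G x‖)
        refine le_trans (le_of_eq (by ring)) this
      have B0 : 0 ≤ B := (abs_nonneg _).trans (hcB n x)
      rw [sub_zero, ← ofReal_norm]
      refine (ENNReal.ofReal_le_ofReal hreal).trans (le_of_eq ?_)
      rw [ENNReal.ofReal_mul B0, ENNReal.ofReal_mul (by positivity),
        ← ENNReal.ofReal_rpow_of_nonneg (norm_nonneg _) (by linarith), ofReal_norm, ofReal_norm]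
      rfl
    have h0 : Tendsto (fun n => ENNReal.ofReal B *
        (K * eLpNorm (fun x => g n x - G x) (ENNReal.ofReal p) ν)) atTop (𝓝 0) := by
      have h1 := ENNReal.Tendsto.const_mul hgG (a := K) (Or.inr hK)
      have h2 := ENNReal.Tendsto.const_mul h1 (a := ENNReal.ofReal B) (Or.inr ENNReal.ofReal_ne_top)
      simpa using h2
    have := tendsto_integral_of_L1 (μ := ν) (fun _ : α => (0 : ℝ)) aestronglyMeasurable_const
      (Eventually.of_forall fun n => integrable_inner_pFlux hp he (m2 n))
      (tendsto_of_tendsto_of_tendsto_of_le_of_le tendsto_const_nhds h0 (fun _ => zero_le) hn)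
    simpa using this
  have := L1.add L2
  rw [add_zero] at this
  refine this.congr fun n => ?_
  rw [← integral_add (integrable_inner_pFlux hp he (m1 n)) (integrable_inner_pFlux hp he (m2 n))]
  refine integral_congr_ae (ae_of_all _ fun x => ?_)
  simp only
  rw [← inner_add_right]
  congr 1; module

/-- The exponents are conjugate, $\frac pn+\frac{p-1}{p^*}+\frac1{p^*}=1$ with $p^*=np/(n-p)$.
Bounding each factor by the corresponding power of the whole right side gives the product with
constant $1$. -/
theorem mul_rpow_mul_le {n a b c : ℝ} (hp : 1 < p) (hpn : p < n) (ha : 0 ≤ a) (hb : 0 ≤ b)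
    (hc : 0 ≤ c) : a * b ^ (p - 1) * c
      ≤ a ^ (n / p) + b ^ (n * p / (n - p)) + c ^ (n * p / (n - p)) := by
  set s := n * p / (n - p) with hs
  have p0 : 0 < p := by linarith
  have n0 : 0 < n := by linarith
  have np0 : 0 < n - p := by linarith
  have s0 : 0 < s := by positivity
  set M := a ^ (n / p) + b ^ s + c ^ s
  have ha' : 0 ≤ a ^ (n / p) := by positivity
  have hb' : 0 ≤ b ^ s := by positivity
  have hc' : 0 ≤ c ^ s := by positivity
  have inv : ∀ {t r : ℝ}, 0 ≤ t → 0 < r → t ^ r ≤ M → t ≤ M ^ (1 / r) := fun {t r} ht hr h => by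
    have := Real.rpow_le_rpow (by positivity) h (show 0 ≤ 1 / r by positivity)
    rwa [← Real.rpow_mul ht, mul_one_div_cancel hr.ne', Real.rpow_one] at this
  have h1 := inv ha (by positivity) (show a ^ (n / p) ≤ M by simp only [M]; linarith)
  have h2 := inv hb s0 (show b ^ s ≤ M by simp only [M]; linarith)
  have h3 := inv hc s0 (show c ^ s ≤ M by simp only [M]; linarith)
  have hM : 0 ≤ M := by positivity
  rcases hM.eq_or_lt with hM | hM
  · have : a ≤ 0 := by
      rw [← hM, Real.zero_rpow (by positivity)] at h1; exact h1
    have : a = 0 := le_antisymm this ha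
    rw [this]; simp only [zero_mul]; exact hM.le
  have h4 : b ^ (p - 1) ≤ (M ^ (1 / s)) ^ (p - 1) := Real.rpow_le_rpow hb h2 (by linarith)
  calc a * b ^ (p - 1) * c ≤ M ^ (1 / (n / p)) * (M ^ (1 / s)) ^ (p - 1) * M ^ (1 / s) := by gcongr
    _ = M := by
      rw [← Real.rpow_mul hM.le, ← Real.rpow_add hM, ← Real.rpow_add hM]
      have : 1 / (n / p) + 1 / s * (p - 1) + 1 / s = 1 := by
        rw [hs]; field_simp; ring
      rw [this, Real.rpow_one]

theorem integrable_mul_rpow_mul {n : ℝ} {f u w : α → ℝ} (hp : 1 < p) (hpn : p < n)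
    (hf : AEStronglyMeasurable f ν) (hu : AEStronglyMeasurable u ν) (hw : AEStronglyMeasurable w ν)
    (hf' : Integrable (fun x => |f x| ^ (n / p)) ν)
    (hu' : Integrable (fun x => |u x| ^ (n * p / (n - p))) ν)
    (hw' : Integrable (fun x => |w x| ^ (n * p / (n - p))) ν) :
    Integrable (fun x => f x * (|u x| ^ (p - 2) * u x) * w x) ν := by
  refine ((hf'.add hu').add hw').mono' ?_ (ae_of_all _ fun x => ?_)
  · refine (hf.mul (AEStronglyMeasurable.mul ?_ hu)).mul hw
    exact (hu.norm.aemeasurable.pow_const _).aestronglyMeasurable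
  · have : ‖f x * (|u x| ^ (p - 2) * u x) * w x‖ = |f x| * |u x| ^ (p - 1) * |w x| := by
      rw [Real.norm_eq_abs, abs_mul, abs_mul, abs_mul,
        abs_of_nonneg (by positivity : 0 ≤ |u x| ^ (p - 2)),
        rpow_sub_two_mul_self hp (abs_nonneg _)]
    rw [this]
    exact mul_rpow_mul_le hp hpn (abs_nonneg _) (abs_nonneg _) (abs_nonneg _)

end Limits

/-! ### Limits of competitors and localisation of the weak inequality. -/

section Comparison

variable {N : ℕ}

theorem IsTestFunction.mono {U V : Set (EuclideanSpace ℝ (Fin N))}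
    {φ : EuclideanSpace ℝ (Fin N) → ℝ} (h : IsTestFunction U φ) (hUV : U ⊆ V) : IsTestFunction V φ :=
  ⟨h.1, h.2.1, h.2.2.trans hUV⟩

theorem HasWeakGradient.mono {U V : Set (EuclideanSpace ℝ (Fin N))}
    {y : EuclideanSpace ℝ (Fin N) → ℝ} {Y : EuclideanSpace ℝ (Fin N) → EuclideanSpace ℝ (Fin N)}
    (h : HasWeakGradient V y Y) (hUV : U ⊆ V) : HasWeakGradient U y Y := by
  refine ⟨h.1.mono_set hUV, h.2.1.mono_set hUV, fun φ hφ => ?_⟩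
  have e := h.2.2 φ (hφ.mono hUV)
  rw [setIntegral_eq_integral_of_forall_compl_eq_zero fun x hx => by
      rw [(hφ.mono hUV).gradient_eq_zero hx, smul_zero],
    setIntegral_eq_integral_of_forall_compl_eq_zero fun x hx => by
      rw [(hφ.mono hUV).eq_zero hx, zero_smul]] at e
  rw [setIntegral_eq_integral_of_forall_compl_eq_zero fun x hx => by
      rw [hφ.gradient_eq_zero hx, smul_zero],
    setIntegral_eq_integral_of_forall_compl_eq_zero fun x hx => by
      rw [hφ.eq_zero hx, zero_smul]]
  exact e

theorem HasWeakGradient.sub {U : Set (EuclideanSpace ℝ (Fin N))}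
    {y z : EuclideanSpace ℝ (Fin N) → ℝ} {Y Z : EuclideanSpace ℝ (Fin N) → EuclideanSpace ℝ (Fin N)}
    (hy : HasWeakGradient U y Y) (hz : HasWeakGradient U z Z) :
    HasWeakGradient U (fun x => y x - z x) (fun x => Y x - Z x) := by
  refine ⟨hy.1.sub hz.1, hy.2.1.sub hz.2.1, fun φ hφ => ?_⟩
  have i1 : ∀ {y : EuclideanSpace ℝ (Fin N) → ℝ}, LocallyIntegrableOn y U →
      IntegrableOn (fun x => y x • gradient φ x) U := fun {y} hy => by
    have h : IntegrableOn (fun x => y x • gradient φ x) (tsupport φ) :=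
      (hy.integrableOn_compact_subset hφ.2.2 hφ.2.1).smul_continuousOn
        hφ.continuous_gradient.continuousOn hφ.2.1
    refine Integrable.integrableOn
      ((integrableOn_iff_integrable_of_support_subset fun x hx => ?_).1 h)
    contrapose! hx
    have : gradient φ x = 0 :=
      IsTestFunction.gradient_eq_zero (U := tsupport φ) ⟨hφ.1, hφ.2.1, le_rfl⟩ hx
    simp [this]
  have i2 : ∀ {Y : EuclideanSpace ℝ (Fin N) → EuclideanSpace ℝ (Fin N)}, LocallyIntegrableOn Y U →
      IntegrableOn (fun x => φ x • Y x) U := fun hY =>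
    (hY.integrable_smul_of_tsupport_subset hφ.1.continuous hφ.2.1 hφ.2.2).integrableOn
  simp_rw [sub_smul, smul_sub]
  rw [integral_sub (i1 hy.1) (i1 hz.1), integral_sub (i2 hy.2.1) (i2 hz.2.1), hy.2.2 φ hφ,
    hz.2.2 φ hφ]
  abel

theorem integrableOn_of_norm_le_norm_rpow (hN : 0 < N) {F : Type*} [NormedAddCommGroup F] {R C t : ℝ}
    (ht : t < N) {g : EuclideanSpace ℝ (Fin N) → F}
    (hg : AEStronglyMeasurable g (volume.restrict (ball 0 R)))
    (hle : ∀ x ∈ ball (0 : EuclideanSpace ℝ (Fin N)) R \ {0}, ‖g x‖ ≤ C * ‖x‖ ^ (-t)) :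
    IntegrableOn g (ball 0 R) := by
  have : Nonempty (Fin N) := ⟨⟨0, hN⟩⟩
  refine ((integrableOn_norm_rpow_neg_ball hN ht R).const_mul C).mono' hg ?_
  filter_upwards [ae_restrict_of_ae (Measure.ae_ne volume 0), ae_restrict_mem measurableSet_ball]
    with x h1 h2 using hle x ⟨h2, h1⟩

theorem exists_bound_of_eq_zero {f : ℝ → ℝ} (hf : Continuous f) {a b : ℝ} (ha : ∀ t ≤ a, f t = 0)
    (hb : ∀ t, b ≤ t → f t = 0) : ∃ B, 0 ≤ B ∧ ∀ t, |f t| ≤ B := by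
  obtain ⟨B, hB⟩ := (isCompact_Icc (a := a) (b := b)).exists_bound_of_continuousOn hf.continuousOn
  refine ⟨max B 0, le_max_right _ _, fun t => ?_⟩
  by_cases h : t ∈ Icc a b
  · exact (hB t h).trans (le_max_left _ _)
  · have : f t = 0 := by
      rcases le_or_gt t a with h1 | h1
      · exact ha t h1
      · exact hb t (by by_contra h2; exact h ⟨h1.le, (not_le.1 h2).le⟩)
    rw [this, abs_zero]; exact le_max_right _ _

/-- Passing to the limit in competitors built from approximating test functions. -/
theorem competitor_limits {p R k κ M : ℝ} (hp : 1 < p) (hk : 0 ≤ k) (hkκ : k < κ)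
    {w z : EuclideanSpace ℝ (Fin N) → ℝ} {a G : EuclideanSpace ℝ (Fin N) → EuclideanSpace ℝ (Fin N)}
    {ψ : ℕ → EuclideanSpace ℝ (Fin N) → ℝ}
    (hw : ∀ x ∈ ball (0 : EuclideanSpace ℝ (Fin N)) R \ {0}, ContDiffAt ℝ ∞ w x)
    (ha : ∀ x ∈ ball (0 : EuclideanSpace ℝ (Fin N)) R \ {0}, HasGradientAt w (a x) x)
    (hκ : ∀ x ∈ ball (0 : EuclideanSpace ℝ (Fin N)) R \ {0}, κ ≤ w x) (hwm : Measurable w)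
    (haL : MemLp a (ENNReal.ofReal p) (volume.restrict (ball 0 R)))
    (hG : MemLp G (ENNReal.ofReal p) (volume.restrict (ball 0 R)))
    (hV : ∀ᵐ x ∂(volume.restrict (ball (0 : EuclideanSpace ℝ (Fin N)) R)),
      x ∈ ball (0 : EuclideanSpace ℝ (Fin N)) R \ {0})
    (hψ : ∀ n, IsTestFunction (ball 0 R \ {0}) (ψ n))
    (hlim : ∀ᵐ x ∂(volume.restrict (ball 0 R)), Tendsto (fun n => ψ n x) atTop (𝓝 (z x)))
    (hgrad : Tendsto (fun n => eLpNorm (fun x => gradient (ψ n) x - G x) (ENNReal.ofReal p)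
        (volume.restrict (ball 0 R))) atTop (𝓝 0))
    {τ : ℝ → ℝ} (hτ : ContDiff ℝ ∞ τ) (hτ1 : ∀ t ≤ 1, τ t = 0) (hτM : ∀ t, M ≤ t → τ t = 0) :
    (∀ e : EuclideanSpace ℝ (Fin N) → EuclideanSpace ℝ (Fin N),
      MemLp e (ENNReal.ofReal p) (volume.restrict (ball 0 R)) →
      IntegrableOn (fun x => inner ℝ (pFlux p (e x)) (deriv τ ((k + z x) / w x) • G x
        + (τ ((k + z x) / w x) - (k + z x) / w x * deriv τ ((k + z x) / w x)) • a x)) (ball 0 R) ∧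
      (∀ n, IntegrableOn (fun x => inner ℝ (pFlux p (e x)) (gradient (competitor k τ w (ψ n)) x))
        (ball 0 R)) ∧
      Tendsto (fun n => ∫ x in ball 0 R,
          inner ℝ (pFlux p (e x)) (gradient (competitor k τ w (ψ n)) x)) atTop
        (𝓝 (∫ x in ball 0 R, inner ℝ (pFlux p (e x)) (deriv τ ((k + z x) / w x) • G x
          + (τ ((k + z x) / w x) - (k + z x) / w x * deriv τ ((k + z x) / w x)) • a x)))) ∧
    (∀ h : EuclideanSpace ℝ (Fin N) → ℝ, IntegrableOn (fun x => h x * w x) (ball 0 R) →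
      IntegrableOn (fun x => h x * (w x * τ ((k + z x) / w x))) (ball 0 R) ∧
      (∀ n, IntegrableOn (fun x => h x * competitor k τ w (ψ n) x) (ball 0 R)) ∧
      Tendsto (fun n => ∫ x in ball 0 R, h x * competitor k τ w (ψ n) x) atTop
        (𝓝 (∫ x in ball 0 R, h x * (w x * τ ((k + z x) / w x))))) := by
  set ν := volume.restrict (ball (0 : EuclideanSpace ℝ (Fin N)) R)
  have opV : IsOpen (ball (0 : EuclideanSpace ℝ (Fin N)) R \ {0}) :=
    isOpen_ball.sdiff isClosed_singleton
  have spec := fun n => competitor_spec opV hk hkκ hw ha hκ hτ hτ1 (hψ n)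
  have dτ : Differentiable ℝ τ := hτ.differentiable (by simp)
  have cdτ : Continuous (deriv τ) := hτ.continuous_deriv (by simp)
  have cσ : Continuous fun t => τ t - t * deriv τ t := by have := hτ.continuous; fun_prop
  have d1 : ∀ t ≤ 1, deriv τ t = 0 := fun t ht => deriv_eq_zero_of_forall_le (dτ t) hτ1 ht
  have dM : ∀ t, M ≤ t → deriv τ t = 0 := fun t ht => deriv_eq_zero_of_forall_ge (dτ t) hτM ht
  obtain ⟨B1, -, hB1⟩ := exists_bound_of_eq_zero cdτ d1 dM
  obtain ⟨B2, -, hB2⟩ := exists_bound_of_eq_zero (a := 1) (b := M) cσ (fun t ht => by simp [d1 t ht, hτ1 t ht])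
    (fun t ht => by simp [dM t ht, hτM t ht])
  obtain ⟨B3, -, hB3⟩ := exists_bound_of_eq_zero hτ.continuous hτ1 hτM
  have mθ : ∀ n, Measurable fun x => (k + ψ n x) / w x := fun n =>
    (measurable_const.add (hψ n).1.continuous.measurable).div hwm
  have lθ : ∀ᵐ x ∂ν, Tendsto (fun n => (k + ψ n x) / w x) atTop (𝓝 ((k + z x) / w x)) := by
    filter_upwards [hlim] with x hx using (hx.const_add k).div_const _
  have mgr : ∀ n, MemLp (gradient (ψ n)) (ENNReal.ofReal p) ν := fun n =>
    ((hψ n).continuous_gradient.memLp_of_hasCompactSupport (hψ n).hasCompactSupport_gradient).restrict _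
  refine ⟨fun e he => ?_, fun h hh => ?_⟩
  · have key := tendsto_integral_inner_pFlux hp he hG haL mgr hgrad
      (c := fun n x => deriv τ ((k + ψ n x) / w x))
      (d := fun n x => τ ((k + ψ n x) / w x) - (k + ψ n x) / w x * deriv τ ((k + ψ n x) / w x))
      (c' := fun x => deriv τ ((k + z x) / w x))
      (d' := fun x => τ ((k + z x) / w x) - (k + z x) / w x * deriv τ ((k + z x) / w x))
      (B := max B1 B2)
      (fun n => (cdτ.measurable.comp (mθ n)).aestronglyMeasurable)
      (fun n => (cσ.measurable.comp (mθ n)).aestronglyMeasurable)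
      (fun n x => (hB1 _).trans (le_max_left _ _)) (fun n x => (hB2 _).trans (le_max_right _ _))
      (lθ.mono fun x hx => (cdτ.tendsto _).comp hx) (lθ.mono fun x hx => (cσ.tendsto _).comp hx)
    refine ⟨key.1, fun n => ?_, key.2.congr fun n => integral_congr_ae ?_⟩
    · have t := (spec n).1
      exact integrable_inner_pFlux hp he
        ((t.continuous_gradient.memLp_of_hasCompactSupport t.hasCompactSupport_gradient).restrict _)
    · filter_upwards [hV] with x hx
      rw [(spec n).2.2 x hx]
  · have mh : AEStronglyMeasurable (fun x => h x * w x) ν := hh.1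
    have eqn : ∀ n, (fun x => τ ((k + ψ n x) / w x) * (h x * w x))
        =ᵐ[ν] fun x => h x * competitor k τ w (ψ n) x := fun n => by
      filter_upwards [hV] with x hx
      rw [(spec n).2.1 x hx]; ring
    have mτ : ∀ n, AEStronglyMeasurable (fun x => τ ((k + ψ n x) / w x)) ν := fun n =>
      (hτ.continuous.measurable.comp (mθ n)).aestronglyMeasurable
    have lτ : ∀ᵐ x ∂ν, Tendsto (fun n => τ ((k + ψ n x) / w x)) atTop (𝓝 (τ ((k + z x) / w x))) :=
      lθ.mono fun x hx => (hτ.continuous.tendsto _).comp hx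
    have re : (fun x => h x * (w x * τ ((k + z x) / w x)))
        = fun x => τ ((k + z x) / w x) * (h x * w x) := by ext x; ring
    rw [re]
    refine ⟨Integrable.bdd_mul (c := B3) hh (aestronglyMeasurable_of_tendsto_ae atTop mτ lτ)
      (ae_of_all _ fun x => hB3 _), fun n => ?_, ?_⟩
    · exact (Integrable.bdd_mul (c := B3) hh (mτ n) (ae_of_all _ fun x => hB3 _)).congr (eqn n)
    · refine Tendsto.congr (fun n => integral_congr_ae (eqn n)) ?_
      refine tendsto_integral_of_dominated_convergence (fun x => B3 * |h x * w x|)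
        (fun n => (mτ n).mul mh) (hh.abs.const_mul B3) (fun n => ae_of_all _ fun x => ?_)
        (lτ.mono fun x hx => hx.mul_const _)
      rw [norm_mul]
      exact mul_le_mul_of_nonneg_right (hB3 _) (abs_nonneg _)

/-- The weak inequality, tested with a test function supported in a smaller set. -/
theorem weakSubsolution_integral_le {Ω U : Set (EuclideanSpace ℝ (Fin N))} {p μ : ℝ} (hUΩ : U ⊆ Ω)
    {f u : EuclideanSpace ℝ (Fin N) → ℝ} {G : EuclideanSpace ℝ (Fin N) → EuclideanSpace ℝ (Fin N)}
    (h : ∀ φ : EuclideanSpace ℝ (Fin N) → ℝ, IsTestFunction Ω φ → (∀ x, 0 ≤ φ x) →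
      ∫ x in Ω, (‖G x‖ ^ (p - 2) * inner ℝ (G x) (gradient φ x)
          - μ / ‖x‖ ^ p * (|u x| ^ (p - 2) * u x) * φ x)
        ≤ ∫ x in Ω, f x * (|u x| ^ (p - 2) * u x) * φ x)
    {φ : EuclideanSpace ℝ (Fin N) → ℝ} (hφ : IsTestFunction U φ) (hφ0 : ∀ x, 0 ≤ φ x)
    (i1 : IntegrableOn (fun x => inner ℝ (pFlux p (G x)) (gradient φ x)) U)
    (i2 : IntegrableOn (fun x => μ * ‖x‖ ^ (-p) * (|u x| ^ (p - 2) * u x) * φ x) U)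
    (i3 : IntegrableOn (fun x => f x * (|u x| ^ (p - 2) * u x) * φ x) U) :
    ∫ x in U, inner ℝ (pFlux p (G x)) (gradient φ x)
      ≤ ∫ x in U, (μ * ‖x‖ ^ (-p) * (|u x| ^ (p - 2) * u x)
        + f x * (|u x| ^ (p - 2) * u x)) * φ x := by
  have hφΩ := hφ.mono hUΩ
  have e := h φ hφΩ hφ0
  have e1 : ∀ x, ‖G x‖ ^ (p - 2) * inner ℝ (G x) (gradient φ x)
          - μ / ‖x‖ ^ p * (|u x| ^ (p - 2) * u x) * φ x
      = inner ℝ (pFlux p (G x)) (gradient φ x)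
        - μ * ‖x‖ ^ (-p) * (|u x| ^ (p - 2) * u x) * φ x := fun x => by
    rw [inner_pFlux, Real.rpow_neg (norm_nonneg _), div_eq_mul_inv]
  simp_rw [e1] at e
  have z1 : ∀ x ∉ U, inner ℝ (pFlux p (G x)) (gradient φ x)
        - μ * ‖x‖ ^ (-p) * (|u x| ^ (p - 2) * u x) * φ x = 0 := fun x hx => by
    rw [hφ.gradient_eq_zero hx, hφ.eq_zero hx]; simp
  have z2 : ∀ x ∉ U, f x * (|u x| ^ (p - 2) * u x) * φ x = 0 := fun x hx => by
    rw [hφ.eq_zero hx]; simp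
  rw [setIntegral_eq_integral_of_forall_compl_eq_zero fun x hx => z1 x fun h => hx (hUΩ h),
    setIntegral_eq_integral_of_forall_compl_eq_zero fun x hx => z2 x fun h => hx (hUΩ h),
    ← setIntegral_eq_integral_of_forall_compl_eq_zero z1,
    ← setIntegral_eq_integral_of_forall_compl_eq_zero z2, integral_sub i1 i2] at e
  simp_rw [add_mul]
  rw [integral_add i2 i3]
  linarith

end Comparison

/-! ### Comparison of the subsolution with the barrier. -/

section ComparisonPrinciple

variable {N : ℕ}

/-- Integrability properties of the barrier on a ball. -/
theorem barrier_integrability {p γ e κ R : ℝ} (hp : 1 < p) (hpN : p < N) (hγ : 0 ≤ γ)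
    (hγb : γ < ((N : ℝ) - p) / p) (he : 0 < e) (hκ : 0 < κ) (hR : 0 < R) (hR1 : R ≤ 1)
    (hq : ∀ r, 0 < r → r ≤ R → γ + r ^ e ≤ ((N : ℝ) - p) / p) :
    MemLp (barrierGradient γ e κ R : EuclideanSpace ℝ (Fin N) → _) (ENNReal.ofReal p)
      (volume.restrict (ball 0 R)) ∧
    (∀ α ≤ p, IntegrableOn (fun x : EuclideanSpace ℝ (Fin N) =>
      ‖x‖ ^ (-α) * barrier γ e κ R ‖x‖ ^ (p - 1) * barrier γ e κ R ‖x‖) (ball 0 R)) ∧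
    ∃ δ : ℝ, 0 < δ ∧
      IntegrableOn (fun x : EuclideanSpace ℝ (Fin N) =>
        |‖x‖ ^ (-δ) * barrier γ e κ R ‖x‖| ^ ((N : ℝ) * p / (N - p))) (ball 0 R) ∧
      IntegrableOn (fun x : EuclideanSpace ℝ (Fin N) =>
        |barrier γ e κ R ‖x‖| ^ ((N : ℝ) * p / (N - p))) (ball 0 R) := by
  have hN0 : (0 : ℝ) < N := by linarith
  have hN : 0 < N := by exact_mod_cast hN0
  have p0 : 0 < p := by linarith
  have np0 : 0 < (N : ℝ) - p := by linarith
  set b := ((N : ℝ) - p) / p with hb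
  have b0 : 0 < b := by positivity
  have hbp : b * p = N - p := by rw [hb]; field_simp
  set c := κ * Real.exp (1 / e) with hc
  have c0 : 0 < c := by positivity
  have mW : Measurable fun x : EuclideanSpace ℝ (Fin N) => barrier γ e κ R ‖x‖ :=
    measurable_barrier.comp measurable_norm
  have hV : ∀ x ∈ ball (0 : EuclideanSpace ℝ (Fin N)) R \ {0},
      0 < ‖x‖ ∧ ‖x‖ < R ∧ 0 < barrier γ e κ R ‖x‖ ∧ barrier γ e κ R ‖x‖ ≤ c * ‖x‖ ^ (-γ) :=
    fun x hx => by
      have h1 : 0 < ‖x‖ := norm_pos_iff.2 hx.2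
      exact ⟨h1, mem_ball_zero_iff.1 hx.1, barrier_pos hκ hR h1, barrier_le hγ he hκ h1 hR hR1⟩
  set s := (N : ℝ) * p / (N - p) with hs
  have s0 : 0 < s := by positivity
  -- The Sobolev exponent is critical for $|x|^{-b}$: any power $|x|^{-t}$ with $t<b$ lies in $L^s$
  -- near $0$. The strict inequality $\gamma<b$ leaves room for the extra weight $|x|^{-\delta}$.
  have hsb : b * s = N := by rw [hb, hs]; field_simp
  have key : ∀ δ : ℝ, γ + δ < b → IntegrableOn (fun x : EuclideanSpace ℝ (Fin N) =>
        |‖x‖ ^ (-δ) * barrier γ e κ R ‖x‖| ^ s) (ball 0 R) := fun δ hδ => by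
    refine integrableOn_of_norm_le_norm_rpow hN (C := c ^ s) (t := (γ + δ) * s) ?_ ?_ ?_
    · rw [← hsb]; exact mul_lt_mul_of_pos_right hδ s0
    · have : Measurable fun x : EuclideanSpace ℝ (Fin N) => ‖x‖ ^ (-δ) * barrier γ e κ R ‖x‖ :=
        (measurable_norm.pow_const _).mul mW
      exact (this.norm.pow_const s).aestronglyMeasurable
    · intro x hx
      obtain ⟨h1, h2, h3, h4⟩ := hV x hx
      have e1 : ‖x‖ ^ (-((γ + δ) * s)) = (‖x‖ ^ (-(γ + δ))) ^ s := by
        rw [← Real.rpow_mul h1.le]; congr 1; ring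
      rw [Real.norm_of_nonneg (by positivity), abs_of_nonneg (by positivity), e1,
        ← Real.mul_rpow c0.le (by positivity)]
      refine Real.rpow_le_rpow (by positivity) ?_ s0.le
      have e2 : ‖x‖ ^ (-(γ + δ)) = ‖x‖ ^ (-δ) * ‖x‖ ^ (-γ) := by
        rw [← Real.rpow_add h1]; congr 1; ring
      rw [e2]
      calc ‖x‖ ^ (-δ) * barrier γ e κ R ‖x‖ ≤ ‖x‖ ^ (-δ) * (c * ‖x‖ ^ (-γ)) := by gcongr
        _ = _ := by ring
  refine ⟨?_, fun α hα => ?_, (b - γ) / 2, by linarith, key _ (by linarith), ?_⟩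
  · have i : IntegrableOn (fun x : EuclideanSpace ℝ (Fin N) => ‖barrierGradient γ e κ R x‖ ^ p)
        (ball 0 R) := by
      refine integrableOn_of_norm_le_norm_rpow hN (C := (b * c) ^ p) (t := (γ + 1) * p) ?_ ?_ ?_
      · have := mul_lt_mul_of_pos_right hγb p0
        rw [add_mul, one_mul]; linarith
      · exact (measurable_barrierGradient.norm.pow_const p).aestronglyMeasurable
      · intro x hx
        obtain ⟨h1, h2, h3, h4⟩ := hV x hx
        have e1 : ‖x‖ ^ (-((γ + 1) * p)) = (‖x‖ ^ (-(γ + 1))) ^ p := by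
          rw [← Real.rpow_mul h1.le]; congr 1; ring
        rw [Real.norm_of_nonneg (by positivity), e1, ← Real.mul_rpow (by positivity) (by positivity)]
        refine Real.rpow_le_rpow (by positivity) ?_ p0.le
        have e2 : ‖x‖ ^ (-(γ + 1)) = ‖x‖ ^ (-γ) / ‖x‖ := by
          rw [← Real.rpow_sub_one h1.ne']; congr 1; ring
        rw [norm_barrierGradient hγ hκ hR hx.2, e2, mul_div_assoc, mul_assoc, ← mul_div_assoc c]
        have := hq ‖x‖ h1 h2.le
        gcongr
    refine (integrable_norm_rpow_iff measurable_barrierGradient.aestronglyMeasurable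
      (by simpa using p0) ENNReal.ofReal_ne_top).1 ?_
    rwa [ENNReal.toReal_ofReal p0.le]
  · refine integrableOn_of_norm_le_norm_rpow hN (C := c ^ p) (t := γ * p + p) ?_ ?_ ?_
    · have := mul_lt_mul_of_pos_right hγb p0
      linarith
    · exact (((measurable_norm.pow_const _).mul (mW.pow_const _)).mul mW).aestronglyMeasurable
    · intro x hx
      obtain ⟨h1, h2, h3, h4⟩ := hV x hx
      rw [Real.norm_of_nonneg (by positivity), mul_assoc, rpow_sub_one_mul_self hp h3.le]
      have e1 : ‖x‖ ^ (-(γ * p + p)) = (‖x‖ ^ (-γ)) ^ p * ‖x‖ ^ (-p) := by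
        rw [← Real.rpow_mul h1.le, ← Real.rpow_add h1]; congr 1; ring
      rw [e1, ← mul_assoc, ← Real.mul_rpow c0.le (by positivity), mul_comm]
      have h5 : ‖x‖ ^ (-α) ≤ ‖x‖ ^ (-p) :=
        Real.rpow_le_rpow_of_exponent_ge h1 (by linarith) (by linarith)
      gcongr
  · have := key 0 (by linarith)
    simpa using this

set_option maxHeartbeats 1000000 in
-- `hq` is required with $A+1$ although $f$ is controlled by $A$: the spare $|x|^{-\alpha}$ leaves a
-- positive weight on $\{\theta>1\}$, so Picone's inequality forces $\theta\le1$. The gap $k<\kappa$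
-- makes the competitors vanish wherever the approximants of $z$ do.
theorem le_barrier_of_weakSubsolution {p μ A α e R₀ R k κ : ℝ} (hp : 1 < p) (hpN : p < N)
    (hμ0 : 0 ≤ μ) (hμ : μ < (((N : ℝ) - p) / p) ^ p) (hα : α < p) (he : 0 < e)
    (hR₀ : R₀ ≤ 1) (hq : ∀ r, 0 < r → r ≤ R₀ →
      gammaOne N p μ + r ^ e ≤ ((N : ℝ) - p) / p ∧
      μ + (A + 1) * r ^ (p - α) ≤ ((N : ℝ) - p) * (gammaOne N p μ + r ^ e) ^ (p - 1)
        - (p - 1) * (gammaOne N p μ + r ^ e) ^ p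
        + (p - 1) * e * r ^ e * (gammaOne N p μ + r ^ e) ^ (p - 2))
    {Ω : Set (EuclideanSpace ℝ (Fin N))} {f u : EuclideanSpace ℝ (Fin N) → ℝ}
    (hf : MemLp f (ENNReal.ofReal (N / p)) (volume.restrict Ω))
    (hfA : ∀ᵐ x ∂(volume.restrict Ω), f x ≤ A * ‖x‖ ^ (-α)) (hu : IsWeakSubsolution Ω p μ f u)
    (hR : 0 < R) (hRR : R ≤ R₀) (hΩ : ball (0 : EuclideanSpace ℝ (Fin N)) R ⊆ Ω)
    (hk : 0 ≤ k) (hkκ : k < κ) (hz : MemW1p0 (ball 0 R) p (fun x => max (max (u x) 0 - k) 0)) :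
    ∀ᵐ x ∂(volume.restrict (ball (0 : EuclideanSpace ℝ (Fin N)) R)),
      u x ≤ barrier (gammaOne N p μ) e κ R ‖x‖ := by
  have hN0 : (0 : ℝ) < N := by linarith
  have hN : 0 < N := by exact_mod_cast hN0
  have : Nonempty (Fin N) := ⟨⟨0, hN⟩⟩
  have p0 : 0 < p := by linarith
  have np0 : 0 < (N : ℝ) - p := by linarith
  have hκ : 0 < κ := hk.trans_lt hkκ
  have hR1 : R ≤ 1 := hRR.trans hR₀
  have hγb := gammaOne_lt hp hpN hμ0 hμ
  have hγ0 : 0 ≤ gammaOne N p μ := (isLeast_gammaOne hp hpN hμ0 hμ).1.1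
  set γ := gammaOne N p μ
  set b := ((N : ℝ) - p) / p with hb
  have b0 : 0 < b := by positivity
  set ν := volume.restrict (ball (0 : EuclideanSpace ℝ (Fin N)) R) with hν
  have hνΩ : ν ≤ volume.restrict Ω := Measure.restrict_mono hΩ le_rfl
  have haeV : ∀ᵐ x ∂ν, x ∈ ball (0 : EuclideanSpace ℝ (Fin N)) R \ {0} := by
    filter_upwards [ae_restrict_of_ae (Measure.ae_ne volume (0 : EuclideanSpace ℝ (Fin N))),
      ae_restrict_mem measurableSet_ball] with x h1 h2 using ⟨h2, h1⟩
  -- the barrier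
  set w : EuclideanSpace ℝ (Fin N) → ℝ := fun x => barrier γ e κ R ‖x‖ with hw
  set a : EuclideanSpace ℝ (Fin N) → EuclideanSpace ℝ (Fin N) := barrierGradient γ e κ R with ha
  have hnorm : ∀ x ∈ ball (0 : EuclideanSpace ℝ (Fin N)) R \ {0}, 0 < ‖x‖ ∧ ‖x‖ < R := fun x hx =>
    ⟨norm_pos_iff.2 hx.2, mem_ball_zero_iff.1 hx.1⟩
  have w1 : ∀ x ∈ ball (0 : EuclideanSpace ℝ (Fin N)) R \ {0}, ContDiffAt ℝ ∞ w x := fun x hx =>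
    contDiffAt_barrier_norm hx.2 ⊤
  have w2 : ∀ x ∈ ball (0 : EuclideanSpace ℝ (Fin N)) R \ {0}, HasGradientAt w (a x) x := fun x hx =>
    hasGradientAt_barrier_norm he hx.2
  have w3 : ∀ x ∈ ball (0 : EuclideanSpace ℝ (Fin N)) R \ {0}, κ ≤ w x := fun x hx =>
    le_barrier hγ0 he hκ (hnorm x hx).1 (hnorm x hx).2.le
  have mw : Measurable w := measurable_barrier.comp measurable_norm
  obtain ⟨haL, hwα, δ, hδ, hwδ, hws⟩ := barrier_integrability hp hpN hγ0 hγb he hκ hR hR1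
    (fun r h1 h2 => (hq r h1 (h2.trans hRR)).1)
  -- the subsolution
  obtain ⟨G, ⟨huL, huG, hGL⟩, hsub⟩ := hu
  have hGν : MemLp G (ENNReal.ofReal p) ν := hGL.mono_measure hνΩ
  have huν : AEStronglyMeasurable u ν := huL.1.mono_measure hνΩ
  have hfν : AEStronglyMeasurable f ν := hf.1.mono_measure hνΩ
  have ius : Integrable (fun x => |u x| ^ ((N : ℝ) * p / (N - p))) ν :=
    (huL.mono_measure hνΩ).integrable_norm_rpow_ofReal (by positivity)
  have ifs : Integrable (fun x => |f x| ^ ((N : ℝ) / p)) ν :=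
    (hf.mono_measure hνΩ).integrable_norm_rpow_ofReal (by positivity)
  set z : EuclideanSpace ℝ (Fin N) → ℝ := fun x => max (max (u x) 0 - k) 0 with hzdef
  have z0 : ∀ x, 0 ≤ z x := fun x => le_max_right _ _
  have uz : ∀ x, u x ≤ k + z x := fun x => by
    have h1 := le_max_left (max (u x) 0 - k) 0
    have h2 := le_max_left (u x) 0
    simp only [hzdef]; linarith
  have uz' : ∀ x, 0 < z x → u x = k + z x := fun x hx => by
    have h1 : 0 < max (u x) 0 - k := by
      by_contra h; simp only [hzdef, max_eq_right (not_lt.1 h)] at hx; exact lt_irrefl _ hx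
    have h2 : 0 < u x := by
      by_contra h; rw [max_eq_right (not_lt.1 h)] at h1; linarith
    simp only [hzdef, max_eq_left h1.le, max_eq_left h2.le]; ring
  obtain ⟨G', ψ, hzL, hGL', hzG, hψ, hlim, hgrad⟩ := hz.exists_seq_punctured hp hpN hR1
  -- On $\{z>0\}$ the difference $u-z$ is the constant $k$, and weak gradients vanish on level sets.
  have hGG : ∀ᵐ x ∂ν, 0 < z x → G x = G' x := by
    have h := ((huG.mono hΩ).sub hzG).ae_eq_zero_of_eq isOpen_ball k
    filter_upwards [ae_restrict_of_ae h, ae_restrict_mem measurableSet_ball] with x h1 h2 h3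
    exact sub_eq_zero.1 (h1 h2 (by rw [uz' x h3]; ring))
  have hHardy := integrable_hardy_of_tendsto hp hpN hzL.1 hGL' hψ hlim hgrad
  -- the ratio and the lower order terms
  set θ : EuclideanSpace ℝ (Fin N) → ℝ := fun x => (k + z x) / w x with hθ
  have mθ : AEStronglyMeasurable θ ν :=
    ((hzL.1.aemeasurable.const_add k).div mw.aemeasurable).aestronglyMeasurable
  have θw : ∀ x ∈ ball (0 : EuclideanSpace ℝ (Fin N)) R \ {0}, θ x * w x = k + z x := fun x hx =>
    div_mul_cancel₀ _ (hκ.trans_le (w3 x hx)).ne'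
  -- The weight $|x|^{-p}$ just fails to be in $L^{N/p}$. Moving $|x|^{-\delta}$ onto the barrier,
  -- which stays in $L^{p^*}$, makes the three-factor estimate applicable.
  have iμ : IntegrableOn (fun x => μ * ‖x‖ ^ (-p) * (|u x| ^ (p - 2) * u x) * w x) (ball 0 R) := by
    have h0 : Integrable (fun x : EuclideanSpace ℝ (Fin N) => |‖x‖ ^ (-(p - δ))| ^ ((N : ℝ) / p)) ν := by
      refine integrableOn_of_norm_le_norm_rpow hN (C := 1) (t := (p - δ) * (N / p)) ?_ ?_ ?_
      · have : (p - δ) * ((N : ℝ) / p) < p * ((N : ℝ) / p) :=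
          mul_lt_mul_of_pos_right (by linarith) (by positivity)
        rwa [mul_div_cancel₀ _ p0.ne'] at this
      · have : Measurable fun x : EuclideanSpace ℝ (Fin N) => ‖x‖ ^ (-(p - δ)) :=
          measurable_norm.pow_const _
        exact (this.norm.pow_const _).aestronglyMeasurable
      · intro x _
        rw [Real.norm_of_nonneg (by positivity), abs_of_nonneg (by positivity),
          ← Real.rpow_mul (norm_nonneg _), one_mul, neg_mul]
    have m0 : Measurable fun x : EuclideanSpace ℝ (Fin N) => ‖x‖ ^ (-(p - δ)) :=
      measurable_norm.pow_const _
    have m1 : Measurable fun x : EuclideanSpace ℝ (Fin N) => ‖x‖ ^ (-δ) * w x :=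
      (measurable_norm.pow_const _).mul mw
    have h := integrable_mul_rpow_mul (n := (N : ℝ)) hp hpN m0.aestronglyMeasurable huν
      m1.aestronglyMeasurable h0 ius hwδ
    refine (h.const_mul μ).congr ?_
    filter_upwards [haeV] with x hx
    have : ‖x‖ ^ (-p) = ‖x‖ ^ (-(p - δ)) * ‖x‖ ^ (-δ) := by
      rw [← Real.rpow_add (hnorm x hx).1]; congr 1; ring
    rw [this]; ring
  have iff' : IntegrableOn (fun x => f x * (|u x| ^ (p - 2) * u x) * w x) (ball 0 R) :=
    integrable_mul_rpow_mul (n := (N : ℝ)) hp hpN hfν huν mw.aestronglyMeasurable ifs ius hws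
  set h1 : EuclideanSpace ℝ (Fin N) → ℝ := fun x =>
    μ * ‖x‖ ^ (-p) * (|u x| ^ (p - 2) * u x) + f x * (|u x| ^ (p - 2) * u x) with hh1
  set h2 : EuclideanSpace ℝ (Fin N) → ℝ := fun x =>
    (μ * ‖x‖ ^ (-p) + (A + 1) * ‖x‖ ^ (-α)) * w x ^ (p - 1) with hh2
  have ih1 : IntegrableOn (fun x => h1 x * w x) (ball 0 R) := by
    simp only [hh1, add_mul]; exact iμ.add iff'
  have ih2 : IntegrableOn (fun x => h2 x * w x) (ball 0 R) := by
    refine (((hwα p le_rfl).const_mul μ).add ((hwα α hα.le).const_mul (A + 1))).congr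
      (ae_of_all _ fun x => ?_)
    simp only [hh2, hw, Pi.add_apply]; ring
  -- the error term
  set D : EuclideanSpace ℝ (Fin N) → ℝ := fun x => ‖G x‖ ^ p + ‖θ x • a x‖ ^ p with hD
  have D0 : ∀ x, 0 ≤ D x := fun x => by simp only [hD]; positivity
  have iD : Integrable D ν := by
    refine (hGν.integrable_norm_rpow_ofReal p0).add ?_
    have hi : Integrable (fun x : EuclideanSpace ℝ (Fin N) =>
        (2 * b) ^ p * (k ^ p * ‖x‖ ^ (-p) + ‖x‖ ^ (-p) * |z x| ^ p)) ν :=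
      (((integrableOn_norm_rpow_neg_ball hN hpN R).const_mul (k ^ p)).add hHardy).const_mul _
    refine hi.mono' ?_ ?_
    · exact ((mθ.smul haL.1).norm.aemeasurable.pow_const p).aestronglyMeasurable
    · filter_upwards [haeV] with x hx
      obtain ⟨n1, n2⟩ := hnorm x hx
      have wx : 0 < w x := hκ.trans_le (w3 x hx)
      have kz : 0 ≤ k + z x := add_nonneg hk (z0 x)
      -- Here $|\nabla w|=q\,w/|x|$ with $q\le b$, so $\theta\nabla w$ is controlled by $(k+z)/|x|$:
      -- Hardy's inequality covers $z$, and $p<N$ covers the constant $k$.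
      have n3 : ‖θ x • a x‖ ≤ b * (k + z x) / ‖x‖ := by
        rw [norm_smul, ha, norm_barrierGradient hγ0 hκ hR hx.2, Real.norm_of_nonneg (div_nonneg kz wx.le)]
        have e1 : θ x * ((γ + ‖x‖ ^ e) * barrier γ e κ R ‖x‖ / ‖x‖)
            = (γ + ‖x‖ ^ e) * (θ x * w x) / ‖x‖ := by simp only [hw]; ring
        rw [e1, θw x hx]
        have := (hq ‖x‖ n1 (by linarith)).1
        gcongr
      have n4 : (k + z x) ^ p ≤ 2 ^ p * (k ^ p + z x ^ p) := by
        have q1 : 0 ≤ k ^ p := by positivity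
        have q2 : 0 ≤ z x ^ p := Real.rpow_nonneg (z0 x) p
        rcases le_total k (z x) with h | h
        · calc (k + z x) ^ p ≤ (2 * z x) ^ p := Real.rpow_le_rpow kz (by linarith) p0.le
            _ = 2 ^ p * z x ^ p := Real.mul_rpow (by norm_num) (z0 x)
            _ ≤ _ := by gcongr; linarith
        · calc (k + z x) ^ p ≤ (2 * k) ^ p := Real.rpow_le_rpow kz (by linarith) p0.le
            _ = 2 ^ p * k ^ p := Real.mul_rpow (by norm_num) hk
            _ ≤ _ := by gcongr; linarith
      rw [Real.norm_of_nonneg (by positivity)]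
      calc ‖θ x • a x‖ ^ p ≤ (b * (k + z x) / ‖x‖) ^ p :=
            Real.rpow_le_rpow (norm_nonneg _) n3 p0.le
        _ = b ^ p * (k + z x) ^ p * ‖x‖ ^ (-p) := by
            rw [Real.div_rpow (by positivity) n1.le, Real.mul_rpow b0.le kz, Real.rpow_neg n1.le]; ring
        _ ≤ b ^ p * (2 ^ p * (k ^ p + z x ^ p)) * ‖x‖ ^ (-p) := by gcongr
        _ = _ := by rw [Real.mul_rpow (by norm_num) b0.le, abs_of_nonneg (z0 x)]; ring
  obtain ⟨S, S0, hS⟩ := exists_mul_deriv_profile_ge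
  -- the main inequality for a fixed truncation level
  set T : ℝ → EuclideanSpace ℝ (Fin N) → ℝ := fun m x =>
    ‖x‖ ^ (-α) * w x ^ (p - 1) * (w x * (θ x ^ p * profile m (θ x))) with hT
  set err : ℝ → EuclideanSpace ℝ (Fin N) → ℝ := fun m x =>
    (if m ≤ θ x then (1 : ℝ) else 0) * (S * (3 * D x)) with herr
  have ierr : ∀ m, Integrable (err m) ν := fun m => by
    have hm : Measurable fun t : ℝ => if m ≤ t then (1 : ℝ) else 0 :=
      Measurable.ite measurableSet_Ici measurable_const measurable_const
    refine Integrable.bdd_mul (c := 1) ((iD.const_mul 3).const_mul S)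
      (hm.comp_aemeasurable mθ.aemeasurable).aestronglyMeasurable (ae_of_all _ fun x => ?_)
    split_ifs <;> simp
  have main : ∀ m, 2 ≤ m → Integrable (T m) ν ∧ ∫ x, T m x ∂ν ≤ ∫ x, err m x ∂ν := by
    intro m hm
    have m0 : 0 < m := by linarith
    have s1 : ContDiff ℝ ∞ (fun t => t * profile m t) := contDiff_id.mul (contDiff_profile m ⊤)
    have s2 : ContDiff ℝ ∞ (fun t => t ^ p * profile m t) := contDiff_rpow_mul_profile p m ⊤
    have v1 : ∀ t ≤ 1, t * profile m t = 0 := fun t ht => by rw [profile_of_le_one ht, mul_zero]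
    have v2 : ∀ t ≤ 1, t ^ p * profile m t = 0 := fun t ht => by rw [profile_of_le_one ht, mul_zero]
    have v3 : ∀ t, 2 * m ≤ t → t * profile m t = 0 := fun t ht => by
      rw [profile_of_two_mul_le m0 ht, mul_zero]
    have v4 : ∀ t, 2 * m ≤ t → t ^ p * profile m t = 0 := fun t ht => by
      rw [profile_of_two_mul_le m0 ht, mul_zero]
    -- With $g$ the profile, $\tau=\theta g$ gives the competitor for the inequality of $u$, and
    -- $\tau=\theta^pg$ the one for the barrier.
    have C1 := competitor_limits hp hk hkκ w1 w2 w3 mw haL hGL' haeV hψ hlim hgrad s1 v1 v3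
    have C2 := competitor_limits hp hk hkκ w1 w2 w3 mw haL hGL' haeV hψ hlim hgrad s2 v2 v4
    have opV : IsOpen (ball (0 : EuclideanSpace ℝ (Fin N)) R \ {0}) :=
      isOpen_ball.sdiff isClosed_singleton
    have P1 := fun n => competitor_spec opV hk hkκ w1 w2 w3 s1 v1 (hψ n)
    have P2 := fun n => competitor_spec opV hk hkκ w1 w2 w3 s2 v2 (hψ n)
    have nn : ∀ {τ : ℝ → ℝ}, (∀ t, 0 ≤ τ t) → (∀ t ≤ 1, τ t = 0) → ContDiff ℝ ∞ τ →
        ∀ n x, 0 ≤ competitor k τ w (ψ n) x := fun {τ} hτ hτ1 hs n x => by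
      have sp := competitor_spec opV hk hkκ w1 w2 w3 hs hτ1 (hψ n)
      by_cases hx : x ∈ ball (0 : EuclideanSpace ℝ (Fin N)) R \ {0}
      · rw [sp.2.1 x hx]; exact mul_nonneg (hκ.le.trans (w3 x hx)) (hτ _)
      · rw [sp.1.eq_zero hx]
    have n1 := nn (fun t => by
      rcases le_or_gt t 0 with h | h
      · rw [v1 t (by linarith)]
      · exact mul_nonneg h.le (profile_nonneg _ _)) v1 s1
    have n2 := nn (fun t => by
      rcases le_or_gt t 0 with h | h
      · rw [v2 t (by linarith)]
      · exact mul_nonneg (Real.rpow_nonneg h.le p) (profile_nonneg _ _)) v2 s2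
    obtain ⟨F1i, F1n, F1t⟩ := C1.1 G hGν
    obtain ⟨F2i, F2n, F2t⟩ := C2.1 a haL
    obtain ⟨H1i, H1n, H1t⟩ := C1.2 h1 ih1
    obtain ⟨H2i, H2n, H2t⟩ := C2.2 h2 ih2
    have ineq1 := le_of_tendsto_of_tendsto' F1t H1t fun n =>
      weakSubsolution_integral_le hΩ hsub ((P1 n).1.mono sdiff_subset) (n1 n) (F1n n)
        ((C1.2 _ iμ).2.1 n) ((C1.2 _ iff').2.1 n)
    have ineq2 := le_of_tendsto_of_tendsto' H2t F2t fun n => by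
      have t := (P2 n).1
      have hoff : ∀ x ∉ ball (0 : EuclideanSpace ℝ (Fin N)) R,
          h2 x * competitor k (fun t => t ^ p * profile m t) w (ψ n) x = 0 := fun x hx => by
        rw [t.eq_zero fun h => hx h.1, mul_zero]
      have hi := (integrableOn_iff_integrable_of_support_subset fun x hx => by
        by_contra hx'; exact hx (hoff x hx')).1 (H2n n)
      have := barrier_supersolution (γ := γ) hp hγ0 he hκ hR hRR (fun r h1 h2 => (hq r h1 h2).2)
        (t.1.of_le (by simp)) t.2.1 t.2.2 (n2 n) hi
      rw [setIntegral_eq_integral_of_forall_compl_eq_zero hoff,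
        setIntegral_eq_integral_of_forall_compl_eq_zero fun x hx => by
          rw [t.gradient_eq_zero fun h => hx h.1, inner_zero_right]]
      exact this
    have iT : Integrable (T m) ν := (C2.2 _ (hwα α hα.le)).1
    refine ⟨iT, ?_⟩
    -- Where $\theta\le1$, every term except the nonnegative error vanishes. Where $\theta>1$,
    -- $k+z>w\ge\kappa>k$ gives $z>0$ and hence $u=\theta w$ and $\nabla u=\nabla z$, so Picone's
    -- bound applies to the actual gradient of $u$.
    have pt : ∀ᵐ x ∂ν, T m x + h1 x * (w x * (θ x * profile m (θ x)))
          + inner ℝ (pFlux p (a x)) (deriv (fun t => t ^ p * profile m t) (θ x) • G' x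
            + (θ x ^ p * profile m (θ x) - θ x * deriv (fun t => t ^ p * profile m t) (θ x)) • a x)
        ≤ err m x + h2 x * (w x * (θ x ^ p * profile m (θ x)))
          + inner ℝ (pFlux p (G x)) (deriv (fun t => t * profile m t) (θ x) • G' x
            + (θ x * profile m (θ x) - θ x * deriv (fun t => t * profile m t) (θ x)) • a x) := by
      filter_upwards [haeV, hGG, hνΩ.absolutelyContinuous.ae_le hfA] with x hx hG hfx
      have hwx : 0 < w x := hκ.trans_le (w3 x hx)
      rcases le_or_gt (θ x) 1 with hθ1 | hθ1
      · have e1 : deriv (fun t => t ^ p * profile m t) (θ x) = 0 :=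
          deriv_eq_zero_of_forall_le (s2.differentiable (by simp) _) v2 hθ1
        have e2 : deriv (fun t => t * profile m t) (θ x) = 0 :=
          deriv_eq_zero_of_forall_le (s1.differentiable (by simp) _) v1 hθ1
        have hE : 0 ≤ err m x := by
          simp only [herr]
          have := D0 x
          split_ifs <;> positivity
        simp only [hT, e1, e2, profile_of_le_one hθ1]
        simpa using hE
      · have θ0 : 0 < θ x := by linarith
        have hzx : 0 < z x := by
          have : w x < k + z x := by rw [← θw x hx]; exact lt_mul_of_one_lt_left hwx hθ1
          have := w3 x hx
          linarith
        have hux : u x = θ x * w x := by rw [θw x hx]; exact uz' x hzx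
        rw [← hG hzx, deriv_mul_profile, deriv_rpow_mul_profile p m θ0]
        have hP := picone_lower_bound_smul hp (G x) (a x) θ0 (profile_nonneg m (θ x))
          (κ := if m ≤ θ x then S else 0) (by split_ifs <;> simp [S0]) (hS m m0 (θ x) θ0.le)
        have hE : (if m ≤ θ x then S else 0) * (3 * (‖G x‖ ^ p + ‖θ x • a x‖ ^ p)) = err m x := by
          simp only [herr, hD]; split_ifs <;> simp
        rw [hE] at hP
        have hu0 : 0 < u x := by rw [hux]; positivity
        have e1 : |u x| ^ (p - 2) * u x = θ x ^ (p - 1) * w x ^ (p - 1) := by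
          rw [abs_of_pos hu0, rpow_sub_two_mul_self hp hu0.le, hux, Real.mul_rpow θ0.le hwx.le]
        have e2 : θ x ^ p = θ x ^ (p - 1) * θ x := (rpow_sub_one_mul_self hp θ0.le).symm
        have q0 : 0 ≤ θ x ^ (p - 1) * w x ^ (p - 1) * (w x * (θ x * profile m (θ x))) := by
          have := profile_nonneg m (θ x); positivity
        -- By homogeneity the $\mu$ terms cancel. The $f$ term is covered by $A|x|^{-\alpha}$, and
        -- the additional $1$ in $A+1$ supplies exactly $T$.
        have low : T m x + h1 x * (w x * (θ x * profile m (θ x)))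
            ≤ h2 x * (w x * (θ x ^ p * profile m (θ x))) := by
          have e3 : h2 x * (w x * (θ x ^ p * profile m (θ x)))
              - (T m x + h1 x * (w x * (θ x * profile m (θ x))))
              = (A * ‖x‖ ^ (-α) - f x)
                * (θ x ^ (p - 1) * w x ^ (p - 1) * (w x * (θ x * profile m (θ x)))) := by
            simp only [hT, hh1, hh2, e1, e2]; ring
          exact sub_nonneg.1 (e3 ▸ mul_nonneg (sub_nonneg.2 hfx) q0)
        linarith
    have I := integral_mono_ae ((iT.add H1i).add F2i) ((ierr m |>.add H2i).add F1i) pt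
    have I1 := integral_add (iT.add H1i) F2i
    have I2 := integral_add iT H1i
    have I3 := integral_add ((ierr m).add H2i) F1i
    have I4 := integral_add (ierr m) H2i
    simp only [Pi.add_apply] at I I1 I2 I3 I4
    rw [I1, I2, I3, I4] at I
    linarith
  -- letting the truncation level tend to infinity
  have lerr : Tendsto (fun n : ℕ => ∫ x, err (n + 2) x ∂ν) atTop (𝓝 0) := by
    have := tendsto_integral_of_dominated_convergence (μ := ν) (F := fun (n : ℕ) x => err (n + 2) x)
      (f := fun _ => (0 : ℝ)) (fun x => S * (3 * D x)) (fun n => (ierr _).1)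
      ((iD.const_mul 3).const_mul S) (fun n => ae_of_all _ fun x => ?_) (ae_of_all _ fun x => ?_)
    · simpa using this
    · have := D0 x
      simp only [herr]
      rw [Real.norm_of_nonneg (by split_ifs <;> positivity)]
      exact mul_le_of_le_one_left (by positivity) (by split_ifs <;> norm_num)
    · refine tendsto_const_nhds.congr' ?_
      filter_upwards [(tendsto_natCast_atTop_atTop (R := ℝ)).eventually_gt_atTop (θ x)] with n hn
      have : ¬ ((n : ℝ) + 2 ≤ θ x) := by linarith
      simp [herr, this]
  set T' : EuclideanSpace ℝ (Fin N) → ℝ := fun x =>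
    ‖x‖ ^ (-α) * w x ^ (p - 1) * (w x * (θ x ^ p * Real.smoothTransition (θ x - 1))) with hT'
  have T0 : ∀ m, ∀ᵐ x ∂ν, 0 ≤ T m x := fun m => by
    filter_upwards [haeV] with x hx
    have hwx : 0 < w x := hκ.trans_le (w3 x hx)
    have : 0 ≤ θ x := div_nonneg (add_nonneg hk (z0 x)) hwx.le
    have := profile_nonneg m (θ x)
    simp only [hT]; positivity
  -- For fixed $x$ the upper cutoff disappears once $m\ge\theta(x)$, so $T_m\to T'$ pointwise and
  -- Fatou's lemma applies.
  have fat : ∫⁻ x, ENNReal.ofReal (T' x) ∂ν = 0 := by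
    have h := lintegral_liminf_le' (μ := ν) (u := atTop)
      (f := fun (n : ℕ) x => ENNReal.ofReal (T (n + 2) x))
      fun n => (main (n + 2) (by linarith [Nat.cast_nonneg (α := ℝ) n])).1.1.aemeasurable.ennreal_ofReal
    have e1 : ∀ x, liminf (fun n : ℕ => ENNReal.ofReal (T (n + 2) x)) atTop = ENNReal.ofReal (T' x) :=
      fun x => by
        refine Tendsto.liminf_eq (tendsto_const_nhds.congr' ?_)
        filter_upwards [(tendsto_natCast_atTop_atTop (R := ℝ)).eventually_gt_atTop (θ x)] with n hn
        simp only [hT, hT']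
        rw [profile_of_le (by positivity) (by linarith)]
    simp_rw [e1] at h
    have e2 : Tendsto (fun n : ℕ => ENNReal.ofReal (∫ x, err (n + 2) x ∂ν)) atTop (𝓝 0) := by
      simpa using ENNReal.tendsto_ofReal lerr
    refine le_antisymm (h.trans ?_) zero_le
    rw [← e2.liminf_eq]
    refine liminf_le_liminf (Eventually.of_forall fun n => ?_)
    obtain ⟨j1, j2⟩ := main (n + 2) (by linarith [Nat.cast_nonneg (α := ℝ) n])
    rw [← ofReal_integral_eq_lintegral_ofReal j1 (T0 _)]
    exact ENNReal.ofReal_le_ofReal j2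
  have mT' : AEMeasurable (fun x => ENNReal.ofReal (T' x)) ν := by
    have m1 : AEMeasurable (fun x => Real.smoothTransition (θ x - 1)) ν :=
      Real.smoothTransition.continuous.measurable.comp_aemeasurable (mθ.aemeasurable.sub_const 1)
    have m2 : Measurable fun x : EuclideanSpace ℝ (Fin N) => ‖x‖ ^ (-α) := measurable_norm.pow_const _
    exact ((m2.mul (mw.pow_const _)).aemeasurable.mul
      (mw.aemeasurable.mul ((mθ.aemeasurable.pow_const p).mul m1))).ennreal_ofReal
  filter_upwards [(lintegral_eq_zero_iff' mT').1 fat, haeV] with x hTx hx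
  have hwx : 0 < w x := hκ.trans_le (w3 x hx)
  by_contra hlt
  have hθ1 : 1 < θ x := by
    rw [hθ]; simp only
    rw [one_lt_div hwx]
    exact (not_le.1 hlt).trans_le (uz x)
  have : 0 < T' x := by
    have h1 := (hnorm x hx).1
    have h2 := Real.smoothTransition.pos_of_pos (show 0 < θ x - 1 by linarith)
    simp only [hT']; positivity
  exact (ENNReal.ofReal_pos.2 this).ne' hTx

end ComparisonPrinciple

/-! ### Conclusion: letting the boundary level tend to $M_R$. -/

theorem theorem1p3 (N : ℕ) (p μ A α : ℝ) (hp : 1 < p) (hpN : p < N)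
    (hμ0 : 0 ≤ μ) (hμ : μ < (((N : ℝ) - p) / p) ^ p) (hA : 0 < A) (hα : α < p) :
    ∃ C R₀ : ℝ, 0 < C ∧ 0 < R₀ ∧
      ∀ (Ω : Set (EuclideanSpace ℝ (Fin N))), IsOpen Ω → IsConnected Ω →
        Bornology.IsBounded Ω → (0 : EuclideanSpace ℝ (Fin N)) ∈ Ω →
      ∀ f : EuclideanSpace ℝ (Fin N) → ℝ,
        MemLp f (ENNReal.ofReal (N / p)) (volume.restrict Ω) →
        (∀ᵐ x ∂(volume.restrict Ω), f x ≤ A * ‖x‖ ^ (-α)) →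
      ∀ u : EuclideanSpace ℝ (Fin N) → ℝ, IsWeakSubsolution Ω p μ f u →
      ∀ R : ℝ, 0 < R → R ≤ R₀ → ball (0 : EuclideanSpace ℝ (Fin N)) R ⊆ Ω →
        ∀ᵐ x ∂(volume.restrict (ball (0 : EuclideanSpace ℝ (Fin N)) R)),
          ENNReal.ofReal (u x) ≤
            ENNReal.ofReal C * boundarySup (ball (0 : EuclideanSpace ℝ (Fin N)) R) p
              (fun y => max (u y) 0) * ENNReal.ofReal (‖x‖ ^ (-gammaOne N p μ)) := by
  obtain ⟨e, R₀, he, hR₀, hR₀1, hq⟩ :=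
    exists_riccati_supersolution hp hpN hμ0 hμ (show 0 < A + 1 by linarith) hα
  have hγ0 : 0 ≤ gammaOne N p μ := (isLeast_gammaOne hp hpN hμ0 hμ).1.1
  have hN : 0 < N := by
    have : (0 : ℝ) < N := by linarith
    exact_mod_cast this
  have : Nonempty (Fin N) := ⟨⟨0, hN⟩⟩
  -- The constant is the bound for the exponential factor of the barrier, valid for all $R\le
  -- R_0\le1$.
  refine ⟨Real.exp (1 / e), R₀, Real.exp_pos _, hR₀, ?_⟩
  intro Ω _ _ _ _ f hf hfA u hu R hR hRR hΩ
  set M := boundarySup (ball (0 : EuclideanSpace ℝ (Fin N)) R) p (fun y => max (u y) 0) with hM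
  have ne0 : ∀ᵐ x : EuclideanSpace ℝ (Fin N) ∂(volume.restrict (ball 0 R)), x ≠ 0 :=
    ae_restrict_of_ae (Measure.ae_ne volume 0)
  rcases eq_or_ne M ⊤ with hMt | hMt
  · filter_upwards [ne0] with x hx
    have hx' : 0 < ‖x‖ := norm_pos_iff.2 hx
    rw [hMt, ENNReal.mul_top (by simpa using Real.exp_pos _), ENNReal.top_mul]
    · exact le_top
    · simpa using Real.rpow_pos_of_pos hx' _
  set L := M.toReal
  have L0 : 0 ≤ L := ENNReal.toReal_nonneg
  have ML : M = ENNReal.ofReal L := (ENNReal.ofReal_toReal hMt).symm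
  -- The infimum defining $M$ need not be attained, and the comparison needs $k<\kappa$; so
  -- $\kappa=L+1/(n+1)$ is used, leaving room for an admissible $k$ below it, and $n\to\infty$ at
  -- the end.
  have step : ∀ n : ℕ, ∀ᵐ x ∂(volume.restrict (ball (0 : EuclideanSpace ℝ (Fin N)) R)),
      u x ≤ barrier (gammaOne N p μ) e (L + 1 / ((n : ℝ) + 1)) R ‖x‖ := fun n => by
    have pos : 0 < 1 / ((n : ℝ) + 1) := by positivity
    have lt : M < ENNReal.ofReal (L + 1 / ((n : ℝ) + 1)) := by
      rw [ML]; exact (ENNReal.ofReal_lt_ofReal_iff (by positivity)).2 (by linarith)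
    rw [hM, boundarySup, iInf_lt_iff] at lt
    obtain ⟨k, hk⟩ := lt
    rw [iInf_lt_iff] at hk
    obtain ⟨hkz, hk⟩ := hk
    have hk' : (k : ℝ) < L + 1 / ((n : ℝ) + 1) := by
      rw [← ENNReal.ofReal_coe_nnreal] at hk
      exact (ENNReal.ofReal_lt_ofReal_iff (by positivity)).1 hk
    exact le_barrier_of_weakSubsolution hp hpN hμ0 hμ hα he hR₀1 hq hf hfA hu hR hRR hΩ
      k.2 hk' hkz
  filter_upwards [ae_all_iff.2 step, ne0] with x hx hx0
  have hx' : 0 < ‖x‖ := norm_pos_iff.2 hx0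
  have lim : Tendsto (fun n : ℕ => (L + 1 / ((n : ℝ) + 1)) * Real.exp (1 / e) * ‖x‖ ^ (-gammaOne N p μ))
      atTop (𝓝 ((L + 0) * Real.exp (1 / e) * ‖x‖ ^ (-gammaOne N p μ))) :=
    ((tendsto_one_div_add_atTop_nhds_zero_nat.const_add L).mul_const _).mul_const _
  have fin := ge_of_tendsto' lim fun n => (hx n).trans
    (barrier_le hγ0 he (by positivity) hx' hR (hRR.trans hR₀1))
  rw [ML, ← ENNReal.ofReal_mul (Real.exp_pos _).le, ← ENNReal.ofReal_mul (by positivity)]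
  refine ENNReal.ofReal_le_ofReal (fin.trans (le_of_eq (by ring)))
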